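/- Let $d\ge 2$, $\Omega=[0,1]$, and let $M$ be the set of measurable functions $a:\Omega\to S^{d-1}$ (unit sphere of $\mathbb R^d$), functions equal almost everywhere being identified. Write $\dot h=\partial_t h$ and $dh=\partial_s h$ for functions $h(t,s)$ of time $t\in[0,1]$ and of $s\in\Omega$. An \emph{increasing diffeomorphism} of $\Omega$ is understood in the almost-everywhere sense: a strictly increasing absolutely continuous $\varphi:\Omega\to\Omega$ with $\varphi(0)=0$, $\varphi(1)=1$ and $d\varphi>0$ a.e.; $G$ is the group of all of these (it contains all $C^1$ functions $\varphi$ with $\varphi(0)=0$, $\varphi(1)=1$, $d\varphi>0$). A \emph{trajectory} is a curve $t\mapsto(\phi(t),\alpha(t))\in G\times M$, $t\in[0,1]$, with $\phi(0)=\mathrm{id}$, such that $(t,s)\mapsto d\phi(t,s)$ and $(t,s)\mapsto\alpha(t,s)$ are measurable and, for a.e. $s$, $t\mapsto d\phi(t,s)$ is positive and absolutely continuous on $[0,1]$ and $t\mapsto\alpha(t,s)$ is absolutely continuous on $[0,1]$. For $\sigma>0$ its energy is $$U_\sigma(\phi,\alpha)=\int_0^1\!\!\int_\Omega\frac{(d\dot\phi)^2}{d\phi}\,ds\,dt+\frac1{\sigma^2}\int_0^1\!\!\int_\Omega|\dot\alpha|^2\,d\phi\,ds\,dt\in[0,\infty],$$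 where $d\dot\phi=\partial_t(d\phi)$. For $a_0,a_1\in M$ and $\phi_1\in G$ put $$\omega(s)=\arccos\big(a_0(s)^Ta_1(\phi_1(s))\big),\qquad \rho_\sigma(a_0,a_1,\phi_1)=\arccos\int_\Omega\sqrt{d\phi_1(s)}\,\cos\Big(\frac{\omega(s)}{2\sigma}\Big)\,ds .$$ Assume $2\sigma\ge1$. Then the following hold. (1) For all $a_0,a_1\in M$ and $\phi_1\in G$, $$\inf\{U_\sigma(\phi,\alpha):\ \phi(1)=\phi_1,\ \alpha(0)=a_0,\ \alpha(1)=a_1\circ\phi_1\}=4\,\rho_\sigma(a_0,a_1,\phi_1)^2 .$$ (2) If $2\sigma>1$, the infimum in (1) is attained by a trajectory $(\phi,\alpha)$ of the following form. There are a measurable field $a_0^\perp$ of unit vectors with $a_0^Ta_0^\perp=0$ and $a_1\circ\phi_1=\cos\omega\,a_0+\sin\omega\,a_0^\perp$ a.e., and a function $\tau(t,s)$, continuous in $t$ for a.e. $s$, with $\tau(0,\cdot)=0$ and $\tau(1,\cdot)=\omega$, such that $\alpha=\cos\tau\,a_0+\sin\tau\,a_0^\perp$ and such that for every $t\in[0,1]$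 $$\sqrt{d\phi(t,\cdot)}\,\Big(\cos\frac{\tau(t,\cdot)}{2\sigma},\ \sin\frac{\tau(t,\cdot)}{2\sigma}\Big)=\frac{\sin((1-t)\rho)}{\sin\rho}\,q_0+\frac{\sin(t\rho)}{\sin\rho}\,q_1\quad\text{a.e.},$$ which is the great-circle geodesic of the unit sphere of $L^2(\Omega,\mathbb R^2)$ between $q_0=(1,0)$ and $q_1=\sqrt{d\phi_1}\,\big(\cos\frac{\omega}{2\sigma},\sin\frac{\omega}{2\sigma}\big)$; here $\rho=\arccos\langle q_0,q_1\rangle_{L^2}$, and the right-hand side is read as $q_0$ if $q_0=q_1$. (3) Define $$d_\sigma(a_0,a_1)=2\inf_{\phi_1\in G}\rho_\sigma(a_0,a_1,\phi_1).$$ Then for all $a_0,a_1\in M$ $$d_\sigma(a_0,a_1)^2=\inf\{U_\sigma(\phi,\alpha):\ \alpha(0)=a_0,\ \alpha(1)=a_1\circ\phi(1)\},$$ the value $d_\sigma(a_0,a_1)$ is unchanged if, for some $n\in\{1,2,\dots,\infty\}$, the infimum over $\phi_1$ is restricted to the $C^n$ functions $\phi_1:\Omega\to\Omega$ with $\phi_1(0)=0$,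 $\phi_1(1)=1$ and $d\phi_1>0$ everywhere, and $d_\sigma$ is a distance on $M$: it is non-negative, symmetric, satisfies the triangle inequality, and $d_\sigma(a_0,a_1)=0$ if and only if $a_0=a_1$ a.e. -/

import Mathlib

open Set MeasureTheory
open scoped ENNReal

noncomputable section

namespace Metamorphosis

/-- The Euclidean space `ℝ^d`. -/
abbrev E (d : ℕ) : Type := EuclideanSpace ℝ (Fin d)

/-- Lebesgue measure on `Ω = [0,1]`. -/
abbrev lebOmega : Measure ℝ := volume.restrict (Icc (0 : ℝ) 1)

/-- The set `M` of measurable functions from `Ω = [0,1]` to the unit sphere of `ℝ^d`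
(only the values on `[0,1]` matter; functions that agree almost everywhere on `[0,1]`
represent the same element). -/
def unitTangents (d : ℕ) : Set (ℝ → E d) :=
  {a | Measurable a ∧ ∀ s ∈ Icc (0 : ℝ) 1, ‖a s‖ = 1}

/-- The group `G` of increasing diffeomorphisms of `Ω = [0,1]`. As the elements of `M` are only
measurable, diffeomorphisms are understood in the almost-everywhere sense: strictly increasing
absolutely continuous bijections of `[0,1]` whose derivative is positive almost everywhere (the
inverse is then absolutely continuous as well). -/
structure IsDiffeo (φ : ℝ → ℝ) : Prop where
  zero : φ 0 = 0
  one : φ 1 = 1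
  strictMono : StrictMonoOn φ (Icc 0 1)
  absCont : AbsolutelyContinuousOnInterval φ 0 1
  deriv_pos : ∀ᵐ s ∂lebOmega, 0 < deriv φ s

/-- Classical increasing diffeomorphisms of `[0,1]`, of class `C^n`. -/
structure IsClassicalDiffeo (n : ℕ∞) (φ : ℝ → ℝ) : Prop where
  zero : φ 0 = 0
  one : φ 1 = 1
  contDiffOn : ContDiffOn ℝ n φ (Icc 0 1)
  deriv_pos : ∀ s ∈ Icc (0 : ℝ) 1, 0 < derivWithin φ (Icc 0 1) s

/-- A trajectory `t ↦ (φ(t), α(t)) ∈ G × M`, `t ∈ [0,1]`, with `φ(0) = id`. The field `dφ` is the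
`s`-derivative of `φ`. For almost every `s`, `t ↦ dφ(t,s)` is positive and absolutely continuous,
and `t ↦ α(t,s)` is absolutely continuous. -/
structure Trajectory (d : ℕ) where
  /-- the diffeomorphisms, as a function of `t` and `s` -/
  φ : ℝ → ℝ → ℝ
  /-- the space derivative of `φ` -/
  dφ : ℝ → ℝ → ℝ
  /-- the sphere-valued part, as a function of `t` and `s` -/
  α : ℝ → ℝ → E d
  isDiffeo : ∀ t ∈ Icc (0 : ℝ) 1, IsDiffeo (φ t)
  φ_zero : ∀ s ∈ Icc (0 : ℝ) 1, φ 0 s = s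
  hasDerivAt : ∀ t ∈ Icc (0 : ℝ) 1, ∀ᵐ s ∂lebOmega, HasDerivAt (φ t) (dφ t s) s
  dφ_measurable : Measurable (Function.uncurry dφ)
  dφ_pos : ∀ᵐ s ∂lebOmega, ∀ t ∈ Icc (0 : ℝ) 1, 0 < dφ t s
  dφ_absCont : ∀ᵐ s ∂lebOmega, AbsolutelyContinuousOnInterval (fun t => dφ t s) 0 1
  α_mem : ∀ t ∈ Icc (0 : ℝ) 1, α t ∈ unitTangents d
  α_measurable : Measurable (Function.uncurry α)
  α_absCont : ∀ᵐ s ∂lebOmega, AbsolutelyContinuousOnInterval (fun t => α t s) 0 1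

/-- The metamorphosis energy
`U_σ(φ,α) = ∫∫ (∂ₜ dφ)² / dφ ds dt + σ⁻² ∫∫ |∂ₜ α|² dφ ds dt`, with values in `[0,∞]`. -/
def energy {d : ℕ} (σ : ℝ) (T : Trajectory d) : ℝ≥0∞ :=
  (∫⁻ t, ∫⁻ s, ENNReal.ofReal ((deriv (fun r => T.dφ r s) t) ^ 2 / T.dφ t s)
      ∂lebOmega ∂lebOmega) +
    ENNReal.ofReal (1 / σ ^ 2) *
      ∫⁻ t, ∫⁻ s, ENNReal.ofReal (‖deriv (fun r => T.α r s) t‖ ^ 2 * T.dφ t s)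
        ∂lebOmega ∂lebOmega

/-- Boundary conditions `α(0) = a₀`, `α(1) = a₁ ∘ φ(1)` (as elements of `M`). -/
def Joins {d : ℕ} (a₀ a₁ : ℝ → E d) (T : Trajectory d) : Prop :=
  (∀ᵐ s ∂lebOmega, T.α 0 s = a₀ s) ∧ (∀ᵐ s ∂lebOmega, T.α 1 s = a₁ (T.φ 1 s))

/-- Boundary conditions `φ(1) = φ₁`, `α(0) = a₀`, `α(1) = a₁ ∘ φ₁`. -/
def JoinsWith {d : ℕ} (a₀ a₁ : ℝ → E d) (φ₁ : ℝ → ℝ) (T : Trajectory d) : Prop :=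
  (∀ s ∈ Icc (0 : ℝ) 1, T.φ 1 s = φ₁ s) ∧ Joins a₀ a₁ T

/-- `ω(s) = arccos (a₀(s)ᵀ a₁(φ₁(s)))`. -/
def omega {d : ℕ} (a₀ a₁ : ℝ → E d) (φ₁ : ℝ → ℝ) (s : ℝ) : ℝ :=
  Real.arccos (inner ℝ (a₀ s) (a₁ (φ₁ s)))

/-- `arccos ∫ √(dφ₁(s)) cos (ω(s) / (2σ)) ds`. -/
def rho {d : ℕ} (σ : ℝ) (a₀ a₁ : ℝ → E d) (φ₁ : ℝ → ℝ) : ℝ :=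
  Real.arccos (∫ s in Icc (0 : ℝ) 1,
    Real.sqrt (deriv φ₁ s) * Real.cos (omega a₀ a₁ φ₁ s / (2 * σ)))

/-- `d_σ(a₀,a₁) = 2 inf_{φ₁} arccos ∫ √(dφ₁(s)) cos (ω(s) / (2σ)) ds`. -/
def elasticDist {d : ℕ} (σ : ℝ) (a₀ a₁ : ℝ → E d) : ℝ :=
  2 * ⨅ φ₁ : {φ : ℝ → ℝ // IsDiffeo φ}, rho σ a₀ a₁ φ₁.1

/-- The great-circle geodesic from `x` to `y` on the unit sphere of a Hilbert space,
parametrized proportionally to arc length (for unit vectors `x`, `y` with `x ≠ -y`):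
`sin((1-t)ρ)/sin ρ x + sin(tρ)/sin ρ y` with `ρ = arccos ⟨x,y⟩`, constant if `x = y`. -/
def greatCircle {H : Type*} [NormedAddCommGroup H] [InnerProductSpace ℝ H] (x y : H) (t : ℝ) : H :=
  open scoped Classical in
  if x = y then x else
    (Real.sin ((1 - t) * Real.arccos (inner ℝ x y)) / Real.sin (Real.arccos (inner ℝ x y))) • x +
      (Real.sin (t * Real.arccos (inner ℝ x y)) / Real.sin (Real.arccos (inner ℝ x y))) • y

/-- The square-root transform of a density `h` and an angle `τ`:
`√h (cos (τ/(2σ)), sin (τ/(2σ))) ∈ ℝ²`. -/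
def sqrtTransform (σ h τ : ℝ) : E 2 :=
  Real.sqrt h • !₂[Real.cos (τ / (2 * σ)), Real.sin (τ / (2 * σ))]

/-- The trajectory `T` is deduced from a great circle of the unit sphere of `L²(Ω,ℝ²)`:
`α = cos τ a₀ + sin τ a₀^⊥`, where `a₀^⊥` is a measurable unit vector field orthogonal to `a₀` with
`a₁ ∘ φ₁ = cos ω a₀ + sin ω a₀^⊥` and `τ` is a time-continuous angle going from `0` to `ω`
(so that the `S^{d-1}`-valued problem is reduced to the `S¹`-valued one for `(cos τ, sin τ)`), and
the square-root transform of `(dφ, τ)` is the great-circle geodesic from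
`q₀ = (1,0)` to `q₁ = √(dφ₁) (cos (ω/(2σ)), sin (ω/(2σ)))`. -/
def IsGreatCircleLift {d : ℕ} (σ : ℝ) (a₀ a₁ : ℝ → E d) (φ₁ : ℝ → ℝ) (T : Trajectory d) : Prop :=
  ∃ (b : ℝ → E d) (τ : ℝ → ℝ → ℝ) (q₀ q₁ : Lp (E 2) 2 lebOmega),
    b ∈ unitTangents d ∧
    (∀ᵐ s ∂lebOmega, inner ℝ (a₀ s) (b s) = 0 ∧
      a₁ (φ₁ s) = Real.cos (omega a₀ a₁ φ₁ s) • a₀ s + Real.sin (omega a₀ a₁ φ₁ s) • b s) ∧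
    (∀ᵐ s ∂lebOmega, ContinuousOn (fun t => τ t s) (Icc 0 1) ∧
      τ 0 s = 0 ∧ τ 1 s = omega a₀ a₁ φ₁ s ∧
      ∀ t ∈ Icc (0 : ℝ) 1, T.α t s = Real.cos (τ t s) • a₀ s + Real.sin (τ t s) • b s) ∧
    (q₀ =ᵐ[lebOmega] fun _ => !₂[1, 0]) ∧
    (q₁ =ᵐ[lebOmega] fun s => sqrtTransform σ (deriv φ₁ s) (omega a₀ a₁ φ₁ s)) ∧
    ‖q₀‖ = 1 ∧ ‖q₁‖ = 1 ∧
    ∀ t ∈ Icc (0 : ℝ) 1,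
      ((greatCircle q₀ q₁ t : Lp (E 2) 2 lebOmega) : ℝ → E 2) =ᵐ[lebOmega] fun s => sqrtTransform σ (T.dφ t s) (τ t s)

end Metamorphosis

end

/-! ### Absolute continuity, angle versus chord, and measurability of time derivatives. -/

namespace Metamorphosis

open Filter Topology

/-! The square-root transform turns the energy into the kinetic energy of a curve on a sphere. Let
`θ(t,s)` be the angle between `α(0,s)` and `α(t,s)`, and put `q(t) = √(dφ) (cos (θ/2σ), sin
(θ/2σ))`. Since `∫ dφ ds = 1`, `q(t)` is a unit vector of `L²(Ω, ℝ²)`, and since `|θ̇| ≤ |α̇|`, the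
squared speed of `q` is at most one quarter of the energy density. The endpoints of `q` make the
angle `ρ_σ`, and the length of a spherical curve is at least the angle between its ends, so `U_σ ≥ 4
ρ_σ²` (`four_mul_rho_sq_le_energy`). The argument uses only increments of `q`: a pointwise bound in
`s` (`ofReal_sqrtTransform_sub_sq_le`), Tonelli, and finer and finer subdivisions of `[0,1]`
(`ofReal_angle_sq_le_lintegral`).

Conversely, if `2σ > 1`, then `ω/2σ < π`. The great circle from `1` to `√(dφ₁) exp(iω/2σ)`, seen as
a complex-valued function `z(t,s)`, then avoids the negative real axis, so `dφ = |z|²` and `τ = 2σ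
arg z` are smooth in `t` and give a trajectory of energy exactly `4 ρ_σ²`
(`exists_greatCircle_trajectory`). If `2σ = 1`, the circle may pass through `0` for some `s`. The
infimum is then reached by applying the construction to parameters decreasing to `σ` and passing to
the limit (`iInf_energy_joinsWith`).

The properties of `d_σ` rest on the continuity of the correlation `∫ √(dφ) cos (ω/2σ)` when the
derivatives of the diffeomorphisms converge in `L¹` (`tendsto_corr_of_derivGap`). It allows `φ₁` to
be smooth (`elasticDist_eq_iInf_classical`). It also gives definiteness: if `d_σ = 0`, the almost
optimal `φ₁` converge to the identity, whose correlation must then be `1`. Symmetry and the triangle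
inequality are proved with `C¹` diffeomorphisms, by inversion and composition; the latter is the
triangle inequality for angles in `L²(Ω, ℝ²)` (`rho_comp_le`). -/

theorem absolutelyContinuousOnInterval_of_dist_le {X Y : Type*} [PseudoMetricSpace X]
    [PseudoMetricSpace Y] {f : ℝ → X} {g : ℝ → Y} {a b K : ℝ}
    (hg : AbsolutelyContinuousOnInterval g a b)
    (h : ∀ x ∈ uIcc a b, ∀ y ∈ uIcc a b, dist (f x) (f y) ≤ K * dist (g x) (g y)) :
    AbsolutelyContinuousOnInterval f a b := by
  have hK : Tendsto (fun E : ℕ × (ℕ → ℝ × ℝ) ↦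
      K * ∑ i ∈ Finset.range E.1, dist (g (E.2 i).1) (g (E.2 i).2))
      (AbsolutelyContinuousOnInterval.totalLengthFilter ⊓
        𝓟 (AbsolutelyContinuousOnInterval.disjWithin a b)) (𝓝 0) := by
    simpa using Tendsto.const_mul K hg
  refine squeeze_zero' (Eventually.of_forall fun E => Finset.sum_nonneg fun _ _ => dist_nonneg)
    ?_ hK
  filter_upwards [mem_inf_of_right (mem_principal_self _)] with E hE
  rw [Finset.mul_sum]
  refine Finset.sum_le_sum fun i hi => ?_
  exact h _ (hE.1 i hi).1 _ (hE.1 i hi).2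

theorem ae_lebOmega_of_ae {p : ℝ → Prop} (h : ∀ᵐ x : ℝ, x ∈ uIcc (0 : ℝ) 1 → p x) :
    ∀ᵐ x ∂lebOmega, p x := by
  rw [ae_restrict_iff' measurableSet_Icc]
  simpa [uIcc_of_le (zero_le_one' ℝ)] using h

theorem ae_mem_Ioo : ∀ᵐ x ∂lebOmega, x ∈ Ioo (0 : ℝ) 1 := by
  have : lebOmega = volume.restrict (Ioo (0 : ℝ) 1) := restrict_Ioo_eq_restrict_Icc.symm
  rw [this]
  exact ae_restrict_mem measurableSet_Ioo

theorem ae_mem_Icc : ∀ᵐ x ∂lebOmega, x ∈ Icc (0 : ℝ) 1 :=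
  ae_restrict_mem measurableSet_Icc

theorem ae_differentiableAt_of_absolutelyContinuous {V : Type*} [NormedAddCommGroup V]
    [NormedSpace ℝ V] [FiniteDimensional ℝ V] {f : ℝ → V}
    (hf : AbsolutelyContinuousOnInterval f 0 1) : ∀ᵐ t ∂lebOmega, DifferentiableAt ℝ f t :=
  ae_lebOmega_of_ae hf.boundedVariationOn.ae_differentiableAt_of_mem_uIcc

/-- Cauchy–Schwarz applied to `f b - f a = ∫ f'`. Stated in `[0,∞]`, it needs no square
integrability of `f'`. -/
theorem ofReal_sq_sub_le {f : ℝ → ℝ} {a b : ℝ} (hab : a ≤ b)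
    (hf : AbsolutelyContinuousOnInterval f a b) :
    ENNReal.ofReal ((f b - f a) ^ 2) ≤
      ENNReal.ofReal (b - a) * ∫⁻ t in Ioc a b, ENNReal.ofReal ((deriv f t) ^ 2) := by
  have h1 : ‖f b - f a‖ₑ ≤ ∫⁻ t in Ioc a b, ‖deriv f t‖ₑ := by
    rw [← hf.integral_deriv_eq_sub, intervalIntegral.integral_of_le hab]
    exact enorm_integral_le_lintegral_enorm _
  have hm : AEMeasurable (fun t => ‖deriv f t‖ₑ) (volume.restrict (Ioc a b)) :=
    (measurable_deriv f).enorm.aemeasurable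
  have h2 := ENNReal.lintegral_mul_le_Lp_mul_Lq (volume.restrict (Ioc a b))
    Real.HolderConjugate.two_two hm (aemeasurable_const (b := (1 : ℝ≥0∞)))
  have e : ∀ x : ℝ, ENNReal.ofReal (x ^ 2) = ‖x‖ₑ ^ 2 := fun x => by
    rw [← sq_abs, ENNReal.ofReal_pow (abs_nonneg x), Real.enorm_eq_ofReal_abs]
  simp only [Pi.mul_apply, mul_one, ENNReal.rpow_ofNat, one_pow, lintegral_const,
    Measure.restrict_apply_univ, Real.volume_Ioc, one_mul] at h2
  simp only [e]
  calc ‖f b - f a‖ₑ ^ 2 ≤ _ := pow_le_pow_left' (h1.trans h2) 2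
    _ = _ := by
        rw [mul_pow, ← ENNReal.rpow_natCast, ← ENNReal.rpow_natCast, ← ENNReal.rpow_mul,
          ← ENNReal.rpow_mul]
        norm_num
        rw [mul_comm]

/-- The chord is `2 sin (θ/2)`. In the first bound the error is cubic, so it disappears when a curve
is subdivided; the second is Jordan's inequality and serves as a global Lipschitz bound. -/
theorem angle_le_chord {V : Type*} [NormedAddCommGroup V] [InnerProductSpace ℝ V]
    {x y : V} (hx : ‖x‖ = 1) (hy : ‖y‖ = 1) :
    InnerProductGeometry.angle x y ≤ ‖x - y‖ + ‖x - y‖ ^ 3 ∧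
      InnerProductGeometry.angle x y ≤ Real.pi / 2 * ‖x - y‖ := by
  set θ := InnerProductGeometry.angle x y with hθ
  have h0 : 0 ≤ θ := InnerProductGeometry.angle_nonneg x y
  have hpi : θ ≤ Real.pi := InnerProductGeometry.angle_le_pi x y
  have hc : inner ℝ x y = Real.cos θ := by
    have := InnerProductGeometry.cos_angle_mul_norm_mul_norm x y
    rw [hx, hy] at this
    linarith
  have hs0 : 0 ≤ Real.sin (θ / 2) := Real.sin_nonneg_of_nonneg_of_le_pi (by linarith) (by linarith)
  have hn : ‖x - y‖ = 2 * Real.sin (θ / 2) := by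
    rw [← sq_eq_sq₀ (norm_nonneg _) (by positivity), norm_sub_sq_real, hx, hy, hc]
    have := Real.cos_two_mul (θ / 2)
    have h3 := Real.sin_sq_add_cos_sq (θ / 2)
    rw [show 2 * (θ / 2) = θ by ring] at this
    rw [this]
    nlinarith
  have hb := Real.mul_le_sin (x := θ / 2) (by linarith) (by linarith)
  have hcube := Real.sin_ge_sub_cube (x := θ / 2) (by linarith)
  have hp := Real.pi_pos
  have hb' : θ / 2 ≤ Real.pi / 2 * Real.sin (θ / 2) := by
    have := mul_le_mul_of_nonneg_left hb (show (0 : ℝ) ≤ Real.pi / 2 by positivity)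
    have e : Real.pi / 2 * (2 / Real.pi * (θ / 2)) = θ / 2 := by field_simp
    linarith
  refine ⟨?_, ?_⟩
  · rw [hn]
    have h4 : θ / 2 ≤ 2 * Real.sin (θ / 2) :=
      hb'.trans (mul_le_mul_of_nonneg_right (by linarith [Real.pi_le_four]) hs0)
    have h5 : (θ / 2) ^ 3 ≤ (2 * Real.sin (θ / 2)) ^ 3 := pow_le_pow_left₀ (by linarith) h4 3
    have h6 : 0 ≤ (Real.sin (θ / 2)) ^ 3 := by positivity
    nlinarith
  · rw [hn]; linarith

theorem tendsto_diffQuot {V : Type*} [NormedAddCommGroup V] [NormedSpace ℝ V] {f : ℝ → V} {t : ℝ}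
    {v : V} (h : HasDerivAt f v t) :
    Tendsto (fun n : ℕ => ((n : ℝ) + 1) • (f (t + 1 / ((n : ℝ) + 1)) - f t)) atTop (𝓝 v) := by
  have h1 := h.tendsto_slope_zero
  have h2 : Tendsto (fun n : ℕ => 1 / ((n : ℝ) + 1)) atTop (𝓝[≠] 0) := by
    refine tendsto_nhdsWithin_iff.2 ⟨tendsto_one_div_add_atTop_nhds_zero_nat,
      Eventually.of_forall fun n => ?_⟩
    have : (0 : ℝ) < 1 / ((n : ℝ) + 1) := by positivity
    exact this.ne'
  refine (h1.comp h2).congr fun n => ?_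
  simp

/-- Differentiability in `t` holds a.e. on almost every line `s = const`, but Fubini needs a
measurable set in the plane. The set `D` below is such a set: on it the limit `L` of difference
quotients is the derivative, at least where `F(·,s)` is continuous on `[0,1]`. -/
theorem aemeasurable_deriv_param {V : Type*} [NormedAddCommGroup V] [NormedSpace ℝ V]
    [FiniteDimensional ℝ V] [CompleteSpace V] [SecondCountableTopology V] [MeasurableSpace V]
    [BorelSpace V] {F : ℝ → ℝ → V} (hF : Measurable (Function.uncurry F))
    (hac : ∀ᵐ s ∂lebOmega, AbsolutelyContinuousOnInterval (fun t => F t s) 0 1) :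
    AEMeasurable (fun p : ℝ × ℝ => deriv (fun r => F r p.2) p.1) (lebOmega.prod lebOmega) := by
  have hFm : ∀ {u v : ℝ × ℝ → ℝ}, Measurable u → Measurable v →
      Measurable fun p => F (u p) (v p) := fun hu hv => hF.comp (hu.prodMk hv)
  set g : ℕ → ℝ × ℝ → V := fun n p =>
    ((n : ℝ) + 1) • (F (p.1 + 1 / ((n : ℝ) + 1)) p.2 - F p.1 p.2) with hg
  have hgm : ∀ n, StronglyMeasurable (g n) := fun n =>
    (((hFm (measurable_fst.add_const _) measurable_snd).sub
      (hFm measurable_fst measurable_snd)).const_smul ((n : ℝ) + 1)).stronglyMeasurable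
  set L : ℝ × ℝ → V := fun p => limUnder atTop (fun n => g n p) with hL
  have hLm : Measurable L := (StronglyMeasurable.limUnder hgm).measurable
  -- Differentiability with derivative `L`, tested on rational increments only: countably many
  -- conditions, hence measurable. Density of `ℚ` and continuity in `t` recover all real increments
  -- in `hconv`.
  set D : Set (ℝ × ℝ) := ⋂ k : ℕ, ⋃ m : ℕ, ⋂ q : ℚ, {p | |(q : ℝ)| < 1 / ((m : ℝ) + 1) →
    ‖F (p.1 + q) p.2 - F p.1 p.2 - (q : ℝ) • L p‖ ≤ 1 / ((k : ℝ) + 1) * |(q : ℝ)|} with hD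
  have hDm : MeasurableSet D := by
    refine MeasurableSet.iInter fun k => MeasurableSet.iUnion fun m => MeasurableSet.iInter
      fun q => ?_
    by_cases hq : |(q : ℝ)| < 1 / ((m : ℝ) + 1)
    · simp only [hq, forall_const]
      exact measurableSet_le (((hFm (measurable_fst.add_const _) measurable_snd).sub
        (hFm measurable_fst measurable_snd)).sub (hLm.const_smul (q : ℝ))).norm measurable_const
    · simp only [hq, false_imp_iff]
      exact MeasurableSet.univ
  have hdiff : ∀ t s, DifferentiableAt ℝ (fun r => F r s) t →
      L (t, s) = deriv (fun r => F r s) t ∧ (t, s) ∈ D := by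
    intro t s h
    have h1 : L (t, s) = deriv (fun r => F r s) t := (tendsto_diffQuot h.hasDerivAt).limUnder_eq
    refine ⟨h1, ?_⟩
    simp only [hD, mem_iInter, mem_iUnion, mem_ofPred_eq]
    intro k
    have h2 := (hasDerivAt_iff_isLittleO_nhds_zero.1 h.hasDerivAt).def
      (show (0 : ℝ) < 1 / ((k : ℝ) + 1) by positivity)
    obtain ⟨ε, hε, h3⟩ := Metric.eventually_nhds_iff.1 h2
    obtain ⟨m, hm⟩ := exists_nat_one_div_lt hε
    refine ⟨m, fun q hq => ?_⟩
    have := h3 (y := (q : ℝ)) (by rw [dist_zero_right, Real.norm_eq_abs]; exact hq.trans hm)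
    rwa [h1, ← Real.norm_eq_abs]
  have hconv : ∀ t s, t ∈ Ioo (0 : ℝ) 1 → ContinuousOn (fun r => F r s) (Icc 0 1) → (t, s) ∈ D →
      HasDerivAt (fun r => F r s) (L (t, s)) t := by
    intro t s ht hc hp
    rw [hasDerivAt_iff_isLittleO_nhds_zero, Asymptotics.isLittleO_iff]
    intro c hcpos
    obtain ⟨k, hk⟩ := exists_nat_one_div_lt hcpos
    simp only [hD, mem_iInter, mem_iUnion, mem_ofPred_eq] at hp
    obtain ⟨m, hm⟩ := hp k
    set U : Set ℝ := Ioo (-(1 / ((m : ℝ) + 1))) (1 / ((m : ℝ) + 1)) ∩ Ioo (-t) (1 - t) with hU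
    have hUo : IsOpen U := isOpen_Ioo.inter isOpen_Ioo
    have h0U : (0 : ℝ) ∈ U := by
      have : (0 : ℝ) < 1 / ((m : ℝ) + 1) := by positivity
      exact ⟨⟨by linarith, this⟩, by linarith [ht.1], by linarith [ht.2]⟩
    have hcU : ContinuousOn (fun h : ℝ => F (t + h) s) U := by
      refine hc.comp (continuous_const.add continuous_id).continuousOn fun h hh => ?_
      have := hh.2
      exact ⟨by change 0 ≤ t + h; linarith [this.1], by change t + h ≤ 1; linarith [this.2]⟩
    filter_upwards [hUo.mem_nhds h0U] with h hh
    have hcl : h ∈ closure (U ∩ range ((↑) : ℚ → ℝ)) := by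
      have := (Rat.denseRange_cast (𝕜 := ℝ)).open_subset_closure_inter hUo hh
      simpa using this
    have hle : ∀ x ∈ U ∩ range ((↑) : ℚ → ℝ), ‖F (t + x) s - F t s - x • L (t, s)‖ ≤
        1 / ((k : ℝ) + 1) * |x| := by
      rintro x ⟨hx, q, rfl⟩
      exact hm q (abs_lt.2 hx.1)
    have h5 : ‖F (t + h) s - F t s - h • L (t, s)‖ ≤ 1 / ((k : ℝ) + 1) * |h| := by
      have c1 : ContinuousWithinAt (fun x : ℝ => ‖F (t + x) s - F t s - x • L (t, s)‖)
          (U ∩ range ((↑) : ℚ → ℝ)) h :=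
        ((((hcU h hh).mono inter_subset_left).sub continuousWithinAt_const).sub
          (continuousWithinAt_id.smul continuousWithinAt_const)).norm
      have c2 : ContinuousWithinAt (fun x : ℝ => 1 / ((k : ℝ) + 1) * |x|)
          (U ∩ range ((↑) : ℚ → ℝ)) h := by fun_prop
      exact ContinuousWithinAt.closure_le hcl c1 c2 hle
    refine h5.trans ?_
    rw [Real.norm_eq_abs]
    exact mul_le_mul_of_nonneg_right hk.le (abs_nonneg _)
  have hsec : ∀ᵐ s ∂lebOmega, lebOmega ((fun t => (t, s)) ⁻¹' Dᶜ) = 0 := by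
    filter_upwards [hac] with s hs
    have := ae_differentiableAt_of_absolutelyContinuous hs
    refine measure_mono_null ?_ (ae_iff.1 this)
    intro t ht hd
    exact ht (hdiff t s hd).2
  have hDae : ∀ᵐ p ∂lebOmega.prod lebOmega, p ∈ D := by
    rw [ae_iff]
    change (lebOmega.prod lebOmega) Dᶜ = 0
    rw [Measure.prod_apply_symm hDm.compl, lintegral_eq_zero_iff
      (measurable_measure_prodMk_right hDm.compl)]
    exact hsec
  refine ⟨L, hLm, ?_⟩
  filter_upwards [hDae, Measure.quasiMeasurePreserving_snd.ae hac,
    Measure.quasiMeasurePreserving_fst.ae ae_mem_Ioo] with p h1 h2 h3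
  have hc := h2.continuousOn
  rw [uIcc_of_le zero_le_one] at hc
  exact (hconv p.1 p.2 h3 hc h1).deriv

end Metamorphosis

/-! ### Diffeomorphisms, the correlation, and the square-root transform into `L²(Ω, ℝ²)`. -/

namespace Metamorphosis

open Filter Topology

/-- The correlation `∫ √(dφ) cos (ω / (2σ)) ds`, whose `arccos` is `rho`. -/
noncomputable def corr {d : ℕ} (σ : ℝ) (a₀ a₁ : ℝ → E d) (φ : ℝ → ℝ) : ℝ :=
  ∫ s in Icc (0 : ℝ) 1, Real.sqrt (deriv φ s) * Real.cos (omega a₀ a₁ φ s / (2 * σ))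

theorem rho_eq_arccos_corr {d : ℕ} (σ : ℝ) (a₀ a₁ : ℝ → E d) (φ : ℝ → ℝ) :
    rho σ a₀ a₁ φ = Real.arccos (corr σ a₀ a₁ φ) := rfl

theorem rho_nonneg {d : ℕ} (σ : ℝ) (a₀ a₁ : ℝ → E d) (φ : ℝ → ℝ) : 0 ≤ rho σ a₀ a₁ φ :=
  Real.arccos_nonneg _

namespace IsDiffeo

variable {φ : ℝ → ℝ}

theorem mapsTo (h : IsDiffeo φ) : MapsTo φ (Icc 0 1) (Icc 0 1) := fun _ hs =>
  ⟨h.zero ▸ h.strictMono.monotoneOn (left_mem_Icc.2 zero_le_one) hs hs.1,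
    h.one ▸ h.strictMono.monotoneOn hs (right_mem_Icc.2 zero_le_one) hs.2⟩

theorem intervalIntegrable (h : IsDiffeo φ) : IntervalIntegrable (deriv φ) volume 0 1 :=
  h.absCont.intervalIntegrable_deriv

theorem integrable (h : IsDiffeo φ) : Integrable (deriv φ) lebOmega := by
  have := h.intervalIntegrable
  rwa [intervalIntegrable_iff_integrableOn_Icc_of_le zero_le_one] at this

theorem integral_deriv_eq (h : IsDiffeo φ) {s : ℝ} (hs : s ∈ Icc (0 : ℝ) 1) :
    ∫ x in (0 : ℝ)..s, deriv φ x = φ s := by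
  have hm : uIcc 0 s ⊆ uIcc (0 : ℝ) 1 := by
    rw [uIcc_of_le hs.1, uIcc_of_le zero_le_one]
    exact Icc_subset_Icc_right hs.2
  rw [(h.absCont.mono hm).integral_deriv_eq_sub, h.zero, sub_zero]

theorem integral_deriv (h : IsDiffeo φ) : ∫ s, deriv φ s ∂lebOmega = 1 := by
  rw [integral_Icc_eq_integral_Ioc, ← intervalIntegral.integral_of_le zero_le_one,
    h.integral_deriv_eq (right_mem_Icc.2 zero_le_one), h.one]

/-- Nothing is known of `φ` outside `[0,1]`. Clamping the argument gives a monotone function on the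
whole line that agrees with `φ` on `[0,1]`. -/
theorem measurable_clamp (h : IsDiffeo φ) : Measurable fun s => φ (max 0 (min 1 s)) := by
  refine Monotone.measurable fun s t hst => ?_
  exact h.strictMono.monotoneOn ⟨le_max_left _ _, by simp⟩ ⟨le_max_left _ _, by simp⟩
    (max_le_max le_rfl (min_le_min le_rfl hst))

theorem ae_differentiableAt (h : IsDiffeo φ) : ∀ᵐ s ∂lebOmega, DifferentiableAt ℝ φ s :=
  ae_differentiableAt_of_absolutelyContinuous h.absCont

/-- Change of variables on the set of differentiability points, which is conull in `[0,1]` and is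
mapped injectively into `[0,1]`. The inequality suffices for upper bounds and requires no discussion
of the image. -/
theorem lintegral_deriv_mul_comp_le (h : IsDiffeo φ) (g : ℝ → ℝ≥0∞) :
    ∫⁻ s, ENNReal.ofReal (deriv φ s) * g (φ s) ∂lebOmega ≤ ∫⁻ s, g s ∂lebOmega := by
  set D : Set ℝ := Icc 0 1 ∩ {s | DifferentiableAt ℝ φ s} with hD
  have hDm : MeasurableSet D := measurableSet_Icc.inter (measurableSet_of_differentiableAt ℝ φ)
  have h1 : D =ᵐ[volume] Icc (0 : ℝ) 1 := by
    filter_upwards [(ae_restrict_iff' measurableSet_Icc).1 h.ae_differentiableAt] with s hs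
    exact propext ⟨fun h => h.1, fun h => ⟨h, hs h⟩⟩
  have h2 := lintegral_image_eq_lintegral_abs_deriv_mul hDm
    (fun s hs => hs.2.hasDerivAt.hasDerivWithinAt)
    (h.strictMono.injOn.mono inter_subset_left) g
  calc ∫⁻ s, ENNReal.ofReal (deriv φ s) * g (φ s) ∂lebOmega
      = ∫⁻ s in D, ENNReal.ofReal (deriv φ s) * g (φ s) := (setLIntegral_congr h1).symm
    _ ≤ ∫⁻ s in D, ENNReal.ofReal |deriv φ s| * g (φ s) :=
        lintegral_mono fun s => mul_le_mul_left (ENNReal.ofReal_le_ofReal (le_abs_self _)) _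
    _ = ∫⁻ s in φ '' D, g s := h2.symm
    _ ≤ ∫⁻ s, g s ∂lebOmega := lintegral_mono_set
        ((image_mono inter_subset_left).trans h.mapsTo.image_subset)

end IsDiffeo

theorem clamp_eq {s : ℝ} (hs : s ∈ Icc (0 : ℝ) 1) : max 0 (min 1 s) = s := by
  rw [min_eq_right hs.2, max_eq_right hs.1]

theorem isDiffeo_id : IsDiffeo fun s => s where
  zero := rfl
  one := rfl
  strictMono := strictMono_id.strictMonoOn _
  absCont := (LipschitzWith.id.lipschitzOnWith).absolutelyContinuousOnInterval
  deriv_pos := by simp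

theorem aemeasurable_comp_diffeo {X : Type*} [MeasurableSpace X] {a : ℝ → X} {φ : ℝ → ℝ}
    (ha : Measurable a) (h : IsDiffeo φ) : AEMeasurable (fun s => a (φ s)) lebOmega := by
  refine ⟨fun s => a (φ (max 0 (min 1 s))), ha.comp h.measurable_clamp, ?_⟩
  filter_upwards [ae_mem_Icc] with s hs
  rw [clamp_eq hs]

theorem aemeasurable_omega {d : ℕ} {a₀ a₁ : ℝ → E d} {φ : ℝ → ℝ} (h₀ : a₀ ∈ unitTangents d)
    (h₁ : a₁ ∈ unitTangents d) (h : IsDiffeo φ) : AEMeasurable (omega a₀ a₁ φ) lebOmega :=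
  Real.continuous_arccos.measurable.comp_aemeasurable
    (h₀.1.aemeasurable.inner (aemeasurable_comp_diffeo h₁.1 h))

theorem omega_nonneg {d : ℕ} (a₀ a₁ : ℝ → E d) (φ : ℝ → ℝ) (s : ℝ) : 0 ≤ omega a₀ a₁ φ s :=
  Real.arccos_nonneg _

theorem omega_le_pi {d : ℕ} (a₀ a₁ : ℝ → E d) (φ : ℝ → ℝ) (s : ℝ) : omega a₀ a₁ φ s ≤ Real.pi :=
  Real.arccos_le_pi _

theorem omega_eq_angle {d : ℕ} {a₀ a₁ : ℝ → E d} {φ : ℝ → ℝ} {s : ℝ} (h₀ : ‖a₀ s‖ = 1)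
    (h₁ : ‖a₁ (φ s)‖ = 1) : omega a₀ a₁ φ s = InnerProductGeometry.angle (a₀ s) (a₁ (φ s)) := by
  simp [omega, InnerProductGeometry.angle, h₀, h₁]

section SqrtTransform

theorem inner_sqrtTransform (σ h₁ τ₁ h₂ τ₂ : ℝ) :
    inner ℝ (sqrtTransform σ h₁ τ₁) (sqrtTransform σ h₂ τ₂) =
      √h₁ * √h₂ * Real.cos (τ₁ / (2 * σ) - τ₂ / (2 * σ)) := by
  simp only [sqrtTransform, PiLp.inner_apply, Fin.sum_univ_two, PiLp.smul_apply, smul_eq_mul]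
  simp [Real.cos_sub]
  ring

variable {h τ h₁ τ₁ h₂ τ₂ : ℝ → ℝ}

theorem memLp_sqrtTransform (σ : ℝ) (hh : Integrable h lebOmega) (hτ : AEMeasurable τ lebOmega) :
    MemLp (fun s => sqrtTransform σ (h s) (τ s)) 2 lebOmega := by
  have hm : AEStronglyMeasurable (fun s => sqrtTransform σ (h s) (τ s)) lebOmega := by
    have h1 : AEMeasurable (fun s => √(h s)) lebOmega :=
      Real.continuous_sqrt.measurable.comp_aemeasurable hh.aemeasurable
    have h2 : Continuous fun θ : ℝ => (!₂[Real.cos (θ / (2 * σ)), Real.sin (θ / (2 * σ))] : E 2) := by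
      fun_prop
    exact (h1.smul (h2.measurable.comp_aemeasurable hτ)).aestronglyMeasurable
  rw [memLp_two_iff_integrable_sq_norm hm]
  refine hh.mono (hm.norm.pow 2) (Eventually.of_forall fun s => ?_)
  rw [← real_inner_self_eq_norm_sq, inner_sqrtTransform, sub_self, Real.cos_zero, mul_one]
  rcases le_total 0 (h s) with h0 | h0
  · rw [Real.mul_self_sqrt h0]
  · rw [Real.sqrt_eq_zero_of_nonpos h0]; simp

theorem inner_toLp_sqrtTransform {σ : ℝ}
    (m₁ : MemLp (fun s => sqrtTransform σ (h₁ s) (τ₁ s)) 2 lebOmega)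
    (m₂ : MemLp (fun s => sqrtTransform σ (h₂ s) (τ₂ s)) 2 lebOmega) :
    inner ℝ (m₁.toLp _) (m₂.toLp _) =
      ∫ s, √(h₁ s) * √(h₂ s) * Real.cos (τ₁ s / (2 * σ) - τ₂ s / (2 * σ)) ∂lebOmega := by
  rw [L2.inner_def]
  refine integral_congr_ae ?_
  filter_upwards [m₁.coeFn_toLp, m₂.coeFn_toLp] with s e₁ e₂
  rw [e₁, e₂, inner_sqrtTransform]

theorem norm_toLp_sqrtTransform {σ : ℝ}
    (m : MemLp (fun s => sqrtTransform σ (h s) (τ s)) 2 lebOmega) (h0 : ∀ᵐ s ∂lebOmega, 0 ≤ h s)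
    (h1 : ∫ s, h s ∂lebOmega = 1) : ‖m.toLp _‖ = 1 := by
  have : ‖m.toLp _‖ ^ 2 = 1 := by
    rw [← real_inner_self_eq_norm_sq, inner_toLp_sqrtTransform, ← h1]
    refine integral_congr_ae ?_
    filter_upwards [h0] with s hs
    simp [Real.mul_self_sqrt hs]
  exact (pow_eq_one_iff_of_nonneg (norm_nonneg _) two_ne_zero).1 this

end SqrtTransform

theorem integrable_sqrt_deriv {φ : ℝ → ℝ} (h : IsDiffeo φ) :
    Integrable (fun s => √(deriv φ s)) lebOmega := by
  refine ((integrable_const (1 : ℝ)).add h.integrable.norm).mono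
    (Real.continuous_sqrt.measurable.comp (measurable_deriv φ)).aestronglyMeasurable
    (Eventually.of_forall fun s => ?_)
  have h0 := abs_nonneg (deriv φ s)
  simp only [Pi.add_apply, Real.norm_eq_abs, abs_of_nonneg (Real.sqrt_nonneg _)]
  rw [abs_of_nonneg (by positivity)]
  refine (Real.sqrt_le_sqrt (le_abs_self _)).trans ?_
  rw [Real.sqrt_le_left (by positivity)]
  nlinarith

theorem integrable_corr {d : ℕ} (σ : ℝ) {a₀ a₁ : ℝ → E d} {φ : ℝ → ℝ} (h₀ : a₀ ∈ unitTangents d)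
    (h₁ : a₁ ∈ unitTangents d) (h : IsDiffeo φ) :
    Integrable (fun s => √(deriv φ s) * Real.cos (omega a₀ a₁ φ s / (2 * σ))) lebOmega := by
  refine (integrable_sqrt_deriv h).mul_bdd (c := 1) ?_ (Eventually.of_forall fun s => ?_)
  · exact (Real.continuous_cos.measurable.comp_aemeasurable
      ((aemeasurable_omega h₀ h₁ h).div_const _)).aestronglyMeasurable
  · exact Real.abs_cos_le_one _

/-- `√x ≤ (1 + x)/2`, integrated against `∫ φ' = 1`. -/
theorem integral_sqrt_deriv_le {φ : ℝ → ℝ} (h : IsDiffeo φ) :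
    ∫ s, √(deriv φ s) ∂lebOmega ≤ 1 := by
  have h1 : ∫ s, √(deriv φ s) ∂lebOmega ≤ ∫ s, (1 + deriv φ s) / 2 ∂lebOmega := by
    refine integral_mono_ae (integrable_sqrt_deriv h)
      (((integrable_const 1).add h.integrable).div_const 2) ?_
    filter_upwards [h.deriv_pos] with s hs
    nlinarith [Real.sq_sqrt hs.le, sq_nonneg (√(deriv φ s) - 1)]
  rw [integral_div, integral_add (integrable_const _) h.integrable, h.integral_deriv] at h1
  simpa using h1

theorem corr_le_integral_sqrt_deriv {d : ℕ} (σ : ℝ) {a₀ a₁ : ℝ → E d} {φ : ℝ → ℝ}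
    (h₀ : a₀ ∈ unitTangents d) (h₁ : a₁ ∈ unitTangents d) (h : IsDiffeo φ) :
    corr σ a₀ a₁ φ ≤ ∫ s, √(deriv φ s) ∂lebOmega := by
  refine integral_mono (integrable_corr σ h₀ h₁ h) (integrable_sqrt_deriv h) fun s => ?_
  exact mul_le_of_le_one_right (Real.sqrt_nonneg _) (Real.cos_le_one _)

namespace IsClassicalDiffeo

variable {n : ℕ∞} {φ : ℝ → ℝ}

theorem mono {m : ℕ∞} (h : IsClassicalDiffeo n φ) (hm : m ≤ n) : IsClassicalDiffeo m φ where
  zero := h.zero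
  one := h.one
  contDiffOn := h.contDiffOn.of_le (by exact_mod_cast hm)
  deriv_pos := h.deriv_pos

theorem hasDerivWithinAt (h : IsClassicalDiffeo 1 φ) {s : ℝ} (hs : s ∈ Icc (0 : ℝ) 1) :
    HasDerivWithinAt φ (derivWithin φ (Icc 0 1) s) (Icc 0 1) s :=
  ((h.contDiffOn.differentiableOn (by simp)) s hs).hasDerivWithinAt

theorem hasDerivAt (h : IsClassicalDiffeo 1 φ) {s : ℝ} (hs : s ∈ Ioo (0 : ℝ) 1) :
    HasDerivAt φ (derivWithin φ (Icc 0 1) s) s :=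
  (h.hasDerivWithinAt (Ioo_subset_Icc_self hs)).hasDerivAt (Icc_mem_nhds hs.1 hs.2)

theorem strictMonoOn (h : IsClassicalDiffeo 1 φ) : StrictMonoOn φ (Icc 0 1) := by
  refine strictMonoOn_of_deriv_pos (convex_Icc 0 1) h.contDiffOn.continuousOn fun s hs => ?_
  rw [interior_Icc] at hs
  rw [(h.hasDerivAt hs).deriv]
  exact h.deriv_pos s (Ioo_subset_Icc_self hs)

theorem isDiffeo (h : IsClassicalDiffeo 1 φ) : IsDiffeo φ where
  zero := h.zero
  one := h.one
  strictMono := h.strictMonoOn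
  absCont := ContDiffOn.absolutelyContinuousOnInterval (by
    rw [uIcc_of_le zero_le_one]; exact h.contDiffOn)
  deriv_pos := by
    filter_upwards [ae_mem_Ioo] with s hs
    rw [(h.hasDerivAt hs).deriv]
    exact h.deriv_pos s (Ioo_subset_Icc_self hs)

theorem image (h : IsClassicalDiffeo 1 φ) : φ '' Icc 0 1 = Icc 0 1 := by
  refine subset_antisymm h.isDiffeo.mapsTo.image_subset ?_
  have := intermediate_value_Icc (zero_le_one' ℝ) h.contDiffOn.continuousOn
  rwa [h.zero, h.one] at this

/-- Here the image is all of `[0,1]`, so the change of variables is an equality, for arbitrary `g`.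
Symmetry and the triangle inequality use it. -/
theorem integral_comp (h : IsClassicalDiffeo 1 φ) (g : ℝ → ℝ) :
    ∫ s, g s ∂lebOmega = ∫ s, deriv φ s * g (φ s) ∂lebOmega := by
  have h1 := integral_image_eq_integral_abs_deriv_smul measurableSet_Icc
    (fun s hs => h.hasDerivWithinAt hs) h.strictMonoOn.injOn g
  rw [h.image] at h1
  rw [h1]
  refine integral_congr_ae ?_
  filter_upwards [ae_mem_Ioo] with s hs
  rw [(h.hasDerivAt hs).deriv, abs_of_pos (h.deriv_pos s (Ioo_subset_Icc_self hs)), smul_eq_mul]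

end IsClassicalDiffeo

end Metamorphosis

/-! ### Length of curves on a sphere, and the pointwise speed estimate. -/

namespace Metamorphosis

open Filter Topology

/-- With `U = ∫ e` and `N = n + 1` equal pieces, the chords satisfy `∑ cᵢ² ≤ U/N`. Hence `∑ cᵢ ≤ √U`
by Cauchy–Schwarz, and `∑ cᵢ³ ≤ (U/N) √(U/N)` tends to `0`. Adding up angles by the triangle
inequality and letting `N → ∞` gives `angle ≤ √U`, without differentiating `q` in the Hilbert space.
-/
theorem ofReal_angle_sq_le_lintegral {H : Type*} [NormedAddCommGroup H] [InnerProductSpace ℝ H]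
    {q : ℝ → H} {e : ℝ → ℝ≥0∞} (hq : ∀ t ∈ Icc (0 : ℝ) 1, ‖q t‖ = 1)
    (h : ∀ a b : ℝ, 0 ≤ a → a ≤ b → b ≤ 1 →
      ENNReal.ofReal (‖q b - q a‖ ^ 2) ≤ ENNReal.ofReal (b - a) * ∫⁻ t in Ioc a b, e t) :
    ENNReal.ofReal (InnerProductGeometry.angle (q 0) (q 1) ^ 2) ≤ ∫⁻ t in Ioc (0 : ℝ) 1, e t := by
  rcases eq_or_ne (∫⁻ t in Ioc (0 : ℝ) 1, e t) ⊤ with htop | htop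
  · rw [htop]; exact le_top
  set U := (∫⁻ t in Ioc (0 : ℝ) 1, e t).toReal with hU
  have hU0 : 0 ≤ U := ENNReal.toReal_nonneg
  set θ := InnerProductGeometry.angle (q 0) (q 1)
  have key : ∀ n : ℕ, θ ≤ √U + U / ((n : ℝ) + 1) * √(U / ((n : ℝ) + 1)) := by
    intro n
    set N : ℝ := (n : ℝ) + 1 with hN
    have hNpos : 0 < N := by positivity
    set p : ℕ → ℝ := fun i => (i : ℝ) / N with hp
    have hp0 : p 0 = 0 := by simp [hp]
    have hpn : p (n + 1) = 1 := by
      simp only [hp, hN]; push_cast; exact div_self (by positivity)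
    have hpmono : Monotone p := fun i j hij =>
      div_le_div_of_nonneg_right (by exact_mod_cast hij) hNpos.le
    have hpmem : ∀ i ≤ n + 1, p i ∈ Icc (0 : ℝ) 1 := fun i hi =>
      ⟨hp0 ▸ hpmono (Nat.zero_le i), hpn ▸ hpmono hi⟩
    set w : ℕ → ℝ := fun i => (∫⁻ t in Ioc (p i) (p (i + 1)), e t).toReal with hw
    set c : ℕ → ℝ := fun i => ‖q (p i) - q (p (i + 1))‖ with hc
    have hc0 : ∀ i, 0 ≤ c i := fun i => norm_nonneg _
    have hfin : ∀ a b : ℝ, 0 ≤ a → b ≤ 1 → ∫⁻ t in Ioc a b, e t ≠ ⊤ := fun a b ha hb =>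
      ne_top_of_le_ne_top htop (lintegral_mono_set (Ioc_subset_Ioc ha hb))
    have hsum : ∀ k ≤ n + 1, ∑ i ∈ Finset.range k, w i =
        (∫⁻ t in Ioc (0 : ℝ) (p k), e t).toReal := by
      intro k hk
      induction k with
      | zero => simp [hp0]
      | succ k ih =>
        rw [Finset.sum_range_succ, ih (by omega), hw,
          ← ENNReal.toReal_add (hfin _ _ le_rfl (hpmem k (by omega)).2)
            (hfin _ _ (hpmem k (by omega)).1 (hpmem (k + 1) hk).2),
          ← lintegral_union measurableSet_Ioc (Ioc_disjoint_Ioc_of_le le_rfl),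
          Ioc_union_Ioc_eq_Ioc (hpmem k (by omega)).1 (hpmono (Nat.le_succ k))]
    have hcw : ∀ i < n + 1, c i ^ 2 ≤ w i / N := by
      intro i hi
      have h1 := h (p i) (p (i + 1)) (hpmem i hi.le).1 (hpmono (Nat.le_succ i))
        (hpmem (i + 1) hi).2
      have hd : p (i + 1) - p i = 1 / N := by
        simp only [hp]; push_cast; ring
      rw [hd] at h1
      have h2 := ENNReal.toReal_mono (ENNReal.mul_ne_top ENNReal.ofReal_ne_top
        (hfin _ _ (hpmem i hi.le).1 (hpmem (i + 1) hi).2)) h1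
      rw [ENNReal.toReal_mul, ENNReal.toReal_ofReal (by positivity),
        ENNReal.toReal_ofReal (by positivity), norm_sub_rev] at h2
      calc c i ^ 2 ≤ _ := h2
        _ = w i / N := by simp only [hw]; ring
    have hsq : ∑ i ∈ Finset.range (n + 1), c i ^ 2 ≤ U / N := by
      have h1 : ∑ i ∈ Finset.range (n + 1), c i ^ 2 ≤ ∑ i ∈ Finset.range (n + 1), w i / N :=
        Finset.sum_le_sum fun i hi => hcw i (Finset.mem_range.1 hi)
      rwa [← Finset.sum_div, hsum (n + 1) le_rfl, hpn] at h1
    have hle : ∀ i ∈ Finset.range (n + 1), c i ≤ √(U / N) := by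
      intro i hi
      refine Real.le_sqrt_of_sq_le (le_trans ?_ hsq)
      exact Finset.single_le_sum (f := fun i => c i ^ 2) (fun j _ => sq_nonneg _) hi
    have hlin : ∑ i ∈ Finset.range (n + 1), c i ≤ √U := by
      refine Real.le_sqrt_of_sq_le ?_
      have h1 := sq_sum_le_card_mul_sum_sq (s := Finset.range (n + 1)) (f := c)
      rw [Finset.card_range] at h1
      have h2 : ((n + 1 : ℕ) : ℝ) * (U / N) = U := by
        rw [hN]; push_cast; field_simp
      calc _ ≤ _ := h1
        _ ≤ ((n + 1 : ℕ) : ℝ) * (U / N) := mul_le_mul_of_nonneg_left hsq (by positivity)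
        _ = U := h2
    have hcub : ∑ i ∈ Finset.range (n + 1), c i ^ 3 ≤ U / N * √(U / N) := by
      calc ∑ i ∈ Finset.range (n + 1), c i ^ 3
          ≤ ∑ i ∈ Finset.range (n + 1), c i ^ 2 * √(U / N) := by
            refine Finset.sum_le_sum fun i hi => ?_
            rw [pow_succ]
            exact mul_le_mul_of_nonneg_left (hle i hi) (sq_nonneg _)
        _ ≤ U / N * √(U / N) := by
            rw [← Finset.sum_mul]
            exact mul_le_mul_of_nonneg_right hsq (Real.sqrt_nonneg _)
    have hchain : ∀ k ≤ n + 1, InnerProductGeometry.angle (q 0) (q (p k)) ≤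
        ∑ i ∈ Finset.range k, (c i + c i ^ 3) := by
      intro k hk
      induction k with
      | zero =>
        have h1 : ‖q 0‖ = 1 := hq 0 (left_mem_Icc.2 zero_le_one)
        rw [hp0, InnerProductGeometry.angle_self (norm_ne_zero_iff.1 (by rw [h1]; norm_num))]
        simp
      | succ k ih =>
        rw [Finset.sum_range_succ]
        exact (InnerProductGeometry.angle_le_angle_add_angle _ (q (p k)) _).trans
          (add_le_add (ih (by omega)) (angle_le_chord (hq _ (hpmem k (by omega)))
            (hq _ (hpmem (k + 1) hk))).1)
    have hfinal := hchain (n + 1) le_rfl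
    rw [hpn, Finset.sum_add_distrib] at hfinal
    exact hfinal.trans (add_le_add hlin hcub)
  have hlim : Tendsto (fun n : ℕ => √U + U / ((n : ℝ) + 1) * √(U / ((n : ℝ) + 1))) atTop
      (𝓝 (√U)) := by
    have h1 : Tendsto (fun n : ℕ => U / ((n : ℝ) + 1)) atTop (𝓝 0) := by
      simpa [div_eq_mul_inv] using (tendsto_one_div_add_atTop_nhds_zero_nat (𝕜 := ℝ)).const_mul U
    simpa using (h1.mul ((Real.continuous_sqrt.tendsto _).comp h1)).const_add (√U)
  have hθ : θ ≤ √U := ge_of_tendsto' hlim key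
  have hθ0 : 0 ≤ θ := InnerProductGeometry.angle_nonneg _ _
  rw [← ENNReal.ofReal_toReal htop]
  refine ENNReal.ofReal_le_ofReal ?_
  calc θ ^ 2 ≤ (√U) ^ 2 := pow_le_pow_left₀ hθ0 hθ 2
    _ = U := Real.sq_sqrt hU0

/-- The angle to a fixed vector is 1-Lipschitz for the angular distance, and angular distance equals
chord up to a cubic error, which vanishes in the difference quotient. -/
theorem abs_deriv_angle_le {V : Type*} [NormedAddCommGroup V] [InnerProductSpace ℝ V]
    {α : ℝ → V} {v α' : V} {θ' t : ℝ} (hunit : ∀ᶠ r in 𝓝 t, ‖α r‖ = 1) (hα : HasDerivAt α α' t)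
    (hθ : HasDerivAt (fun r => InnerProductGeometry.angle v (α r)) θ' t) : |θ'| ≤ ‖α'‖ := by
  have h1 := (hasDerivAt_iff_tendsto_slope.1 hθ).norm
  have h2 := (hasDerivAt_iff_tendsto_slope.1 hα).norm
  have h3 : Tendsto (fun r => 1 + ‖α r - α t‖ ^ 2) (𝓝[≠] t) (𝓝 1) := by
    have : Tendsto (fun r => 1 + ‖α r - α t‖ ^ 2) (𝓝 t) (𝓝 (1 + ‖α t - α t‖ ^ 2)) :=
      (((hα.continuousAt.sub continuousAt_const).norm.pow 2).const_add 1)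
    simpa using this.mono_left nhdsWithin_le_nhds
  have h4 := h2.mul h3
  rw [mul_one] at h4
  refine le_of_tendsto_of_tendsto h1 h4 ?_
  filter_upwards [mem_nhdsWithin_of_mem_nhds hunit] with r hr
  have ht := hunit.self_of_nhds
  simp only [slope, vsub_eq_sub, norm_smul, smul_eq_mul, norm_mul]
  rw [mul_assoc]
  refine mul_le_mul_of_nonneg_left ?_ (norm_nonneg (r - t)⁻¹)
  have h5 := (angle_le_chord hr ht).1
  have h6 := InnerProductGeometry.angle_le_angle_add_angle v (α r) (α t)
  have h7 := InnerProductGeometry.angle_le_angle_add_angle v (α t) (α r)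
  rw [InnerProductGeometry.angle_comm (α t) (α r)] at h7
  have h8 : |InnerProductGeometry.angle v (α r) - InnerProductGeometry.angle v (α t)| ≤
      InnerProductGeometry.angle (α r) (α t) := abs_le.2 ⟨by linarith, by linarith⟩
  rw [Real.norm_eq_abs]
  exact h8.trans (h5.trans (le_of_eq (by ring)))

/-- In polar coordinates the squared speed of `√h exp(iθ/2σ)` is `¼ (h'²/h + h θ'²/σ²)`, and `|θ'| ≤
|α'|`. Each Cartesian coordinate is absolutely continuous, so `ofReal_sq_sub_le` applies to it. -/
theorem ofReal_sqrtTransform_sub_sq_le {d : ℕ} {σ : ℝ} (hσ : 0 < σ) {h : ℝ → ℝ} {α : ℝ → E d}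
    (hpos : ∀ t ∈ Icc (0 : ℝ) 1, 0 < h t) (hac : AbsolutelyContinuousOnInterval h 0 1)
    (hα : ∀ t ∈ Icc (0 : ℝ) 1, ‖α t‖ = 1) (hαac : AbsolutelyContinuousOnInterval α 0 1)
    {a b : ℝ} (ha : 0 ≤ a) (hab : a ≤ b) (hb : b ≤ 1) :
    ENNReal.ofReal (‖sqrtTransform σ (h b) (InnerProductGeometry.angle (α 0) (α b)) -
        sqrtTransform σ (h a) (InnerProductGeometry.angle (α 0) (α a))‖ ^ 2) ≤
      ENNReal.ofReal (b - a) * ∫⁻ t in Ioc a b, 4⁻¹ * (ENNReal.ofReal ((deriv h t) ^ 2 / h t) +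
        ENNReal.ofReal (1 / σ ^ 2) * ENNReal.ofReal (‖deriv α t‖ ^ 2 * h t)) := by
  have hu : uIcc (0 : ℝ) 1 = Icc 0 1 := uIcc_of_le zero_le_one
  set θ : ℝ → ℝ := fun t => InnerProductGeometry.angle (α 0) (α t) with hθ
  have hhc : ContinuousOn h (Icc 0 1) := hu ▸ hac.continuousOn
  obtain ⟨t₀, ht₀, hmin⟩ := isCompact_Icc.exists_isMinOn (nonempty_Icc.2 zero_le_one) hhc
  have hm : 0 < h t₀ := hpos t₀ ht₀
  -- The square root is Lipschitz only away from `0`; the positive minimum `h t₀` on `[0,1]`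
  -- supplies the constant.
  have hrac : AbsolutelyContinuousOnInterval (fun t => √(h t)) 0 1 := by
    refine absolutelyContinuousOnInterval_of_dist_le (K := 1 / √(h t₀)) hac fun x hx y hy => ?_
    rw [hu] at hx hy
    have s0 := Real.sqrt_pos.2 hm
    have sx : √(h t₀) ≤ √(h x) := Real.sqrt_le_sqrt (hmin hx)
    have sy : √(h t₀) ≤ √(h y) := Real.sqrt_le_sqrt (hmin hy)
    rw [Real.dist_eq, Real.dist_eq]
    have e : |h x - h y| = |√(h x) - √(h y)| * (√(h x) + √(h y)) := by
      rw [← abs_of_pos (show 0 < √(h x) + √(h y) by linarith), ← abs_mul]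
      congr 1
      nlinarith [Real.sq_sqrt (hpos x hx).le, Real.sq_sqrt (hpos y hy).le]
    rw [e, one_div, inv_mul_eq_div, le_div_iff₀ s0]
    exact mul_le_mul_of_nonneg_left (by linarith) (abs_nonneg _)
  have hθac : AbsolutelyContinuousOnInterval θ 0 1 := by
    refine absolutelyContinuousOnInterval_of_dist_le (K := Real.pi / 2) hαac fun x hx y hy => ?_
    rw [hu] at hx hy
    have h5 := (angle_le_chord (hα x hx) (hα y hy)).2
    have h6 := InnerProductGeometry.angle_le_angle_add_angle (α 0) (α x) (α y)
    have h7 := InnerProductGeometry.angle_le_angle_add_angle (α 0) (α y) (α x)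
    rw [InnerProductGeometry.angle_comm (α y) (α x)] at h7
    rw [Real.dist_eq, dist_eq_norm]
    exact (abs_le.2 ⟨by simp only [hθ]; linarith, by simp only [hθ]; linarith⟩).trans h5
  have htrig : ∀ {g : ℝ → ℝ}, LipschitzWith 1 g →
      AbsolutelyContinuousOnInterval (fun t => g (θ t / (2 * σ))) 0 1 := by
    intro g hg
    refine absolutelyContinuousOnInterval_of_dist_le (K := 1 / (2 * σ)) hθac fun x _ y _ => ?_
    refine (hg.dist_le_mul _ _).trans ?_
    rw [Real.dist_eq, Real.dist_eq, ← sub_div, abs_div, abs_of_pos (show 0 < 2 * σ by linarith)]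
    simp [div_eq_inv_mul]
  have hcac := htrig Real.lipschitzWith_cos
  have hsac := htrig Real.lipschitzWith_sin
  have hxac : AbsolutelyContinuousOnInterval (fun t => √(h t) * Real.cos (θ t / (2 * σ))) 0 1 :=
    hrac.mul hcac
  have hyac : AbsolutelyContinuousOnInterval (fun t => √(h t) * Real.sin (θ t / (2 * σ))) 0 1 :=
    hrac.mul hsac
  set x : ℝ → ℝ := fun t => √(h t) * Real.cos (θ t / (2 * σ)) with hx
  set y : ℝ → ℝ := fun t => √(h t) * Real.sin (θ t / (2 * σ)) with hy
  have hsub : uIcc a b ⊆ uIcc (0 : ℝ) 1 := by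
    rw [hu, uIcc_of_le hab]; exact Icc_subset_Icc ha hb
  have ix := ofReal_sq_sub_le hab (hxac.mono hsub)
  have iy := ofReal_sq_sub_le hab (hyac.mono hsub)
  have hnorm : ‖sqrtTransform σ (h b) (θ b) - sqrtTransform σ (h a) (θ a)‖ ^ 2 =
      (x b - x a) ^ 2 + (y b - y a) ^ 2 := by
    rw [EuclideanSpace.norm_sq_eq, Fin.sum_univ_two]
    simp [sqrtTransform, hx, hy]
  rw [hnorm, ENNReal.ofReal_add (sq_nonneg _) (sq_nonneg _)]
  refine (add_le_add ix iy).trans ?_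
  rw [← mul_add, ← lintegral_add_left ((measurable_deriv x).pow_const 2).ennreal_ofReal]
  refine mul_le_mul_right (lintegral_mono_ae ?_) _
  have hle : volume.restrict (Ioc a b) ≤ lebOmega :=
    Measure.restrict_mono_set _ (Ioc_subset_Icc_self.trans (Icc_subset_Icc ha hb))
  refine ae_mono hle ?_
  filter_upwards [ae_differentiableAt_of_absolutelyContinuous hac,
    ae_differentiableAt_of_absolutelyContinuous hαac,
    ae_differentiableAt_of_absolutelyContinuous hθac, ae_mem_Ioo] with t dh dα dθ ht
  have htI := Ioo_subset_Icc_self ht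
  have hht := hpos t htI
  have hθ' : |deriv θ t| ≤ ‖deriv α t‖ := by
    refine abs_deriv_angle_le ?_ dα.hasDerivAt dθ.hasDerivAt
    filter_upwards [Icc_mem_nhds ht.1 ht.2] with r hr using hα r hr
  have hr' := dh.hasDerivAt.sqrt hht.ne'
  have hφ' := dθ.hasDerivAt.div_const (2 * σ)
  have hx' : HasDerivAt x _ t := hr'.mul hφ'.cos
  have hy' : HasDerivAt y _ t := hr'.mul hφ'.sin
  rw [hx'.deriv, hy'.deriv, ← ENNReal.ofReal_add (sq_nonneg _) (sq_nonneg _),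
    ← ENNReal.ofReal_mul (by positivity), ← ENNReal.ofReal_add (by positivity) (by positivity),
    show (4⁻¹ : ℝ≥0∞) = ENNReal.ofReal 4⁻¹ by
      rw [ENNReal.ofReal_inv_of_pos (by norm_num)]; norm_num,
    ← ENNReal.ofReal_mul (by norm_num)]
  refine ENNReal.ofReal_le_ofReal ?_
  have s1 := Real.sin_sq_add_cos_sq (θ t / (2 * σ))
  have hsq : √(h t) ^ 2 = h t := Real.sq_sqrt hht.le
  have hθ2 : (deriv θ t) ^ 2 ≤ ‖deriv α t‖ ^ 2 := by
    rw [← sq_abs]; exact pow_le_pow_left₀ (abs_nonneg _) hθ' 2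
  have e1 : (deriv h t / (2 * √(h t))) ^ 2 + h t * (deriv θ t / (2 * σ)) ^ 2 ≤
      4⁻¹ * ((deriv h t) ^ 2 / h t + 1 / σ ^ 2 * (‖deriv α t‖ ^ 2 * h t)) := by
    have : 4⁻¹ * ((deriv h t) ^ 2 / h t + 1 / σ ^ 2 * ((deriv θ t) ^ 2 * h t)) =
        (deriv h t / (2 * √(h t))) ^ 2 + h t * (deriv θ t / (2 * σ)) ^ 2 := by
      rw [div_pow, mul_pow, hsq]
      field_simp
      ring
    rw [← this]
    gcongr
  refine le_trans (le_of_eq ?_) e1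
  rw [← hsq, Real.sqrt_sq (Real.sqrt_nonneg _)]
  linear_combination ((deriv h t / (2 * √(h t))) ^ 2 +
    √(h t) ^ 2 * (deriv θ t / (2 * σ)) ^ 2) * s1

end Metamorphosis

/-! ### The lower bound for the energy. -/

namespace Metamorphosis

open Filter Topology

namespace Trajectory

variable {d : ℕ} (σ : ℝ) (T : Trajectory d)

/-- The integrand of the energy. -/
noncomputable def density (t s : ℝ) : ℝ≥0∞ :=
  ENNReal.ofReal ((deriv (fun r => T.dφ r s) t) ^ 2 / T.dφ t s) +
    ENNReal.ofReal (1 / σ ^ 2) * ENNReal.ofReal (‖deriv (fun r => T.α r s) t‖ ^ 2 * T.dφ t s)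

theorem aemeasurable_φ_part : AEMeasurable (fun p : ℝ × ℝ =>
    ENNReal.ofReal ((deriv (fun r => T.dφ r p.2) p.1) ^ 2 / T.dφ p.1 p.2))
    (lebOmega.prod lebOmega) :=
  (((aemeasurable_deriv_param T.dφ_measurable T.dφ_absCont).pow_const 2).div
    T.dφ_measurable.aemeasurable).ennreal_ofReal

theorem aemeasurable_α_part : AEMeasurable (fun p : ℝ × ℝ =>
    ENNReal.ofReal (‖deriv (fun r => T.α r p.2) p.1‖ ^ 2 * T.dφ p.1 p.2))
    (lebOmega.prod lebOmega) :=
  (((aemeasurable_deriv_param T.α_measurable T.α_absCont).norm.pow_const 2).mul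
    T.dφ_measurable.aemeasurable).ennreal_ofReal

theorem aemeasurable_density :
    AEMeasurable (fun p : ℝ × ℝ => T.density σ p.1 p.2) (lebOmega.prod lebOmega) :=
  T.aemeasurable_φ_part.add (T.aemeasurable_α_part.const_mul _)

theorem energy_eq_lintegral_density :
    energy σ T = ∫⁻ t, ∫⁻ s, T.density σ t s ∂lebOmega ∂lebOmega := by
  rw [energy, ← lintegral_prod _ T.aemeasurable_φ_part, ← lintegral_prod _ T.aemeasurable_α_part,
    ← lintegral_prod _ (T.aemeasurable_density σ), ← lintegral_const_mul'' _ T.aemeasurable_α_part,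
    ← lintegral_add_left' T.aemeasurable_φ_part]
  rfl

variable {T}

theorem ae_deriv_φ {t : ℝ} (ht : t ∈ Icc (0 : ℝ) 1) :
    ∀ᵐ s ∂lebOmega, deriv (T.φ t) s = T.dφ t s := by
  filter_upwards [T.hasDerivAt t ht] with s hs using hs.deriv

theorem integrable_dφ {t : ℝ} (ht : t ∈ Icc (0 : ℝ) 1) : Integrable (T.dφ t) lebOmega :=
  (T.isDiffeo t ht).integrable.congr (ae_deriv_φ ht)

theorem integral_dφ {t : ℝ} (ht : t ∈ Icc (0 : ℝ) 1) : ∫ s, T.dφ t s ∂lebOmega = 1 := by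
  rw [← (T.isDiffeo t ht).integral_deriv]
  exact integral_congr_ae ((ae_deriv_φ ht).mono fun s hs => hs.symm)

variable (T)

/-- The angle travelled on the sphere. -/
noncomputable def angle (t s : ℝ) : ℝ := InnerProductGeometry.angle (T.α 0 s) (T.α t s)

variable {T}

theorem aemeasurable_angle (t : ℝ) : AEMeasurable (T.angle t) lebOmega := by
  have h : ∀ t, Measurable (T.α t) := fun t => T.α_measurable.comp measurable_prodMk_left
  exact (Real.continuous_arccos.measurable.comp
    (((h 0).inner (h t)).div ((h 0).norm.mul (h t).norm))).aemeasurable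

theorem memLp_lift {t : ℝ} (ht : t ∈ Icc (0 : ℝ) 1) :
    MemLp (fun s => sqrtTransform σ (T.dφ t s) (T.angle t s)) 2 lebOmega :=
  memLp_sqrtTransform σ (integrable_dφ ht) (aemeasurable_angle t)

/-- The lift `q(t)` lies on the unit sphere of `L²(Ω, ℝ²)`. Integrating the pointwise increment
bound in `s` and exchanging the integrals gives the hypothesis of `ofReal_angle_sq_le_lintegral`
with a quarter of the energy density. -/
theorem four_mul_rho_sq_le_energy (hσ : 0 < σ) {a₀ a₁ : ℝ → E d}
    {φ₁ : ℝ → ℝ} (hT : JoinsWith a₀ a₁ φ₁ T) :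
    ENNReal.ofReal (4 * rho σ a₀ a₁ φ₁ ^ 2) ≤ energy σ T := by
  classical
  have h0 : (0 : ℝ) ∈ Icc (0 : ℝ) 1 := left_mem_Icc.2 zero_le_one
  have h1 : (1 : ℝ) ∈ Icc (0 : ℝ) 1 := right_mem_Icc.2 zero_le_one
  -- The lift is known to be square integrable only for `t ∈ [0,1]`; the value `0` elsewhere plays
  -- no role.
  set q : ℝ → Lp (E 2) 2 lebOmega := fun t =>
    if ht : t ∈ Icc (0 : ℝ) 1 then (T.memLp_lift σ ht).toLp _ else 0 with hq
  have hqt : ∀ t (ht : t ∈ Icc (0 : ℝ) 1), q t = (T.memLp_lift σ ht).toLp _ := fun t ht => by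
    simp only [hq, dif_pos ht]
  have hpos : ∀ t ∈ Icc (0 : ℝ) 1, ∀ᵐ s ∂lebOmega, 0 ≤ T.dφ t s := fun t ht => by
    filter_upwards [T.dφ_pos] with s hs using (hs t ht).le
  have hnorm : ∀ t ∈ Icc (0 : ℝ) 1, ‖q t‖ = 1 := fun t ht => by
    rw [hqt t ht]
    exact norm_toLp_sqrtTransform _ (hpos t ht) (integral_dφ ht)
  have hincr : ∀ a b : ℝ, 0 ≤ a → a ≤ b → b ≤ 1 → ENNReal.ofReal (‖q b - q a‖ ^ 2) ≤
      ENNReal.ofReal (b - a) * ∫⁻ t in Ioc a b, 4⁻¹ * ∫⁻ s, T.density σ t s ∂lebOmega := by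
    intro a b ha hab hb
    have haI : a ∈ Icc (0 : ℝ) 1 := ⟨ha, hab.trans hb⟩
    have hbI : b ∈ Icc (0 : ℝ) 1 := ⟨ha.trans hab, hb⟩
    set f : ℝ → E 2 := fun s => sqrtTransform σ (T.dφ b s) (T.angle b s) -
      sqrtTransform σ (T.dφ a s) (T.angle a s) with hf
    have hfm : MemLp f 2 lebOmega := (T.memLp_lift σ hbI).sub (T.memLp_lift σ haI)
    have e1 : q b - q a = hfm.toLp f := by
      rw [hqt b hbI, hqt a haI, ← MemLp.toLp_sub]; rfl
    have e2 : ‖q b - q a‖ ^ 2 = ∫ s, ‖f s‖ ^ 2 ∂lebOmega := by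
      rw [e1, ← real_inner_self_eq_norm_sq, L2.inner_def]
      refine integral_congr_ae ?_
      filter_upwards [hfm.coeFn_toLp] with s hs
      rw [hs, real_inner_self_eq_norm_sq]
    rw [e2, ofReal_integral_eq_lintegral_ofReal
      ((memLp_two_iff_integrable_sq_norm hfm.aestronglyMeasurable).1 hfm)
      (Eventually.of_forall fun s => sq_nonneg _)]
    have hle : ∫⁻ s, ENNReal.ofReal (‖f s‖ ^ 2) ∂lebOmega ≤
        ∫⁻ s, (ENNReal.ofReal (b - a) * ∫⁻ t in Ioc a b, 4⁻¹ * T.density σ t s) ∂lebOmega := by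
      refine lintegral_mono_ae ?_
      filter_upwards [T.dφ_pos, T.dφ_absCont, T.α_absCont, ae_mem_Icc] with s p1 p2 p3 p4
      exact ofReal_sqrtTransform_sub_sq_le hσ p1 p2 (fun t ht => (T.α_mem t ht).2 s p4) p3 ha hab hb
    refine hle.trans ?_
    have hres : (lebOmega.prod lebOmega).restrict (Ioc a b ×ˢ univ) =
        (volume.restrict (Ioc a b)).prod lebOmega := by
      rw [← Measure.prod_restrict, Measure.restrict_univ,
        Measure.restrict_restrict measurableSet_Ioc, inter_eq_left.2
          (Ioc_subset_Icc_self.trans (Icc_subset_Icc ha hb))]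
    have hm : AEMeasurable (fun p : ℝ × ℝ => 4⁻¹ * T.density σ p.1 p.2)
        ((volume.restrict (Ioc a b)).prod lebOmega) := by
      rw [← hres]
      exact ((T.aemeasurable_density σ).const_mul _).restrict
    rw [lintegral_const_mul' _ _ ENNReal.ofReal_ne_top]
    refine mul_le_mul_right ?_ _
    rw [← lintegral_lintegral_swap hm]
    refine lintegral_mono fun t => ?_
    exact (lintegral_const_mul' _ _ (by simp)).le
  have hang := ofReal_angle_sq_le_lintegral hnorm hincr
  have hfinal : ∫⁻ t in Ioc (0 : ℝ) 1, 4⁻¹ * ∫⁻ s, T.density σ t s ∂lebOmega =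
      4⁻¹ * energy σ T := by
    rw [lintegral_const_mul' _ _ (by simp), energy_eq_lintegral_density, restrict_Ioc_eq_restrict_Icc]
  rw [hfinal] at hang
  have hrho : rho σ a₀ a₁ φ₁ = InnerProductGeometry.angle (q 0) (q 1) := by
    rw [InnerProductGeometry.angle, hnorm 0 h0, hnorm 1 h1, rho]
    congr 1
    rw [mul_one, div_one, hqt 0 h0, hqt 1 h1, inner_toLp_sqrtTransform]
    refine integral_congr_ae ?_
    -- `φ(0)` is the identity on `[0,1]` only, hence the restriction to interior points, where this
    -- determines the derivative.
    have hφ0 : ∀ᵐ s ∂lebOmega, T.dφ 0 s = 1 := by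
      filter_upwards [T.hasDerivAt 0 h0, ae_mem_Ioo] with s hs hsI
      refine hs.unique ((hasDerivAt_id s).congr_of_eventuallyEq ?_)
      filter_upwards [Icc_mem_nhds hsI.1 hsI.2] with r hr using T.φ_zero r hr
    have hφ1 : ∀ᵐ s ∂lebOmega, T.dφ 1 s = deriv φ₁ s := by
      filter_upwards [T.hasDerivAt 1 h1, ae_mem_Ioo] with s hs hsI
      refine (HasDerivAt.deriv ?_).symm
      refine hs.congr_of_eventuallyEq ?_
      filter_upwards [Icc_mem_nhds hsI.1 hsI.2] with r hr using (hT.1 r hr).symm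
    filter_upwards [hφ0, hφ1, hT.2.1, hT.2.2, ae_mem_Icc] with s e0 e1 j0 j1 hs
    have u0 := (T.α_mem 0 h0).2 s hs
    have u1 := (T.α_mem 1 h1).2 s hs
    have z0 : T.angle 0 s = 0 :=
      InnerProductGeometry.angle_self (norm_ne_zero_iff.1 (by rw [u0]; norm_num))
    have z1 : T.angle 1 s = omega a₀ a₁ φ₁ s := by
      rw [omega, Trajectory.angle, InnerProductGeometry.angle, u0, u1, j0, j1, hT.1 s hs]
      simp
    rw [z0, z1, e0, e1, Real.sqrt_one, one_mul, zero_div, zero_sub, Real.cos_neg]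
  rw [hrho, ENNReal.ofReal_mul (by norm_num)]
  calc ENNReal.ofReal 4 * ENNReal.ofReal (InnerProductGeometry.angle (q 0) (q 1) ^ 2)
      ≤ ENNReal.ofReal 4 * (4⁻¹ * energy σ T) := mul_le_mul_right hang _
    _ = energy σ T := by
        rw [← mul_assoc, ENNReal.ofReal_ofNat, ENNReal.mul_inv_cancel (by norm_num) (by norm_num),
          one_mul]

end Trajectory

end Metamorphosis

/-! ### Great circles in `L²(Ω, ℝ²)`, written as complex-valued functions. -/

namespace Metamorphosis

open Filter Topology

theorem absolutelyContinuousOnInterval_of_hasDerivAt {F : Type*} [NormedAddCommGroup F]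
    [NormedSpace ℝ F] {f f' : ℝ → F} (hf : ∀ t ∈ Icc (0 : ℝ) 1, HasDerivAt f (f' t) t)
    (hc : ContinuousOn f' (Icc 0 1)) : AbsolutelyContinuousOnInterval f 0 1 := by
  obtain ⟨K, hK⟩ := isCompact_Icc.exists_bound_of_continuousOn hc
  refine LipschitzOnWith.absolutelyContinuousOnInterval (K := K.toNNReal) ?_
  rw [uIcc_of_le zero_le_one]
  refine (convex_Icc (0 : ℝ) 1).lipschitzOnWith_of_nnnorm_hasDerivWithin_le
    (fun t ht => (hf t ht).hasDerivWithinAt) fun t ht => ?_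
  rw [← NNReal.coe_le_coe, coe_nnnorm]
  exact (hK t ht).trans (Real.le_coe_toNNReal K)

section ArcCoeff

/-- The coefficient `sin (tρ) / sin ρ` of a great circle, read as `t` if `ρ = 0`. -/
noncomputable def arcCoeff (ρ t : ℝ) : ℝ :=
  if ρ = 0 then t else Real.sin (t * ρ) / Real.sin ρ

/-- The time derivative of `arcCoeff`. -/
noncomputable def arcCoeffDeriv (ρ t : ℝ) : ℝ :=
  if ρ = 0 then 1 else ρ * Real.cos (t * ρ) / Real.sin ρ

theorem hasDerivAt_arcCoeff (ρ t : ℝ) : HasDerivAt (arcCoeff ρ) (arcCoeffDeriv ρ t) t := by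
  unfold arcCoeff arcCoeffDeriv
  split_ifs with h
  · exact hasDerivAt_id t
  · have := (((hasDerivAt_id t).mul_const ρ).sin).div_const (Real.sin ρ)
    simpa [mul_comm] using this

theorem continuous_arcCoeffDeriv (ρ : ℝ) : Continuous (arcCoeffDeriv ρ) := by
  unfold arcCoeffDeriv
  split_ifs <;> fun_prop

theorem continuous_arcCoeff (ρ : ℝ) : Continuous (arcCoeff ρ) :=
  continuous_iff_continuousAt.2 fun t => (hasDerivAt_arcCoeff ρ t).continuousAt

theorem sin_pos_of_ne {ρ : ℝ} (h0 : 0 ≤ ρ) (hpi : ρ < Real.pi) (h : ρ ≠ 0) : 0 < Real.sin ρ :=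
  Real.sin_pos_of_pos_of_lt_pi (lt_of_le_of_ne h0 h.symm) hpi

theorem arcCoeff_zero (ρ : ℝ) : arcCoeff ρ 0 = 0 := by simp [arcCoeff]

theorem arcCoeff_one {ρ : ℝ} (h0 : 0 ≤ ρ) (hpi : ρ < Real.pi) : arcCoeff ρ 1 = 1 := by
  unfold arcCoeff
  split_ifs with h
  · rfl
  · rw [one_mul, div_self (sin_pos_of_ne h0 hpi h).ne']

theorem arcCoeff_pos {ρ t : ℝ} (h0 : 0 ≤ ρ) (hpi : ρ < Real.pi) (ht0 : 0 < t) (ht1 : t ≤ 1) :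
    0 < arcCoeff ρ t := by
  unfold arcCoeff
  split_ifs with h
  · exact ht0
  · have hρ : 0 < ρ := lt_of_le_of_ne h0 (Ne.symm h)
    exact div_pos (Real.sin_pos_of_pos_of_lt_pi (by positivity) (by nlinarith))
      (sin_pos_of_ne h0 hpi h)

theorem arcCoeff_nonneg {ρ t : ℝ} (h0 : 0 ≤ ρ) (hpi : ρ < Real.pi) (ht0 : 0 ≤ t) (ht1 : t ≤ 1) :
    0 ≤ arcCoeff ρ t := by
  rcases ht0.eq_or_lt with rfl | h
  · rw [arcCoeff_zero]
  · exact (arcCoeff_pos h0 hpi h ht1).le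

/-- The left side is `‖A x + B y‖²` for unit vectors with `⟨x, y⟩ = cos ρ`: the arc stays on the
sphere. The next identity says in the same way that its speed is `ρ`. Writing `ρ = u + v` reduces
both to polynomial identities in sines and cosines. -/
theorem arcCoeff_sq {ρ : ℝ} (h0 : 0 ≤ ρ) (hpi : ρ < Real.pi) (t : ℝ) :
    arcCoeff ρ (1 - t) ^ 2 + arcCoeff ρ t ^ 2 +
      2 * arcCoeff ρ (1 - t) * arcCoeff ρ t * Real.cos ρ = 1 := by
  unfold arcCoeff
  split_ifs with h
  · rw [h, Real.cos_zero]; ring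
  · have hs := (sin_pos_of_ne h0 hpi h).ne'
    have e : ρ = (1 - t) * ρ + t * ρ := by ring
    generalize (1 - t) * ρ = u at e ⊢
    generalize t * ρ = v at e ⊢
    have e1 := congrArg Real.sin e
    have e2 := congrArg Real.cos e
    rw [Real.sin_add] at e1
    rw [Real.cos_add] at e2
    have s1 := Real.sin_sq_add_cos_sq u
    have s2 := Real.sin_sq_add_cos_sq v
    field_simp
    rw [e1, e2]
    linear_combination -(Real.sin u) ^ 2 * s2 - (Real.sin v) ^ 2 * s1

theorem arcCoeffDeriv_sq {ρ : ℝ} (h0 : 0 ≤ ρ) (hpi : ρ < Real.pi) (t : ℝ) :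
    (-arcCoeffDeriv ρ (1 - t)) ^ 2 + arcCoeffDeriv ρ t ^ 2 +
      2 * (-arcCoeffDeriv ρ (1 - t)) * arcCoeffDeriv ρ t * Real.cos ρ = ρ ^ 2 := by
  unfold arcCoeffDeriv
  split_ifs with h
  · rw [h, Real.cos_zero]; ring
  · have hs := (sin_pos_of_ne h0 hpi h).ne'
    have e : ρ = (1 - t) * ρ + t * ρ := by ring
    generalize (1 - t) * ρ = u at e ⊢
    generalize t * ρ = v at e ⊢
    have e1 := congrArg Real.sin e
    have e2 := congrArg Real.cos e
    rw [Real.sin_add] at e1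
    rw [Real.cos_add] at e2
    have s1 := Real.sin_sq_add_cos_sq u
    have s2 := Real.sin_sq_add_cos_sq v
    have key : Real.cos u ^ 2 + Real.cos v ^ 2 -
        2 * Real.cos u * Real.cos v * Real.cos ρ = Real.sin ρ ^ 2 := by
      rw [e1, e2]
      linear_combination -(Real.cos u) ^ 2 * s2 - (Real.cos v) ^ 2 * s1
    field_simp
    linear_combination key

/-- When `x = y`, the angle is `0` and the coefficients are `1 - t` and `t`, whose sum is `1`; the
case distinction of `greatCircle` is thus absorbed in that of `arcCoeff`. -/
theorem greatCircle_eq {H : Type*} [NormedAddCommGroup H] [InnerProductSpace ℝ H] {x y : H}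
    (hx : ‖x‖ = 1) (hy : ‖y‖ = 1) (t : ℝ) :
    greatCircle x y t = arcCoeff (Real.arccos (inner ℝ x y)) (1 - t) • x +
      arcCoeff (Real.arccos (inner ℝ x y)) t • y := by
  unfold greatCircle
  split_ifs with h
  · subst h
    rw [real_inner_self_eq_norm_sq, hx]
    simp only [one_pow, Real.arccos_one, arcCoeff, if_true]
    rw [← add_smul]
    simp
  · have hne : Real.arccos (inner ℝ x y) ≠ 0 := by
      rw [Ne, Real.arccos_eq_zero, not_le]
      exact lt_of_le_of_ne (by simpa [hx, hy] using real_inner_le_norm x y)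
        (fun h1 => h ((inner_eq_one_iff_of_norm_eq_one hx hy).1 h1))
    simp only [arcCoeff, if_neg hne]

end ArcCoeff

/-- Polar coordinates `(r, κ)` of a nowhere vanishing unit vector of `L²(Ω, ℝ²)` whose angle with
`(1, 0)` is everywhere less than `π`. -/
structure CircleData where
  /-- the radius -/
  r : ℝ → ℝ
  /-- the angle -/
  κ : ℝ → ℝ
  r_measurable : Measurable r
  κ_measurable : Measurable κ
  r_pos : ∀ s, 0 < r s
  κ_nonneg : ∀ s, 0 ≤ κ s
  κ_lt_pi : ∀ s, κ s < Real.pi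
  integrable_sq : Integrable (fun s => r s ^ 2) lebOmega
  integral_sq : ∫ s, r s ^ 2 ∂lebOmega = 1

namespace CircleData

variable (D : CircleData)

/-- The spherical distance to `(1, 0)`. -/
noncomputable def ρ : ℝ := Real.arccos (∫ s, D.r s * Real.cos (D.κ s) ∂lebOmega)

/-- The great circle from `1` to `r exp (iκ)`, where its coefficients `A`, `B` are left free. -/
noncomputable def comb (A B s : ℝ) : ℂ :=
  ⟨A + B * (D.r s * Real.cos (D.κ s)), B * (D.r s * Real.sin (D.κ s))⟩

theorem normSq_comb (A B s : ℝ) : Complex.normSq (D.comb A B s) =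
    A ^ 2 + B ^ 2 * D.r s ^ 2 + 2 * A * B * (D.r s * Real.cos (D.κ s)) := by
  rw [Complex.normSq_apply, comb]
  linear_combination B ^ 2 * D.r s ^ 2 * Real.sin_sq_add_cos_sq (D.κ s)

/-- As `0 ≤ κ < π`, the combination has positive imaginary part, or is a positive real when `B = 0`
or `κ = 0`. So `z` never vanishes and its argument is differentiable in time; `κ = π` would allow
cancellation. -/
theorem comb_mem_slitPlane {A B : ℝ} (hA : 0 ≤ A) (hB : 0 ≤ B) (h : 0 < A + B) (s : ℝ) :
    D.comb A B s ∈ Complex.slitPlane := by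
  rw [Complex.mem_slitPlane_iff]
  have hr := D.r_pos s
  rcases hB.eq_or_lt with rfl | hB
  · left; simpa [comb] using h
  rcases (D.κ_nonneg s).eq_or_lt with h0 | h0
  · left
    simp only [comb, ← h0, Real.cos_zero, mul_one]
    positivity
  · right
    have := Real.sin_pos_of_pos_of_lt_pi h0 (D.κ_lt_pi s)
    simp only [comb]
    positivity

theorem normSq_comb_pos {A B : ℝ} (hA : 0 ≤ A) (hB : 0 ≤ B) (h : 0 < A + B) (s : ℝ) :
    0 < Complex.normSq (D.comb A B s) :=
  Complex.normSq_pos.2 (Complex.slitPlane_ne_zero (D.comb_mem_slitPlane hA hB h s))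

theorem integrable_r_cos : Integrable (fun s => D.r s * Real.cos (D.κ s)) lebOmega := by
  have hr : Integrable D.r lebOmega := by
    have : MemLp D.r 2 lebOmega :=
      (memLp_two_iff_integrable_sq D.r_measurable.aestronglyMeasurable).2 D.integrable_sq
    exact this.integrable one_le_two
  refine hr.mul_bdd (c := 1) ?_ (Eventually.of_forall fun s => Real.abs_cos_le_one _)
  exact (Real.continuous_cos.measurable.comp D.κ_measurable).aestronglyMeasurable

theorem integrable_normSq_comb (A B : ℝ) :
    Integrable (fun s => Complex.normSq (D.comb A B s)) lebOmega := by
  simp only [normSq_comb]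
  exact ((integrable_const _).add (D.integrable_sq.const_mul _)).add
    (D.integrable_r_cos.const_mul _)

theorem integral_normSq_comb (A B : ℝ) : ∫ s, Complex.normSq (D.comb A B s) ∂lebOmega =
    A ^ 2 + B ^ 2 + 2 * A * B * ∫ s, D.r s * Real.cos (D.κ s) ∂lebOmega := by
  simp only [normSq_comb]
  have h : Integrable (fun s => A ^ 2 + B ^ 2 * D.r s ^ 2) lebOmega :=
    (integrable_const _).add (D.integrable_sq.const_mul _)
  rw [integral_add h (D.integrable_r_cos.const_mul _), integral_add (integrable_const _)
    (D.integrable_sq.const_mul _), integral_const_mul, integral_const_mul, D.integral_sq]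
  simp

/-- `∫ |1 + r exp(iκ)|² = 2 + 2 ∫ r cos κ`, and the integrand is positive everywhere. Hence the
endpoints are not antipodal and `ρ < π`. -/
theorem neg_one_lt_integral : -1 < ∫ s, D.r s * Real.cos (D.κ s) ∂lebOmega := by
  have h : 0 < ∫ s, Complex.normSq (D.comb 1 1 s) ∂lebOmega := by
    rw [integral_pos_iff_support_of_nonneg (fun s => Complex.normSq_nonneg _)
      (D.integrable_normSq_comb 1 1)]
    have : Function.support (fun s => Complex.normSq (D.comb 1 1 s)) = univ :=
      eq_univ_of_forall fun s =>
        (D.normSq_comb_pos zero_le_one zero_le_one (by norm_num) s).ne'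
    rw [this]
    simp
  rw [integral_normSq_comb] at h
  linarith

theorem integral_le_one : ∫ s, D.r s * Real.cos (D.κ s) ∂lebOmega ≤ 1 := by
  have h : 0 ≤ ∫ s, Complex.normSq (D.comb 1 (-1) s) ∂lebOmega :=
    integral_nonneg fun s => Complex.normSq_nonneg _
  rw [integral_normSq_comb] at h
  linarith

theorem ρ_nonneg : 0 ≤ D.ρ := Real.arccos_nonneg _

theorem ρ_lt_pi : D.ρ < Real.pi := by
  refine lt_of_le_of_ne (Real.arccos_le_pi _) fun h => ?_
  rw [ρ, Real.arccos_eq_pi] at h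
  linarith [D.neg_one_lt_integral]

theorem cos_ρ : Real.cos D.ρ = ∫ s, D.r s * Real.cos (D.κ s) ∂lebOmega :=
  Real.cos_arccos D.neg_one_lt_integral.le D.integral_le_one

/-- The great circle from `1` to `r exp (iκ)`. -/
noncomputable def z (t s : ℝ) : ℂ := D.comb (arcCoeff D.ρ (1 - t)) (arcCoeff D.ρ t) s

/-- The velocity of the great circle. -/
noncomputable def zDeriv (t s : ℝ) : ℂ :=
  D.comb (-arcCoeffDeriv D.ρ (1 - t)) (arcCoeffDeriv D.ρ t) s

theorem hasDerivAt_z (t s : ℝ) : HasDerivAt (fun t => D.z t s) (D.zDeriv t s) t := by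
  have hA : HasDerivAt (fun t => arcCoeff D.ρ (1 - t)) (-arcCoeffDeriv D.ρ (1 - t)) t :=
    (hasDerivAt_arcCoeff D.ρ (1 - t)).comp_const_sub 1 t
  have hB := hasDerivAt_arcCoeff D.ρ t
  have h1 := (hA.add (hB.mul_const (D.r s * Real.cos (D.κ s)))).ofReal_comp
  have h2 := (hB.mul_const (D.r s * Real.sin (D.κ s))).ofReal_comp
  have h3 := h1.add (h2.mul_const Complex.I)
  have e : ∀ A B : ℝ, D.comb A B s = ((A + B * (D.r s * Real.cos (D.κ s)) : ℝ) : ℂ) +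
      ((B * (D.r s * Real.sin (D.κ s)) : ℝ) : ℂ) * Complex.I := fun A B =>
    Complex.mk_eq_add_mul_I _ _
  simp only [z, zDeriv, e]
  exact h3

theorem measurable_comb {X : Type*} [MeasurableSpace X] {A B u : X → ℝ} (hA : Measurable A)
    (hB : Measurable B) (hu : Measurable u) : Measurable fun p => D.comb (A p) (B p) (u p) := by
  have e : ∀ A B s : ℝ, D.comb A B s = ((A + B * (D.r s * Real.cos (D.κ s)) : ℝ) : ℂ) +
      ((B * (D.r s * Real.sin (D.κ s)) : ℝ) : ℂ) * Complex.I := fun A B s =>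
    Complex.mk_eq_add_mul_I _ _
  simp only [e]
  have hr := D.r_measurable.comp hu
  have hκ := D.κ_measurable.comp hu
  have hc := hr.mul (Real.measurable_cos.comp hκ)
  have hs := hr.mul (Real.measurable_sin.comp hκ)
  exact (Complex.measurable_ofReal.comp (hA.add (hB.mul hc))).add
    ((Complex.measurable_ofReal.comp (hB.mul hs)).mul_const _)

theorem measurable_z : Measurable (Function.uncurry D.z) :=
  D.measurable_comb ((continuous_arcCoeff D.ρ).measurable.comp (measurable_fst.const_sub 1))
    ((continuous_arcCoeff D.ρ).measurable.comp measurable_fst) measurable_snd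

theorem continuous_z (s : ℝ) : Continuous fun t => D.z t s :=
  continuous_iff_continuousAt.2 fun t => (D.hasDerivAt_z t s).continuousAt

theorem continuous_zDeriv (s : ℝ) : Continuous fun t => D.zDeriv t s := by
  have e : ∀ A B : ℝ, D.comb A B s = ((A + B * (D.r s * Real.cos (D.κ s)) : ℝ) : ℂ) +
      ((B * (D.r s * Real.sin (D.κ s)) : ℝ) : ℂ) * Complex.I := fun A B =>
    Complex.mk_eq_add_mul_I _ _
  have h := continuous_arcCoeffDeriv D.ρ
  simp only [zDeriv, e]
  fun_prop

theorem coeff_props {t : ℝ} (ht : t ∈ Icc (0 : ℝ) 1) :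
    0 ≤ arcCoeff D.ρ (1 - t) ∧ 0 ≤ arcCoeff D.ρ t ∧
      0 < arcCoeff D.ρ (1 - t) + arcCoeff D.ρ t := by
  have hA := arcCoeff_nonneg D.ρ_nonneg D.ρ_lt_pi (t := 1 - t) (by linarith [ht.2])
    (by linarith [ht.1])
  have hB := arcCoeff_nonneg D.ρ_nonneg D.ρ_lt_pi ht.1 ht.2
  refine ⟨hA, hB, ?_⟩
  rcases ht.1.eq_or_lt with h | h
  · have := arcCoeff_pos D.ρ_nonneg D.ρ_lt_pi (t := 1 - t) (by linarith) (by linarith [ht.1])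
    linarith
  · have := arcCoeff_pos D.ρ_nonneg D.ρ_lt_pi h ht.2
    linarith

theorem z_mem_slitPlane {t : ℝ} (ht : t ∈ Icc (0 : ℝ) 1) (s : ℝ) :
    D.z t s ∈ Complex.slitPlane :=
  D.comb_mem_slitPlane (D.coeff_props ht).1 (D.coeff_props ht).2.1 (D.coeff_props ht).2.2 s

theorem z_ne_zero {t : ℝ} (ht : t ∈ Icc (0 : ℝ) 1) (s : ℝ) : D.z t s ≠ 0 :=
  Complex.slitPlane_ne_zero (D.z_mem_slitPlane ht s)

theorem z_zero (s : ℝ) : D.z 0 s = 1 := by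
  rw [z, sub_zero, arcCoeff_zero, arcCoeff_one D.ρ_nonneg D.ρ_lt_pi, comb]
  apply Complex.ext <;> simp

theorem z_one (s : ℝ) : D.z 1 s = ⟨D.r s * Real.cos (D.κ s), D.r s * Real.sin (D.κ s)⟩ := by
  rw [z, sub_self, arcCoeff_zero, arcCoeff_one D.ρ_nonneg D.ρ_lt_pi, comb]
  simp

theorem integral_normSq_z (t : ℝ) : ∫ s, Complex.normSq (D.z t s) ∂lebOmega = 1 := by
  simp only [z]
  rw [integral_normSq_comb, ← cos_ρ, arcCoeff_sq D.ρ_nonneg D.ρ_lt_pi]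

theorem integral_normSq_zDeriv (t : ℝ) :
    ∫ s, Complex.normSq (D.zDeriv t s) ∂lebOmega = D.ρ ^ 2 := by
  simp only [zDeriv]
  rw [integral_normSq_comb, ← cos_ρ, arcCoeffDeriv_sq D.ρ_nonneg D.ρ_lt_pi]

/-- The argument is the imaginary part of the logarithm, which is differentiable on the slit plane.
-/
theorem hasDerivAt_arg {t : ℝ} (ht : t ∈ Icc (0 : ℝ) 1) (s : ℝ) :
    HasDerivAt (fun t => (D.z t s).arg) (D.zDeriv t s / D.z t s).im t := by
  have h := (D.hasDerivAt_z t s).clog_real (D.z_mem_slitPlane ht s)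
  have := Complex.imCLM.hasFDerivAt.comp_hasDerivAt t h
  simpa [Function.comp_def, Complex.log_im] using this

theorem hasDerivAt_normSq (t s : ℝ) : HasDerivAt (fun t => Complex.normSq (D.z t s))
    (2 * ((D.z t s).re * (D.zDeriv t s).re + (D.z t s).im * (D.zDeriv t s).im)) t := by
  have h := D.hasDerivAt_z t s
  have h1 : HasDerivAt (fun t => (D.z t s).re) (D.zDeriv t s).re t :=
    Complex.reCLM.hasFDerivAt.comp_hasDerivAt t h
  have h2 : HasDerivAt (fun t => (D.z t s).im) (D.zDeriv t s).im t :=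
    Complex.imCLM.hasFDerivAt.comp_hasDerivAt t h
  simp only [Complex.normSq_apply]
  convert! (h1.mul h1).add (h2.mul h2) using 1
  ring

theorem z_polar (t s : ℝ) :
    (D.z t s).re = √(Complex.normSq (D.z t s)) * Real.cos (D.z t s).arg ∧
      (D.z t s).im = √(Complex.normSq (D.z t s)) * Real.sin (D.z t s).arg := by
  have : √(Complex.normSq (D.z t s)) = ‖D.z t s‖ := rfl
  rw [this]
  exact ⟨(Complex.norm_mul_cos_arg _).symm, (Complex.norm_mul_sin_arg _).symm⟩

end CircleData

end Metamorphosis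

/-! ### The trajectory carried by a great circle, and orthogonal fields. -/

namespace Metamorphosis

open Filter Topology

theorem norm_cos_smul_add_sin_smul {V : Type*} [NormedAddCommGroup V] [InnerProductSpace ℝ V]
    {a b : V} (ha : ‖a‖ = 1) (hb : ‖b‖ = 1) (hab : inner ℝ a b = 0) (x y : ℝ) :
    ‖x • a + y • b‖ ^ 2 = x ^ 2 + y ^ 2 := by
  rw [norm_add_sq_real, norm_smul, norm_smul, inner_smul_left, inner_smul_right, hab, ha, hb]
  simp

theorem isDiffeo_integral {h : ℝ → ℝ} (hi : Integrable h lebOmega) (hpos : ∀ s, 0 < h s)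
    (h1 : ∫ s, h s ∂lebOmega = 1) :
    IsDiffeo (fun s => ∫ u in (0 : ℝ)..s, h u) ∧
      ∀ᵐ s ∂lebOmega, HasDerivAt (fun s => ∫ u in (0 : ℝ)..s, h u) (h s) s := by
  have hii : IntervalIntegrable h volume 0 1 :=
    (intervalIntegrable_iff_integrableOn_Icc_of_le zero_le_one).2 hi
  have hd : ∀ᵐ s ∂lebOmega, HasDerivAt (fun s => ∫ u in (0 : ℝ)..s, h u) (h s) s := by
    refine ae_lebOmega_of_ae ?_
    filter_upwards [hii.ae_hasDerivAt_integral] with x hx hxI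
    exact hx hxI 0 left_mem_uIcc
  have hsub : ∀ x ∈ Icc (0 : ℝ) 1, ∀ y ∈ Icc (0 : ℝ) 1, IntervalIntegrable h volume x y :=
    fun x hx y hy => hii.mono_set (by
      rw [uIcc_of_le (zero_le_one' ℝ)]
      exact ordConnected_Icc.uIcc_subset hx hy)
  refine ⟨⟨by simp, ?_, ?_, ?_, ?_⟩, hd⟩
  · rw [intervalIntegral.integral_of_le zero_le_one, ← integral_Icc_eq_integral_Ioc, h1]
  · intro x hx y hy hxy
    have h2 := intervalIntegral.intervalIntegral_pos_of_pos (hsub x hx y hy) hpos hxy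
    have h3 := intervalIntegral.integral_add_adjacent_intervals
      (hsub 0 (left_mem_Icc.2 zero_le_one) x hx) (hsub x hx y hy)
    simp only
    linarith
  · exact hii.absolutelyContinuousOnInterval_intervalIntegral left_mem_uIcc
  · filter_upwards [hd] with s hs
    rw [hs.deriv]
    exact hpos s

namespace CircleData

variable (D : CircleData) {d : ℕ} {a b : ℝ → E d}

/-- The sphere-valued component deduced from a great circle. -/
noncomputable def sphereCurve (σ : ℝ) (a b : ℝ → E d) (t s : ℝ) : E d :=
  Real.cos (2 * σ * (D.z t s).arg) • a s + Real.sin (2 * σ * (D.z t s).arg) • b s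

/-- The time derivative of `sphereCurve`. -/
noncomputable def sphereCurveDeriv (σ : ℝ) (a b : ℝ → E d) (t s : ℝ) : E d :=
  (-Real.sin (2 * σ * (D.z t s).arg) * (2 * σ * (D.zDeriv t s / D.z t s).im)) • a s +
    (Real.cos (2 * σ * (D.z t s).arg) * (2 * σ * (D.zDeriv t s / D.z t s).im)) • b s

theorem hasDerivAt_sphereCurve (σ : ℝ) (a b : ℝ → E d) {t : ℝ} (ht : t ∈ Icc (0 : ℝ) 1) (s : ℝ) :
    HasDerivAt (fun t => D.sphereCurve σ a b t s) (D.sphereCurveDeriv σ a b t s) t := by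
  have h := (D.hasDerivAt_arg ht s).const_mul (2 * σ)
  exact (h.cos.smul_const (a s)).add (h.sin.smul_const (b s))

theorem continuousOn_sphereCurveDeriv (σ : ℝ) (a b : ℝ → E d) (s : ℝ) :
    ContinuousOn (fun t => D.sphereCurveDeriv σ a b t s) (Icc 0 1) := by
  have h1 : ContinuousOn (fun t => (D.z t s).arg) (Icc 0 1) := fun t ht =>
    (D.hasDerivAt_arg ht s).continuousAt.continuousWithinAt
  have h2 : ContinuousOn (fun t => (D.zDeriv t s / D.z t s).im) (Icc 0 1) :=
    Complex.continuous_im.comp_continuousOn ((D.continuous_zDeriv s).continuousOn.div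
      (D.continuous_z s).continuousOn fun t ht => D.z_ne_zero ht s)
  have h3 := (continuousOn_const (c := 2 * σ)).mul h1
  have h4 := (continuousOn_const (c := 2 * σ)).mul h2
  exact (((Real.continuous_sin.comp_continuousOn h3).neg.mul h4).smul continuousOn_const).add
    (((Real.continuous_cos.comp_continuousOn h3).mul h4).smul continuousOn_const)

theorem measurable_sphereCurve (σ : ℝ) (ha : Measurable a) (hb : Measurable b) :
    Measurable (Function.uncurry (D.sphereCurve σ a b)) := by
  have h1 : Measurable fun p : ℝ × ℝ => 2 * σ * (D.z p.1 p.2).arg :=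
    (Complex.measurable_arg.comp D.measurable_z).const_mul _
  have h2 : Measurable fun p : ℝ × ℝ => Real.cos (2 * σ * (D.z p.1 p.2).arg) • a p.2 :=
    (Real.measurable_cos.comp h1).fun_smul (ha.comp measurable_snd)
  have h3 : Measurable fun p : ℝ × ℝ => Real.sin (2 * σ * (D.z p.1 p.2).arg) • b p.2 :=
    (Real.measurable_sin.comp h1).fun_smul (hb.comp measurable_snd)
  exact h2.add h3

theorem sphereCurve_mem (σ : ℝ) (ha : a ∈ unitTangents d) (hb : b ∈ unitTangents d)
    (hab : ∀ s ∈ Icc (0 : ℝ) 1, inner ℝ (a s) (b s) = 0) (t : ℝ) :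
    D.sphereCurve σ a b t ∈ unitTangents d := by
  refine ⟨(D.measurable_sphereCurve σ ha.1 hb.1).of_uncurry_left, fun s hs => ?_⟩
  have h := norm_cos_smul_add_sin_smul (ha.2 s hs) (hb.2 s hs) (hab s hs)
    (Real.cos (2 * σ * (D.z t s).arg)) (Real.sin (2 * σ * (D.z t s).arg))
  rw [Real.cos_sq_add_sin_sq] at h
  exact (pow_eq_one_iff_of_nonneg (norm_nonneg _) two_ne_zero).1 h

theorem normSq_z_pos {t : ℝ} (ht : t ∈ Icc (0 : ℝ) 1) (s : ℝ) :
    0 < Complex.normSq (D.z t s) :=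
  Complex.normSq_pos.2 (D.z_ne_zero ht s)

/-- The trajectory deduced from a great circle. -/
noncomputable def trajectory (σ : ℝ) (ha : a ∈ unitTangents d) (hb : b ∈ unitTangents d)
    (hab : ∀ s ∈ Icc (0 : ℝ) 1, inner ℝ (a s) (b s) = 0) : Trajectory d where
  φ t s := ∫ u in (0 : ℝ)..s, Complex.normSq (D.z t u)
  dφ t s := Complex.normSq (D.z t s)
  α := D.sphereCurve σ a b
  isDiffeo t ht := (isDiffeo_integral (D.integrable_normSq_comb _ _)
    (D.normSq_z_pos ht) (D.integral_normSq_z t)).1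
  φ_zero s _ := by simp [z_zero]
  hasDerivAt t ht := (isDiffeo_integral (D.integrable_normSq_comb _ _)
    (D.normSq_z_pos ht) (D.integral_normSq_z t)).2
  dφ_measurable := Complex.continuous_normSq.measurable.comp D.measurable_z
  dφ_pos := Eventually.of_forall fun s t ht => D.normSq_z_pos ht s
  dφ_absCont := Eventually.of_forall fun s => by
    refine absolutelyContinuousOnInterval_of_hasDerivAt (fun t _ => D.hasDerivAt_normSq t s) ?_
    have h1 := D.continuous_z s
    have h2 := D.continuous_zDeriv s
    have h3 := Complex.continuous_re.comp h1
    have h4 := Complex.continuous_im.comp h1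
    have h5 := Complex.continuous_re.comp h2
    have h6 := Complex.continuous_im.comp h2
    exact (continuous_const.mul ((h3.mul h5).add (h4.mul h6))).continuousOn
  α_mem t _ := D.sphereCurve_mem σ ha hb hab t
  α_measurable := D.measurable_sphereCurve σ ha.1 hb.1
  α_absCont := Eventually.of_forall fun s =>
    absolutelyContinuousOnInterval_of_hasDerivAt (fun _ ht => D.hasDerivAt_sphereCurve σ a b ht s)
      (D.continuousOn_sphereCurveDeriv σ a b s)

/-- Equality in the speed estimate. With `dφ = |z|²` and `τ = 2σ arg z`, the two terms are `4
Re(z̄z')²/|z|²` and `4 Im(z̄z')²/|z|²`, whose sum is `4 |z'|²`. -/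
theorem density_trajectory {σ : ℝ} (hσ : 0 < σ) (ha : a ∈ unitTangents d)
    (hb : b ∈ unitTangents d) (hab : ∀ s ∈ Icc (0 : ℝ) 1, inner ℝ (a s) (b s) = 0) {t s : ℝ}
    (ht : t ∈ Icc (0 : ℝ) 1) (hs : s ∈ Icc (0 : ℝ) 1) :
    (D.trajectory σ ha hb hab).density σ t s =
      ENNReal.ofReal (4 * Complex.normSq (D.zDeriv t s)) := by
  have hpos := D.normSq_z_pos ht s
  have e1 : deriv (fun r => (D.trajectory σ ha hb hab).dφ r s) t =
      2 * ((D.z t s).re * (D.zDeriv t s).re + (D.z t s).im * (D.zDeriv t s).im) :=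
    (D.hasDerivAt_normSq t s).deriv
  have e2 : deriv (fun r => (D.trajectory σ ha hb hab).α r s) t = D.sphereCurveDeriv σ a b t s :=
    (D.hasDerivAt_sphereCurve σ a b ht s).deriv
  have e3 : ‖D.sphereCurveDeriv σ a b t s‖ ^ 2 = (2 * σ * (D.zDeriv t s / D.z t s).im) ^ 2 := by
    rw [sphereCurveDeriv, norm_cos_smul_add_sin_smul (ha.2 s hs) (hb.2 s hs) (hab s hs)]
    linear_combination (2 * σ * (D.zDeriv t s / D.z t s).im) ^ 2 *
      Real.sin_sq_add_cos_sq (2 * σ * (D.z t s).arg)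
  have e4 : (D.trajectory σ ha hb hab).dφ t s = Complex.normSq (D.z t s) := rfl
  rw [Trajectory.density, e1, e2, e3, e4, ← ENNReal.ofReal_mul (by positivity),
    ← ENNReal.ofReal_add (by positivity) (by positivity), Complex.div_im]
  congr 1
  have hne := hpos.ne'
  field_simp
  rw [Complex.normSq_apply, Complex.normSq_apply]
  ring

theorem energy_trajectory {σ : ℝ} (hσ : 0 < σ) (ha : a ∈ unitTangents d)
    (hb : b ∈ unitTangents d) (hab : ∀ s ∈ Icc (0 : ℝ) 1, inner ℝ (a s) (b s) = 0) :
    energy σ (D.trajectory σ ha hb hab) = ENNReal.ofReal (4 * D.ρ ^ 2) := by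
  rw [Trajectory.energy_eq_lintegral_density]
  have h : ∀ᵐ t ∂lebOmega, ∫⁻ s, (D.trajectory σ ha hb hab).density σ t s ∂lebOmega =
      ENNReal.ofReal (4 * D.ρ ^ 2) := by
    filter_upwards [ae_mem_Icc] with t ht
    have hi : Integrable (fun s => 4 * Complex.normSq (D.zDeriv t s)) lebOmega :=
      (D.integrable_normSq_comb _ _).const_mul 4
    rw [← D.integral_normSq_zDeriv t, ← integral_const_mul,
      ofReal_integral_eq_lintegral_ofReal hi
      (Eventually.of_forall fun s => mul_nonneg (by norm_num) (Complex.normSq_nonneg _))]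
    refine lintegral_congr_ae ?_
    filter_upwards [ae_mem_Icc] with s hs
    exact D.density_trajectory hσ ha hb hab ht hs
  rw [lintegral_congr_ae h]
  simp

theorem arg_z_one (s : ℝ) : (D.z 1 s).arg = D.κ s := by
  have h : D.z 1 s = (D.r s : ℂ) * (Complex.cos (D.κ s) + Complex.sin (D.κ s) * Complex.I) := by
    rw [z_one, ← Complex.ofReal_cos, ← Complex.ofReal_sin, Complex.mk_eq_add_mul_I]
    push_cast
    ring
  rw [h]
  exact Complex.arg_mul_cos_add_sin_mul_I (D.r_pos s)
    ⟨by linarith [D.κ_nonneg s, Real.pi_pos], (D.κ_lt_pi s).le⟩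

end CircleData

theorem measurable_normalize {d : ℕ} {w : ℝ → E d} (hw : Measurable w) :
    Measurable fun s => (‖w s‖)⁻¹ • w s := hw.norm.inv.smul hw

/-- The component of `v` orthogonal to the unit vector `x`. -/
noncomputable def orthogonalPart {d : ℕ} (x v : E d) : E d := v - inner ℝ x v • x

theorem inner_orthogonalPart {d : ℕ} {x : E d} (hx : ‖x‖ = 1) (v : E d) :
    inner ℝ x (orthogonalPart x v) = 0 := by
  rw [orthogonalPart, inner_sub_right, inner_smul_right, real_inner_self_eq_norm_sq, hx]
  ring

theorem norm_orthogonalPart_sq {d : ℕ} {x v : E d} (hx : ‖x‖ = 1) (hv : ‖v‖ = 1) :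
    ‖orthogonalPart x v‖ ^ 2 = 1 - inner ℝ x v ^ 2 := by
  rw [orthogonalPart, norm_sub_sq_real, inner_smul_right, norm_smul, hx, hv,
    real_inner_comm, Real.norm_eq_abs, mul_one, sq_abs]
  ring

theorem measurable_orthogonalPart {d : ℕ} {x v : ℝ → E d} (hx : Measurable x)
    (hv : Measurable v) : Measurable fun s => orthogonalPart (x s) (v s) :=
  hv.sub ((hx.inner hv).fun_smul hx)

theorem orthogonalPart_ne_zero {d : ℕ} {x e₀ e₁ : E d} (hx : ‖x‖ = 1) (hn₀ : ‖e₀‖ = 1)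
    (hn₁ : ‖e₁‖ = 1) (h01 : inner ℝ e₀ e₁ = 0) (h₀ : orthogonalPart x e₀ = 0) :
    orthogonalPart x e₁ ≠ 0 := by
  intro h₁
  have k0 : e₀ = inner ℝ x e₀ • x := sub_eq_zero.1 h₀
  have k1 : e₁ = inner ℝ x e₁ • x := sub_eq_zero.1 h₁
  have n0 := congrArg norm k0
  have n1 := congrArg norm k1
  rw [norm_smul, hx, hn₀, mul_one] at n0
  rw [norm_smul, hx, hn₁, mul_one] at n1
  rw [k0, k1, inner_smul_left, inner_smul_right, real_inner_self_eq_norm_sq, hx] at h01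
  simp only [conj_trivial, one_pow, mul_one] at h01
  rcases mul_eq_zero.1 h01 with h | h
  · rw [h] at n0; simp at n0
  · rw [h] at n1; simp at n1

theorem eq_cos_smul_add_sin_smul {d : ℕ} {x v b : E d} (hx : ‖x‖ = 1) (hv : ‖v‖ = 1)
    (hb : orthogonalPart x v ≠ 0 → b = (‖orthogonalPart x v‖)⁻¹ • orthogonalPart x v) :
    v = Real.cos (Real.arccos (inner ℝ x v)) • x + Real.sin (Real.arccos (inner ℝ x v)) • b := by
  have hle := abs_real_inner_le_norm x v
  rw [hx, hv, mul_one, abs_le] at hle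
  rw [Real.cos_arccos hle.1 hle.2, Real.sin_arccos, ← norm_orthogonalPart_sq hx hv,
    Real.sqrt_sq (norm_nonneg _)]
  by_cases h1 : orthogonalPart x v = 0
  · rw [h1, norm_zero, zero_smul, add_zero]
    exact sub_eq_zero.1 h1
  · rw [hb h1, smul_smul, mul_inv_cancel₀ (norm_ne_zero_iff.2 h1), one_smul, orthogonalPart]
    abel

/-- Normalise the component of `c` orthogonal to `a`. Where it vanishes, `c = ±a` and the sine is
`0`, so any unit vector orthogonal to `a` will do, provided that it is chosen measurably. -/
theorem exists_orthogonal_field {d : ℕ} (hd : 2 ≤ d) {a c : ℝ → E d} (ha : a ∈ unitTangents d)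
    (hc : c ∈ unitTangents d) : ∃ b ∈ unitTangents d, ∀ s ∈ Icc (0 : ℝ) 1,
      inner ℝ (a s) (b s) = 0 ∧ c s = Real.cos (Real.arccos (inner ℝ (a s) (c s))) • a s +
        Real.sin (Real.arccos (inner ℝ (a s) (c s))) • b s := by
  classical
  obtain ⟨e₀, e₁, hn₀, hn₁, h01⟩ : ∃ e₀ e₁ : E d, ‖e₀‖ = 1 ∧ ‖e₁‖ = 1 ∧ inner ℝ e₀ e₁ = 0 :=
    ⟨EuclideanSpace.single ⟨0, by omega⟩ 1, EuclideanSpace.single ⟨1, by omega⟩ 1, by simp,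
      by simp, by simp [EuclideanSpace.inner_single_left]⟩
  obtain ⟨u, hum, hu⟩ : ∃ u : ℝ → E d, Measurable u ∧ ∀ s ∈ Icc (0 : ℝ) 1,
      inner ℝ (a s) (u s) = 0 ∧ u s ≠ 0 ∧
        (orthogonalPart (a s) (c s) ≠ 0 → u s = orthogonalPart (a s) (c s)) := by
    have m := measurable_orthogonalPart ha.1 hc.1
    have m₀ := measurable_orthogonalPart ha.1 (measurable_const (a := e₀))
    have m₁ := measurable_orthogonalPart ha.1 (measurable_const (a := e₁))
    -- Two orthonormal vectors, available since `d ≥ 2`, cannot both be parallel to `a s`: one of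
    -- the two fixed candidates always survives projection.
    refine ⟨fun s => if orthogonalPart (a s) (c s) = 0 then
      (if orthogonalPart (a s) e₀ = 0 then orthogonalPart (a s) e₁ else orthogonalPart (a s) e₀)
      else orthogonalPart (a s) (c s), Measurable.ite (m (measurableSet_singleton 0))
      (Measurable.ite (m₀ (measurableSet_singleton 0)) m₁ m₀) m, fun s hs => ?_⟩
    dsimp only
    split_ifs with h1 h2
    · exact ⟨inner_orthogonalPart (ha.2 s hs) _,
        orthogonalPart_ne_zero (ha.2 s hs) hn₀ hn₁ h01 h2, fun h => absurd h1 h⟩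
    · exact ⟨inner_orthogonalPart (ha.2 s hs) _, h2, fun h => absurd h1 h⟩
    · exact ⟨inner_orthogonalPart (ha.2 s hs) _, h1, fun _ => rfl⟩
  refine ⟨fun s => (‖u s‖)⁻¹ • u s, ⟨measurable_normalize hum, fun s hs => ?_⟩, fun s hs => ⟨?_, ?_⟩⟩
  · rw [norm_smul, norm_inv, norm_norm, inv_mul_cancel₀ (norm_ne_zero_iff.2 (hu s hs).2.1)]
  · rw [inner_smul_right, (hu s hs).1, mul_zero]
  · exact eq_cos_smul_add_sin_smul (ha.2 s hs) (hc.2 s hs) fun h => by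
      simp only [(hu s hs).2.2 h]

end Metamorphosis

/-! ### Optimal trajectories and the values of the infima. -/

namespace Metamorphosis

open Filter Topology

variable {d : ℕ} {σ : ℝ} {a₀ a₁ : ℝ → E d} {φ₁ : ℝ → ℝ}

/-- A positive representative of the derivative of a diffeomorphism. -/
noncomputable def posDeriv (φ₁ : ℝ → ℝ) (s : ℝ) : ℝ := if 0 < deriv φ₁ s then deriv φ₁ s else 1

theorem posDeriv_pos (φ₁ : ℝ → ℝ) (s : ℝ) : 0 < posDeriv φ₁ s := by
  unfold posDeriv
  split_ifs with h
  · exact h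
  · exact one_pos

theorem measurable_posDeriv (φ₁ : ℝ → ℝ) : Measurable (posDeriv φ₁) :=
  Measurable.ite (measurableSet_lt measurable_const (measurable_deriv φ₁)) (measurable_deriv φ₁)
    measurable_const

theorem posDeriv_ae_eq (h : IsDiffeo φ₁) : posDeriv φ₁ =ᵐ[lebOmega] deriv φ₁ := by
  filter_upwards [h.deriv_pos] with s hs
  simp only [posDeriv, if_pos hs]

theorem comp_clamp_mem (h₁ : a₁ ∈ unitTangents d) (h : IsDiffeo φ₁) :
    (fun s => a₁ (φ₁ (max 0 (min 1 s)))) ∈ unitTangents d :=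
  ⟨h₁.1.comp h.measurable_clamp, fun s hs => h₁.2 _ (h.mapsTo (by rwa [clamp_eq hs]))⟩

theorem omega_div_lt_pi (hσ : 1 < 2 * σ) (s : ℝ) : omega a₀ a₁ φ₁ s / (2 * σ) < Real.pi := by
  rw [div_lt_iff₀ (by linarith)]
  have := omega_le_pi a₀ a₁ φ₁ s
  nlinarith [Real.pi_pos]

/-- The polar coordinates of `q₁ = √(dφ₁) (cos (ω/(2σ)), sin (ω/(2σ)))`. -/
noncomputable def circleData (hσ : 1 < 2 * σ) (h₀ : a₀ ∈ unitTangents d) (h₁ : a₁ ∈ unitTangents d)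
    (h : IsDiffeo φ₁) : CircleData where
  r s := √(posDeriv φ₁ s)
  -- Clamping inside `a₁ ∘ φ₁` makes the angle measurable on the whole line; on `[0,1]` it is the
  -- angle `ω/2σ` of `a₀` and `a₁ ∘ φ₁`.
  κ s := omega a₀ (fun s => a₁ (φ₁ (max 0 (min 1 s)))) id s / (2 * σ)
  r_measurable := Real.continuous_sqrt.measurable.comp (measurable_posDeriv φ₁)
  κ_measurable := (Real.continuous_arccos.measurable.comp
    (h₀.1.inner (h₁.1.comp h.measurable_clamp))).div_const _
  r_pos s := Real.sqrt_pos.2 (posDeriv_pos φ₁ s)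
  κ_nonneg s := div_nonneg (omega_nonneg _ _ _ s) (by linarith)
  κ_lt_pi := omega_div_lt_pi hσ
  integrable_sq := by
    simp only [Real.sq_sqrt (posDeriv_pos φ₁ _).le]
    exact h.integrable.congr (posDeriv_ae_eq h).symm
  integral_sq := by
    simp only [Real.sq_sqrt (posDeriv_pos φ₁ _).le]
    rw [integral_congr_ae (posDeriv_ae_eq h), h.integral_deriv]

theorem ρ_circleData (hσ : 1 < 2 * σ) (h₀ : a₀ ∈ unitTangents d) (h₁ : a₁ ∈ unitTangents d)
    (h : IsDiffeo φ₁) : (circleData hσ h₀ h₁ h).ρ = rho σ a₀ a₁ φ₁ := by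
  unfold CircleData.ρ rho
  congr 1
  refine integral_congr_ae ?_
  filter_upwards [posDeriv_ae_eq h, ae_mem_Icc] with s hs hI
  simp only [circleData, hs, omega, id, clamp_eq hI]

/-- The great circle ending at `q₁` yields `|z(1)|² = dφ₁` a.e., hence `φ(1) = φ₁` by absolute
continuity, and `2σ arg z(1) = ω`, hence `α(1) = a₁ ∘ φ₁`. Condition `2σ > 1` gives `ω/2σ < π`, as
`CircleData` requires. -/
theorem exists_greatCircle_trajectory (hd : 2 ≤ d) (hσ : 1 < 2 * σ) (h₀ : a₀ ∈ unitTangents d)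
    (h₁ : a₁ ∈ unitTangents d) (h : IsDiffeo φ₁) : ∃ T : Trajectory d,
      JoinsWith a₀ a₁ φ₁ T ∧ energy σ T = ENNReal.ofReal (4 * rho σ a₀ a₁ φ₁ ^ 2) ∧
        IsGreatCircleLift σ a₀ a₁ φ₁ T := by
  have hσ0 : 0 < 2 * σ := by linarith
  set D := circleData hσ h₀ h₁ h with hD
  have hρ : D.ρ = rho σ a₀ a₁ φ₁ := ρ_circleData hσ h₀ h₁ h
  obtain ⟨b, hb, hbs⟩ := exists_orthogonal_field hd h₀ (comp_clamp_mem h₁ h)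
  have hab : ∀ s ∈ Icc (0 : ℝ) 1, inner ℝ (a₀ s) (b s) = 0 := fun s hs => (hbs s hs).1
  have hκ : ∀ s ∈ Icc (0 : ℝ) 1, 2 * σ * D.κ s = omega a₀ a₁ φ₁ s := fun s hs => by
    simp only [hD, circleData, omega, id, clamp_eq hs]
    rw [mul_div_assoc']
    exact mul_div_cancel_left₀ _ hσ0.ne'
  have ha₁ : ∀ s ∈ Icc (0 : ℝ) 1, a₁ (φ₁ s) =
      Real.cos (omega a₀ a₁ φ₁ s) • a₀ s + Real.sin (omega a₀ a₁ φ₁ s) • b s := fun s hs => by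
    have := (hbs s hs).2
    simp only [clamp_eq hs] at this
    exact this
  have hr : ∀ s, D.r s ^ 2 = posDeriv φ₁ s := fun s => Real.sq_sqrt (posDeriv_pos φ₁ s).le
  set T := D.trajectory σ h₀ hb hab with hT
  have hz1 : ∀ s, Complex.normSq (D.z 1 s) = posDeriv φ₁ s := fun s => by
    rw [← hr s, CircleData.z_one, Complex.normSq_apply]
    linear_combination D.r s ^ 2 * Real.sin_sq_add_cos_sq (D.κ s)
  have hφ1 : ∀ s ∈ Icc (0 : ℝ) 1, T.φ 1 s = φ₁ s := by
    intro s hs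
    change ∫ u in (0 : ℝ)..s, Complex.normSq (D.z 1 u) = φ₁ s
    rw [← h.integral_deriv_eq hs, intervalIntegral.integral_of_le hs.1,
      intervalIntegral.integral_of_le hs.1]
    refine integral_congr_ae (ae_mono (Measure.restrict_mono_set _
      (Ioc_subset_Icc_self.trans (Icc_subset_Icc_right hs.2))) ?_)
    filter_upwards [posDeriv_ae_eq h] with u hu
    rw [hz1, hu]
  have hα0 : ∀ s, T.α 0 s = a₀ s := fun s => by
    change D.sphereCurve σ a₀ b 0 s = a₀ s
    rw [CircleData.sphereCurve, CircleData.z_zero]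
    simp
  have hα1 : ∀ s ∈ Icc (0 : ℝ) 1, T.α 1 s = a₁ (T.φ 1 s) := fun s hs => by
    change D.sphereCurve σ a₀ b 1 s = a₁ (T.φ 1 s)
    rw [CircleData.sphereCurve, CircleData.arg_z_one, hκ s hs, hφ1 s hs, ← ha₁ s hs]
  refine ⟨T, ⟨hφ1, Eventually.of_forall hα0, ae_mem_Icc.mono hα1⟩, ?_, ?_⟩
  · rw [← hρ]
    exact D.energy_trajectory (by linarith) h₀ hb hab
  have m₀ : MemLp (fun s => sqrtTransform σ ((fun _ => (1 : ℝ)) s) ((fun _ => (0 : ℝ)) s)) 2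
      lebOmega := memLp_sqrtTransform σ (integrable_const 1) aemeasurable_const
  have m₁ : MemLp (fun s => sqrtTransform σ ((fun s => D.r s ^ 2) s)
      ((fun s => 2 * σ * D.κ s) s)) 2 lebOmega :=
    memLp_sqrtTransform σ D.integrable_sq (D.κ_measurable.const_mul _).aemeasurable
  have hcancel : ∀ x : ℝ, 2 * σ * x / (2 * σ) = x := fun x => mul_div_cancel_left₀ x hσ0.ne'
  have n₀ : ‖m₀.toLp _‖ = 1 :=
    norm_toLp_sqrtTransform m₀ (Eventually.of_forall fun _ => zero_le_one) (by simp)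
  have n₁ : ‖m₁.toLp _‖ = 1 :=
    norm_toLp_sqrtTransform m₁ (Eventually.of_forall fun _ => sq_nonneg _) D.integral_sq
  have hinner : Real.arccos (inner ℝ (m₀.toLp _) (m₁.toLp _)) = D.ρ := by
    rw [inner_toLp_sqrtTransform, CircleData.ρ]
    congr 1
    refine integral_congr_ae (Eventually.of_forall fun s => ?_)
    simp only [hcancel, Real.sqrt_one, one_mul, Real.sqrt_sq (D.r_pos s).le, zero_div, zero_sub,
      Real.cos_neg]
  refine ⟨b, fun t s => 2 * σ * (D.z t s).arg, m₀.toLp _, m₁.toLp _, hb, ?_, ?_, ?_, ?_, n₀, n₁, ?_⟩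
  · filter_upwards [ae_mem_Icc] with s hs using ⟨hab s hs, ha₁ s hs⟩
  · filter_upwards [ae_mem_Icc] with s hs
    refine ⟨fun t ht => ?_, by simp [CircleData.z_zero], ?_, fun t _ => rfl⟩
    · exact ((D.hasDerivAt_arg ht s).const_mul (2 * σ)).continuousAt.continuousWithinAt
    · simp only [CircleData.arg_z_one, hκ s hs]
  · filter_upwards [m₀.coeFn_toLp] with s hs
    rw [hs]
    simp [sqrtTransform]
  · filter_upwards [m₁.coeFn_toLp, ae_mem_Icc, posDeriv_ae_eq h] with s hs hI hp
    rw [hs]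
    simp only [hr, hp, hκ s hI]
  · intro t _
    rw [greatCircle_eq n₀ n₁, hinner]
    filter_upwards [m₀.coeFn_toLp, m₁.coeFn_toLp, Lp.coeFn_add
      (arcCoeff D.ρ (1 - t) • m₀.toLp _) (arcCoeff D.ρ t • m₁.toLp _),
      Lp.coeFn_smul (arcCoeff D.ρ (1 - t)) (m₀.toLp _),
      Lp.coeFn_smul (arcCoeff D.ρ t) (m₁.toLp _)] with s e0 e1 e2 e3 e4
    have hpol := D.z_polar t s
    have hre : (D.z t s).re = arcCoeff D.ρ (1 - t) +
      arcCoeff D.ρ t * (D.r s * Real.cos (D.κ s)) := rfl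
    have him : (D.z t s).im = arcCoeff D.ρ t * (D.r s * Real.sin (D.κ s)) := rfl
    rw [e2, Pi.add_apply, e3, e4, Pi.smul_apply, Pi.smul_apply, e0, e1]
    change _ = sqrtTransform σ (Complex.normSq (D.z t s)) _
    simp only [sqrtTransform, hcancel, Real.sqrt_sq (D.r_pos s).le]
    ext i
    fin_cases i
    · simpa using hre.symm.trans hpol.1
    · simpa using him.symm.trans hpol.2

/-- The factor `(σ'/σ)²` exactly compensates the change of weight in the second term and only
enlarges the first. A trajectory optimal for `σ'` close to `σ` is therefore almost optimal for `σ`.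
-/
theorem energy_le_of_le (hσ : 0 < σ) {σ' : ℝ} (hle : σ ≤ σ') (T : Trajectory d) :
    energy σ T ≤ ENNReal.ofReal ((σ' / σ) ^ 2) * energy σ' T := by
  have hσ' : 0 < σ' := hσ.trans_le hle
  unfold energy
  rw [mul_add, ← mul_assoc, ← ENNReal.ofReal_mul (by positivity)]
  refine add_le_add ?_ (le_of_eq ?_)
  · refine le_mul_of_one_le_left zero_le ?_
    rw [ENNReal.one_le_ofReal]
    exact one_le_pow₀ ((one_le_div hσ).2 hle)
  · congr 2
    field_simp

theorem tendsto_corr (hσ : 0 < σ) (h₀ : a₀ ∈ unitTangents d) (h₁ : a₁ ∈ unitTangents d)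
    (h : IsDiffeo φ₁) {u : ℕ → ℝ} (hu : Tendsto u atTop (𝓝 σ)) :
    Tendsto (fun n => corr (u n) a₀ a₁ φ₁) atTop (𝓝 (corr σ a₀ a₁ φ₁)) := by
  refine tendsto_integral_of_dominated_convergence (fun s => √(deriv φ₁ s))
    (fun n => (integrable_corr (u n) h₀ h₁ h).aestronglyMeasurable) (integrable_sqrt_deriv h)
    (fun n => Eventually.of_forall fun s => ?_) (Eventually.of_forall fun s => ?_)
  · rw [norm_mul, Real.norm_eq_abs, Real.norm_eq_abs, abs_of_nonneg (Real.sqrt_nonneg _)]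
    exact mul_le_of_le_one_right (Real.sqrt_nonneg _) (Real.abs_cos_le_one _)
  · refine Tendsto.const_mul _ ((Real.continuous_cos.tendsto _).comp ?_)
    exact tendsto_const_nhds.div (hu.const_mul 2) (by positivity)

/-- For the upper bound, minimisers for `u n = σ + 1/(n+1)` are used as competitors; `2 u n > 1`
even if `2σ = 1`. Both `u n / σ → 1` and `rho (u n) → rho σ`, the latter by dominated convergence.
-/
theorem iInf_energy_joinsWith (hd : 2 ≤ d) (hσ : 1 ≤ 2 * σ) (h₀ : a₀ ∈ unitTangents d)
    (h₁ : a₁ ∈ unitTangents d) (h : IsDiffeo φ₁) :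
    (⨅ T ∈ {T : Trajectory d | JoinsWith a₀ a₁ φ₁ T}, energy σ T) =
      ENNReal.ofReal (4 * rho σ a₀ a₁ φ₁ ^ 2) := by
  have hσ0 : 0 < σ := by linarith
  refine le_antisymm ?_ (le_iInf₂ fun T hT => T.four_mul_rho_sq_le_energy σ hσ0 hT)
  set u : ℕ → ℝ := fun n => σ + 1 / ((n : ℝ) + 1) with hu
  have hupos : ∀ n, σ < u n := fun n => by
    have : (0 : ℝ) < 1 / ((n : ℝ) + 1) := by positivity
    simp only [hu]; linarith
  have hlim : Tendsto u atTop (𝓝 σ) := by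
    have := (tendsto_one_div_add_atTop_nhds_zero_nat (𝕜 := ℝ)).const_add σ
    rwa [add_zero] at this
  have hle : ∀ n, (⨅ T ∈ {T : Trajectory d | JoinsWith a₀ a₁ φ₁ T}, energy σ T) ≤
      ENNReal.ofReal ((u n / σ) ^ 2 * (4 * rho (u n) a₀ a₁ φ₁ ^ 2)) := by
    intro n
    obtain ⟨T, hT, hE, -⟩ := exists_greatCircle_trajectory hd
      (show 1 < 2 * u n by linarith [hupos n]) h₀ h₁ h
    refine (iInf₂_le T hT).trans ((energy_le_of_le hσ0 (hupos n).le T).trans ?_)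
    rw [hE, ← ENNReal.ofReal_mul (sq_nonneg _)]
  have h1 : Tendsto (fun n => rho (u n) a₀ a₁ φ₁) atTop (𝓝 (rho σ a₀ a₁ φ₁)) :=
    (Real.continuous_arccos.tendsto _).comp (tendsto_corr hσ0 h₀ h₁ h hlim)
  have h2 : Tendsto (fun n => (u n / σ) ^ 2) atTop (𝓝 1) := by
    simpa [div_self hσ0.ne'] using (hlim.div_const σ).pow 2
  have h3 := h2.mul ((h1.pow 2).const_mul 4)
  rw [one_mul] at h3
  exact ge_of_tendsto' (ENNReal.tendsto_ofReal h3) hle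

theorem bddBelow_rho {ι : Type*} (σ : ℝ) (a₀ a₁ : ℝ → E d) (f : ι → ℝ → ℝ) :
    BddBelow (range fun i => rho σ a₀ a₁ (f i)) :=
  ⟨0, by rintro _ ⟨i, rfl⟩; exact rho_nonneg _ _ _ _⟩

theorem elasticDist_nonneg (σ : ℝ) (a₀ a₁ : ℝ → E d) : 0 ≤ elasticDist σ a₀ a₁ :=
  mul_nonneg zero_le_two (Real.iInf_nonneg fun _ => rho_nonneg _ _ _ _)

theorem elasticDist_le (σ : ℝ) (a₀ a₁ : ℝ → E d) (h : IsDiffeo φ₁) :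
    elasticDist σ a₀ a₁ ≤ 2 * rho σ a₀ a₁ φ₁ :=
  mul_le_mul_of_nonneg_left
    (ciInf_le (bddBelow_rho σ a₀ a₁ fun φ : {φ : ℝ → ℝ // IsDiffeo φ} => φ.1) ⟨φ₁, h⟩) zero_le_two

theorem exists_rho_lt (σ : ℝ) (a₀ a₁ : ℝ → E d) {ε : ℝ} (hε : 0 < ε) :
    ∃ φ, IsDiffeo φ ∧ 2 * rho σ a₀ a₁ φ < elasticDist σ a₀ a₁ + ε := by
  have : Nonempty {φ : ℝ → ℝ // IsDiffeo φ} := ⟨⟨_, isDiffeo_id⟩⟩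
  obtain ⟨φ, hφ⟩ := exists_lt_of_ciInf_lt (lt_add_of_pos_right
    (⨅ φ : {φ : ℝ → ℝ // IsDiffeo φ}, rho σ a₀ a₁ φ.1) (half_pos hε))
  refine ⟨φ.1, φ.2, ?_⟩
  unfold elasticDist
  linarith

theorem iInf_energy_joins (hd : 2 ≤ d) (hσ : 1 ≤ 2 * σ) (h₀ : a₀ ∈ unitTangents d)
    (h₁ : a₁ ∈ unitTangents d) :
    (⨅ T ∈ {T : Trajectory d | Joins a₀ a₁ T}, energy σ T) =
      ENNReal.ofReal (elasticDist σ a₀ a₁ ^ 2) := by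
  have hσ0 : 0 < σ := by linarith
  refine le_antisymm ?_ (le_iInf₂ fun T hT => ?_)
  · have hle : ∀ n : ℕ, (⨅ T ∈ {T : Trajectory d | Joins a₀ a₁ T}, energy σ T) ≤
        ENNReal.ofReal ((elasticDist σ a₀ a₁ + 1 / ((n : ℝ) + 1)) ^ 2) := by
      intro n
      obtain ⟨φ, hφ, hlt⟩ := exists_rho_lt σ a₀ a₁ (show (0 : ℝ) < 1 / ((n : ℝ) + 1) by positivity)
      calc (⨅ T ∈ {T : Trajectory d | Joins a₀ a₁ T}, energy σ T)
          ≤ ⨅ T ∈ {T : Trajectory d | JoinsWith a₀ a₁ φ T}, energy σ T :=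
            biInf_mono fun T hT => hT.2
        _ = ENNReal.ofReal ((2 * rho σ a₀ a₁ φ) ^ 2) := by
            rw [iInf_energy_joinsWith hd hσ h₀ h₁ hφ]; ring_nf
        _ ≤ _ := ENNReal.ofReal_le_ofReal (pow_le_pow_left₀
            (mul_nonneg zero_le_two (rho_nonneg _ _ _ _)) hlt.le 2)
    have hlim := ((tendsto_one_div_add_atTop_nhds_zero_nat (𝕜 := ℝ)).const_add
      (elasticDist σ a₀ a₁)).pow 2
    rw [add_zero] at hlim
    exact ge_of_tendsto' (ENNReal.tendsto_ofReal hlim) hle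
  · have h1 : (1 : ℝ) ∈ Icc (0 : ℝ) 1 := right_mem_Icc.2 zero_le_one
    refine le_trans (ENNReal.ofReal_le_ofReal ?_)
      (T.four_mul_rho_sq_le_energy σ hσ0 (φ₁ := T.φ 1) ⟨fun _ _ => rfl, hT⟩)
    calc elasticDist σ a₀ a₁ ^ 2 ≤ (2 * rho σ a₀ a₁ (T.φ 1)) ^ 2 :=
          pow_le_pow_left₀ (elasticDist_nonneg _ _ _) (elasticDist_le _ _ _ (T.isDiffeo 1 h1)) 2
      _ = 4 * rho σ a₀ a₁ (T.φ 1) ^ 2 := by ring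

end Metamorphosis

/-! ### Continuity of the correlation under `L¹` convergence of derivatives. -/

namespace Metamorphosis

open Filter Topology

variable {d : ℕ} {σ : ℝ} {a₀ a₁ : ℝ → E d} {φ ψ : ℝ → ℝ}

theorem lintegral_sq_le {F : ℝ → ℝ≥0∞} (hF : AEMeasurable F lebOmega) :
    (∫⁻ s, F s ∂lebOmega) ^ 2 ≤ ∫⁻ s, F s ^ 2 ∂lebOmega := by
  have h := ENNReal.lintegral_mul_le_Lp_mul_Lq lebOmega
    Real.HolderConjugate.two_two hF (aemeasurable_const (b := (1 : ℝ≥0∞)))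
  simp only [Pi.mul_apply, mul_one, ENNReal.rpow_ofNat, one_pow, lintegral_const,
    Measure.restrict_apply_univ, Real.volume_Icc, sub_zero, ENNReal.ofReal_one,
    ENNReal.one_rpow] at h
  calc (∫⁻ s, F s ∂lebOmega) ^ 2 ≤ _ := pow_le_pow_left' h 2
    _ = _ := by
        rw [← ENNReal.rpow_natCast, ← ENNReal.rpow_mul]
        norm_num

theorem tendsto_zero_of_sq_le {f g : ℕ → ℝ≥0∞} (hg : Tendsto g atTop (𝓝 0))
    (h : ∀ n, f n ^ 2 ≤ g n) : Tendsto f atTop (𝓝 0) := by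
  rw [ENNReal.tendsto_nhds_zero] at hg ⊢
  intro ε hε
  filter_upwards [hg (ε ^ 2) (by positivity)] with n hn
  exact (ENNReal.pow_le_pow_left_iff two_ne_zero).1 ((h n).trans hn)

theorem ofReal_sqrt_sq (x : ℝ) : ENNReal.ofReal (√x) ^ 2 = ENNReal.ofReal x := by
  rw [← ENNReal.ofReal_pow (Real.sqrt_nonneg x)]
  rcases le_total 0 x with h | h
  · rw [Real.sq_sqrt h]
  · rw [Real.sqrt_eq_zero_of_nonpos h, ENNReal.ofReal_of_nonpos h]; simp

theorem measurable_sqrt_deriv (φ : ℝ → ℝ) : Measurable fun s => √(deriv φ s) :=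
  Real.continuous_sqrt.measurable.comp (measurable_deriv φ)

/-- Cauchy–Schwarz, then change of variables. The weight `√φ'` makes composition bounded from `L²`
to `L¹` uniformly in `φ`, which is what permits merely measurable `a₁`. -/
theorem lintegral_sqrt_deriv_mul_comp_sq_le (h : IsDiffeo φ) {g : ℝ → ℝ≥0∞} (hg : Measurable g) :
    (∫⁻ s, ENNReal.ofReal (√(deriv φ s)) * g (φ s) ∂lebOmega) ^ 2 ≤
      ∫⁻ s, g s ^ 2 ∂lebOmega := by
  have hm : AEMeasurable (fun s => ENNReal.ofReal (√(deriv φ s)) * g (φ s)) lebOmega :=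
    (measurable_sqrt_deriv φ).ennreal_ofReal.aemeasurable.mul (aemeasurable_comp_diffeo hg h)
  refine (lintegral_sq_le hm).trans ?_
  simp only [mul_pow, ofReal_sqrt_sq]
  exact h.lintegral_deriv_mul_comp_le fun s => g s ^ 2

theorem lintegral_sqrt_deriv_le_one (h : IsDiffeo φ) :
    ∫⁻ s, ENNReal.ofReal (√(deriv φ s)) ∂lebOmega ≤ 1 := by
  have := lintegral_sqrt_deriv_mul_comp_sq_le h (measurable_const (a := (1 : ℝ≥0∞)))
  simp only [mul_one, one_pow, lintegral_const, Measure.restrict_apply_univ, Real.volume_Icc,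
    sub_zero, ENNReal.ofReal_one] at this
  exact (ENNReal.pow_le_pow_left_iff two_ne_zero).1 (by simpa using this)

theorem measurable_sqrt_gap (ψ φ : ℝ → ℝ) :
    Measurable fun s => ENNReal.ofReal |√(deriv ψ s) - √(deriv φ s)| :=
  ((measurable_sqrt_deriv ψ).sub (measurable_sqrt_deriv φ)).norm.ennreal_ofReal

/-- The distance in `L¹` of the derivatives. -/
noncomputable def derivGap (ψ φ : ℝ → ℝ) : ℝ≥0∞ :=
  ∫⁻ s, ENNReal.ofReal |deriv ψ s - deriv φ s| ∂lebOmega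

/-- `(√x - √y)² ≤ |√x - √y| (√x + √y) = |x - y|`. -/
theorem lintegral_sqrt_sub_sq_le (hψ : IsDiffeo ψ) (hφ : IsDiffeo φ) :
    (∫⁻ s, ENNReal.ofReal |√(deriv ψ s) - √(deriv φ s)| ∂lebOmega) ^ 2 ≤ derivGap ψ φ := by
  refine (lintegral_sq_le (measurable_sqrt_gap ψ φ).aemeasurable).trans (lintegral_mono_ae ?_)
  filter_upwards [hψ.deriv_pos, hφ.deriv_pos] with s h1 h2
  rw [← ENNReal.ofReal_pow (abs_nonneg _)]
  refine ENNReal.ofReal_le_ofReal ?_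
  have e : deriv ψ s - deriv φ s =
      (√(deriv ψ s) - √(deriv φ s)) * (√(deriv ψ s) + √(deriv φ s)) := by
    linear_combination -(Real.sq_sqrt h1.le) + Real.sq_sqrt h2.le
  have p1 := Real.sqrt_nonneg (deriv ψ s)
  have p2 := Real.sqrt_nonneg (deriv φ s)
  rw [e, abs_mul, sq, abs_of_nonneg (add_nonneg p1 p2)]
  exact mul_le_mul_of_nonneg_left (abs_le.2 ⟨by linarith, by linarith⟩) (abs_nonneg _)

theorem edist_le_derivGap (hψ : IsDiffeo ψ) (hφ : IsDiffeo φ) {s : ℝ} (hs : s ∈ Icc (0 : ℝ) 1) :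
    edist (ψ s) (φ s) ≤ derivGap ψ φ := by
  have hsub : uIcc 0 s ⊆ uIcc (0 : ℝ) 1 := by
    rw [uIcc_of_le hs.1, uIcc_of_le zero_le_one]; exact Icc_subset_Icc_right hs.2
  rw [edist_eq_enorm_sub, ← hψ.integral_deriv_eq hs, ← hφ.integral_deriv_eq hs,
    ← intervalIntegral.integral_sub (hψ.intervalIntegrable.mono_set hsub)
      (hφ.intervalIntegrable.mono_set hsub), intervalIntegral.integral_of_le hs.1]
  refine (enorm_integral_le_lintegral_enorm _).trans ?_
  simp only [derivGap, Real.enorm_eq_ofReal_abs]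
  exact lintegral_mono_set (Ioc_subset_Icc_self.trans (Icc_subset_Icc_right hs.2))

theorem exists_boundedContinuous_approx (h₁ : a₁ ∈ unitTangents d) {ε : ℝ≥0∞} (hε : ε ≠ 0) :
    ∃ c : BoundedContinuousFunction ℝ (E d), ∫⁻ s, ‖a₁ s - c s‖ₑ ^ 2 ∂lebOmega ≤ ε ^ 2 := by
  have hm : MemLp a₁ 2 lebOmega := by
    refine MemLp.of_bound h₁.1.aestronglyMeasurable 1 ?_
    filter_upwards [ae_mem_Icc] with s hs using (h₁.2 s hs).le
  obtain ⟨c, hc, -⟩ := hm.exists_boundedContinuous_eLpNorm_sub_le (by norm_num) hε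
  refine ⟨c, ?_⟩
  have e := eLpNorm_nnreal_pow_eq_lintegral (f := a₁ - (c : ℝ → E d)) (μ := lebOmega)
    (p := 2) two_ne_zero
  have h2 := pow_le_pow_left' hc 2
  simp only [NNReal.coe_ofNat, ENNReal.rpow_ofNat, ENNReal.coe_ofNat, Pi.sub_apply] at e
  rwa [e] at h2

/-- Replace `a₁` by a continuous `c` close to it in `L²`, and use uniform continuity of `c`. The
error `g = |a₁ - c|` composed with `ψ n` carries the wrong weight `√φ'`; exchanging it for `√(ψ n)'`
costs at most `M ∫ |√(ψ n)' - √φ'|`, where `M` bounds `g`. This makes four terms of size `ε/4`. -/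
theorem tendsto_lintegral_comp_sub (h₁ : a₁ ∈ unitTangents d) (hφ : IsDiffeo φ) {ψ : ℕ → ℝ → ℝ}
    (hψ : ∀ n, IsDiffeo (ψ n)) (hlim : Tendsto (fun n => derivGap (ψ n) φ) atTop (𝓝 0)) :
    Tendsto (fun n => ∫⁻ s, ENNReal.ofReal (√(deriv φ s)) * ‖a₁ (ψ n s) - a₁ (φ s)‖ₑ ∂lebOmega)
      atTop (𝓝 0) := by
  rw [ENNReal.tendsto_nhds_zero]
  intro ε hε
  have hε4 : ε / 4 ≠ 0 := (ENNReal.div_pos hε.ne' (by norm_num)).ne'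
  obtain ⟨c, hc⟩ := exists_boundedContinuous_approx h₁ hε4
  set g : ℝ → ℝ≥0∞ := fun s => ‖a₁ s - c s‖ₑ with hg
  have hgm : Measurable g := (h₁.1.sub c.continuous.measurable).enorm
  have hQ : ∀ {χ : ℝ → ℝ}, IsDiffeo χ →
      ∫⁻ s, ENNReal.ofReal (√(deriv χ s)) * g (χ s) ∂lebOmega ≤ ε / 4 := fun hχ =>
    (ENNReal.pow_le_pow_left_iff two_ne_zero).1
      ((lintegral_sqrt_deriv_mul_comp_sq_le hχ hgm).trans hc)
  set M : ℝ≥0∞ := ENNReal.ofReal (1 + ‖c‖) with hM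
  have hgM : ∀ x ∈ Icc (0 : ℝ) 1, g x ≤ M := fun x hx => by
    simp only [hg, hM]
    rw [← ofReal_norm]
    refine ENNReal.ofReal_le_ofReal ((norm_sub_le _ _).trans ?_)
    rw [h₁.2 x hx]
    exact add_le_add_right (c.norm_coe_le_norm x) _
  have ev1 : ∀ᶠ n in atTop,
      M * ∫⁻ s, ENNReal.ofReal |√(deriv (ψ n) s) - √(deriv φ s)| ∂lebOmega ≤ ε / 4 := by
    have h0 := ENNReal.Tendsto.const_mul (tendsto_zero_of_sq_le hlim
      fun n => lintegral_sqrt_sub_sq_le (hψ n) hφ) (Or.inr (ENNReal.ofReal_ne_top (r := 1 + ‖c‖)))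
    rw [mul_zero] at h0
    exact (ENNReal.tendsto_nhds_zero.1 h0) _ (pos_iff_ne_zero.2 hε4)
  have ev2 : ∀ᶠ n in atTop, ∀ s ∈ Icc (0 : ℝ) 1, ‖c (ψ n s) - c (φ s)‖ₑ ≤ ε / 4 := by
    have huc : UniformContinuousOn c (Icc 0 1) :=
      isCompact_Icc.uniformContinuousOn_of_continuous c.continuous.continuousOn
    obtain ⟨δ, hδ, hδc⟩ := EMetric.uniformContinuousOn_iff.1 huc (ε / 4) (pos_iff_ne_zero.2 hε4)
    filter_upwards [(tendsto_order.1 hlim).2 δ hδ] with n hn s hs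
    rw [← edist_eq_enorm_sub]
    exact (hδc ((hψ n).mapsTo hs) (hφ.mapsTo hs)
      ((edist_le_derivGap (hψ n) hφ hs).trans_lt hn)).le
  filter_upwards [ev1, ev2] with n e1 e2
  have m0 : AEMeasurable (fun s => ENNReal.ofReal (√(deriv φ s))) lebOmega :=
    (measurable_sqrt_deriv φ).ennreal_ofReal.aemeasurable
  have mg : ∀ {χ : ℝ → ℝ}, IsDiffeo χ →
      AEMeasurable (fun s => ENNReal.ofReal (√(deriv χ s)) * g (χ s)) lebOmega := fun hχ =>
    (measurable_sqrt_deriv _).ennreal_ofReal.aemeasurable.mul (aemeasurable_comp_diffeo hgm hχ)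
  have md : AEMeasurable (fun s => M * ENNReal.ofReal |√(deriv (ψ n) s) - √(deriv φ s)|)
      lebOmega := (measurable_sqrt_gap _ _).aemeasurable.const_mul M
  have mgd : AEMeasurable (fun s => ENNReal.ofReal (√(deriv (ψ n) s)) * g (ψ n s) +
      M * ENNReal.ofReal |√(deriv (ψ n) s) - √(deriv φ s)|) lebOmega := (mg (hψ n)).add md
  have hpt : ∀ᵐ s ∂lebOmega, ENNReal.ofReal (√(deriv φ s)) * ‖a₁ (ψ n s) - a₁ (φ s)‖ₑ ≤
      (ENNReal.ofReal (√(deriv (ψ n) s)) * g (ψ n s) +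
        M * ENNReal.ofReal |√(deriv (ψ n) s) - √(deriv φ s)|) +
      (ENNReal.ofReal (√(deriv φ s)) * g (φ s) + ENNReal.ofReal (√(deriv φ s)) * (ε / 4)) := by
    filter_upwards [ae_mem_Icc] with s hs
    have t1 : ‖a₁ (ψ n s) - a₁ (φ s)‖ₑ ≤ g (ψ n s) + (g (φ s) + ε / 4) := by
      have : a₁ (ψ n s) - a₁ (φ s) = (a₁ (ψ n s) - c (ψ n s)) +
          (-(a₁ (φ s) - c (φ s)) + (c (ψ n s) - c (φ s))) := by abel
      rw [this]
      refine (enorm_add_le _ _).trans (add_le_add le_rfl ((enorm_add_le _ _).trans ?_))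
      rw [enorm_neg]
      exact add_le_add le_rfl (e2 s hs)
    have t2 : ENNReal.ofReal (√(deriv φ s)) ≤ ENNReal.ofReal (√(deriv (ψ n) s)) +
        ENNReal.ofReal |√(deriv (ψ n) s) - √(deriv φ s)| := by
      rw [← ENNReal.ofReal_add (Real.sqrt_nonneg _) (abs_nonneg _)]
      refine ENNReal.ofReal_le_ofReal ?_
      have := neg_abs_le (√(deriv (ψ n) s) - √(deriv φ s))
      linarith
    calc ENNReal.ofReal (√(deriv φ s)) * ‖a₁ (ψ n s) - a₁ (φ s)‖ₑ
        ≤ ENNReal.ofReal (√(deriv φ s)) * (g (ψ n s) + (g (φ s) + ε / 4)) := by gcongr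
      _ = ENNReal.ofReal (√(deriv φ s)) * g (ψ n s) + (ENNReal.ofReal (√(deriv φ s)) * g (φ s) +
          ENNReal.ofReal (√(deriv φ s)) * (ε / 4)) := by rw [mul_add, mul_add]
      _ ≤ _ := by
          refine add_le_add ?_ le_rfl
          calc ENNReal.ofReal (√(deriv φ s)) * g (ψ n s)
              ≤ (ENNReal.ofReal (√(deriv (ψ n) s)) +
                ENNReal.ofReal |√(deriv (ψ n) s) - √(deriv φ s)|) * g (ψ n s) := by gcongr
            _ ≤ _ := by
                rw [add_mul, mul_comm M]
                gcongr
                exact hgM _ ((hψ n).mapsTo hs)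
  refine (lintegral_mono_ae hpt).trans ?_
  rw [lintegral_add_left' mgd, lintegral_add_left' (mg (hψ n)),
    lintegral_add_left' (mg hφ), lintegral_const_mul' _ _ (ENNReal.ofReal_ne_top),
    lintegral_mul_const'' _ m0]
  have e5 : (∫⁻ s, ENNReal.ofReal (√(deriv φ s)) ∂lebOmega) * (ε / 4) ≤ ε / 4 :=
    mul_le_of_le_one_left zero_le (lintegral_sqrt_deriv_le_one hφ)
  calc _ ≤ (ε / 4 + ε / 4) + (ε / 4 + ε / 4) :=
        add_le_add (add_le_add (hQ (hψ n)) e1) (add_le_add (hQ hφ) e5)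
    _ = ε := by
        rw [← two_mul, ← two_mul, ← mul_assoc]
        norm_num
        exact ENNReal.mul_div_cancel (by norm_num) (by norm_num)

theorem abs_cos_angle_sub_le (hσ : 1 ≤ 2 * σ) {x y y' : E d} (hy : ‖y‖ = 1) (hy' : ‖y'‖ = 1) :
    |Real.cos (InnerProductGeometry.angle x y / (2 * σ)) -
      Real.cos (InnerProductGeometry.angle x y' / (2 * σ))| ≤ Real.pi / 2 * ‖y - y'‖ := by
  have h1 := Real.lipschitzWith_cos.dist_le_mul (InnerProductGeometry.angle x y / (2 * σ))
    (InnerProductGeometry.angle x y' / (2 * σ))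
  rw [Real.dist_eq, Real.dist_eq, NNReal.coe_one, one_mul, ← sub_div, abs_div,
    abs_of_pos (show 0 < 2 * σ by linarith)] at h1
  have h5 := (angle_le_chord hy hy').2
  have h6 := InnerProductGeometry.angle_le_angle_add_angle x y y'
  have h7 := InnerProductGeometry.angle_le_angle_add_angle x y' y
  rw [InnerProductGeometry.angle_comm y' y] at h7
  calc _ ≤ _ := h1
    _ ≤ |InnerProductGeometry.angle x y - InnerProductGeometry.angle x y'| :=
        div_le_self (abs_nonneg _) hσ
    _ ≤ _ := abs_le.2 ⟨by linarith, by linarith⟩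

/-- The difference of the integrands splits into a change of `√φ'`, against a cosine bounded by `1`,
and a change of the cosine, which is Lipschitz in `a₁ ∘ φ`. -/
theorem tendsto_corr_of_derivGap (hσ : 1 ≤ 2 * σ) (h₀ : a₀ ∈ unitTangents d)
    (h₁ : a₁ ∈ unitTangents d) (hφ : IsDiffeo φ) {ψ : ℕ → ℝ → ℝ} (hψ : ∀ n, IsDiffeo (ψ n))
    (hlim : Tendsto (fun n => derivGap (ψ n) φ) atTop (𝓝 0)) :
    Tendsto (fun n => corr σ a₀ a₁ (ψ n)) atTop (𝓝 (corr σ a₀ a₁ φ)) := by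
  rw [tendsto_iff_edist_tendsto_0]
  have hA := tendsto_zero_of_sq_le hlim fun n => lintegral_sqrt_sub_sq_le (hψ n) hφ
  have hB := ENNReal.Tendsto.const_mul (a := ENNReal.ofReal (Real.pi / 2))
    (tendsto_lintegral_comp_sub h₁ hφ hψ hlim) (Or.inr ENNReal.ofReal_ne_top)
  have hAB := hA.add hB
  rw [mul_zero, add_zero] at hAB
  refine tendsto_of_tendsto_of_tendsto_of_le_of_le tendsto_const_nhds hAB (fun n => zero_le)
    fun n => ?_
  rw [edist_eq_enorm_sub, corr, corr, ← integral_sub (integrable_corr σ h₀ h₁ (hψ n))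
    (integrable_corr σ h₀ h₁ hφ)]
  refine (enorm_integral_le_lintegral_enorm _).trans ?_
  rw [← lintegral_const_mul' _ _ ENNReal.ofReal_ne_top, ← lintegral_add_left
    (measurable_sqrt_gap _ _)]
  refine lintegral_mono_ae ?_
  filter_upwards [ae_mem_Icc] with s hs
  have u0 := h₀.2 s hs
  have u1 := h₁.2 _ ((hψ n).mapsTo hs)
  have u2 := h₁.2 _ (hφ.mapsTo hs)
  rw [omega_eq_angle u0 u1, omega_eq_angle u0 u2, ← ofReal_norm (a₁ (ψ n s) - a₁ (φ s)),
    ← ENNReal.ofReal_mul (Real.sqrt_nonneg _), ← ENNReal.ofReal_mul (by positivity),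
    ← ENNReal.ofReal_add (abs_nonneg _) (by positivity), Real.enorm_eq_ofReal_abs]
  refine ENNReal.ofReal_le_ofReal ?_
  have h1 := abs_cos_angle_sub_le hσ (x := a₀ s) u1 u2
  set p := Real.cos (InnerProductGeometry.angle (a₀ s) (a₁ (ψ n s)) / (2 * σ)) with hp
  set q := Real.cos (InnerProductGeometry.angle (a₀ s) (a₁ (φ s)) / (2 * σ))
  have e : √(deriv (ψ n) s) * p - √(deriv φ s) * q =
      (√(deriv (ψ n) s) - √(deriv φ s)) * p + √(deriv φ s) * (p - q) := by ring
  rw [e]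
  refine (abs_add_le _ _).trans (add_le_add ?_ ?_)
  · rw [abs_mul]
    exact mul_le_of_le_one_right (abs_nonneg _) (Real.abs_cos_le_one _)
  · rw [abs_mul, abs_of_nonneg (Real.sqrt_nonneg _)]
    calc √(deriv φ s) * |p - q| ≤ √(deriv φ s) * (Real.pi / 2 * ‖a₁ (ψ n s) - a₁ (φ s)‖) :=
          mul_le_mul_of_nonneg_left h1 (Real.sqrt_nonneg _)
      _ = _ := by ring

end Metamorphosis

/-! ### Approximation by smooth diffeomorphisms. -/

namespace Metamorphosis

open Filter Topology

variable {d : ℕ} {σ : ℝ} {a₀ a₁ a₂ : ℝ → E d} {φ ψ : ℝ → ℝ}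

theorem isClassicalDiffeo_id (n : ℕ∞) : IsClassicalDiffeo n fun s => s where
  zero := rfl
  one := rfl
  contDiffOn := contDiffOn_id
  deriv_pos s hs := by
    rw [derivWithin_id' s _ (uniqueDiffOn_Icc zero_lt_one s hs)]
    exact one_pos

theorem isClassicalDiffeo_of_polynomial {p : Polynomial ℝ} (hp : ∀ s ∈ Icc (0 : ℝ) 1, 0 < p.eval s)
    (hI : 0 < ∫ u in (0 : ℝ)..1, p.eval u) (n : ℕ∞) :
    IsClassicalDiffeo n fun s => (∫ u in (0 : ℝ)..s, p.eval u) / ∫ u in (0 : ℝ)..1, p.eval u := by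
  have hd : ∀ s : ℝ, HasDerivAt (fun s => (∫ u in (0 : ℝ)..s, p.eval u) / ∫ u in (0 : ℝ)..1,
      p.eval u) (p.eval s / ∫ u in (0 : ℝ)..1, p.eval u) s := fun s =>
    (p.continuous.integral_hasStrictDerivAt 0 s).hasDerivAt.div_const _
  refine ⟨by simp, div_self hI.ne', ?_, fun s hs => ?_⟩
  · refine (ContDiff.of_le (n := (⊤ : ℕ∞)) ?_ (by exact_mod_cast le_top)).contDiffOn
    rw [contDiff_infty_iff_deriv]
    refine ⟨fun s => (hd s).differentiableAt, ?_⟩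
    rw [funext fun s => (hd s).deriv]
    have hp' := p.contDiff_aeval (𝕜 := ℝ) ((⊤ : ℕ∞) : WithTop ℕ∞)
    simp only [Polynomial.coe_aeval_eq_eval] at hp'
    exact hp'.div_const _
  · rw [(hd s).hasDerivWithinAt.derivWithin (uniqueDiffOn_Icc zero_lt_one s hs)]
    exact div_pos (hp s hs) hI

/-- Approximate `φ'` in `L¹` by a positive polynomial and take its normalised primitive, which is
smooth with positive derivative up to the boundary. -/
theorem exists_classicalDiffeo_near (hφ : IsDiffeo φ) {ε : ℝ} (hε : 0 < ε) :
    ∃ ψ, (∀ n : ℕ∞, IsClassicalDiffeo n ψ) ∧ derivGap ψ φ ≤ ENNReal.ofReal ε := by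
  -- The polynomial is within `3η` of `φ'` in `L¹`, and dividing by its integral `I` costs another
  -- `|I - 1| ≤ 3η`. The bound `1/6` keeps `I ≥ 1/2`.
  set η : ℝ := min (ε / 6) (1 / 6) with hη
  have hη0 : 0 < η := lt_min (by positivity) (by norm_num)
  have hηε : 6 * η ≤ ε := by linarith [min_le_left (ε / 6) (1 / 6)]
  have hη1 : 6 * η ≤ 1 := by linarith [min_le_right (ε / 6) (1 / 6)]
  set f := deriv φ with hf
  have hfi : Integrable f lebOmega := hφ.integrable
  obtain ⟨g, hg, hgi⟩ := hfi.exists_boundedContinuous_integral_sub_le hη0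
  -- Truncating `g` at `0` brings it no farther from the positive `φ'`; the shift by `η` keeps the
  -- polynomial positive.
  obtain ⟨p, hp⟩ := exists_polynomial_near_of_continuousOn 0 1 (fun s => max (g s) 0 + η)
    (((g.continuous.max continuous_const).add continuous_const).continuousOn) η hη0
  have hppos : ∀ s ∈ Icc (0 : ℝ) 1, 0 < p.eval s := fun s hs => by
    have h1 := (abs_lt.1 (hp s hs)).1
    have h2 := le_max_right (g s) 0
    linarith
  have hpi : Integrable (fun s => p.eval s) lebOmega := p.continuous.integrableOn_Icc
  have hpf : ∫ s, |p.eval s - f s| ∂lebOmega ≤ 3 * η := by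
    calc ∫ s, |p.eval s - f s| ∂lebOmega ≤ ∫ s, (2 * η + ‖f s - g s‖) ∂lebOmega := by
          refine integral_mono_ae (hpi.sub hfi).abs
            ((integrable_const _).add (hfi.sub hgi).norm) ?_
          filter_upwards [hφ.deriv_pos, ae_mem_Icc] with s h0 hs
          have h1 := abs_lt.1 (hp s hs)
          have h0' : 0 ≤ f s := h0.le
          rw [Real.norm_eq_abs]
          have h2 : |max (g s) 0 - f s| ≤ |f s - g s| := by
            have := abs_max_sub_max_le_abs (g s) (f s) 0
            rwa [max_eq_left h0', abs_sub_comm (g s)] at this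
          have h3 := abs_le.1 h2
          exact abs_le.2 ⟨by linarith, by linarith⟩
      _ = 2 * η + ∫ s, ‖f s - g s‖ ∂lebOmega := by
          have h1 : Integrable (fun s => ‖f s - g s‖) lebOmega := (hfi.sub hgi).norm
          rw [integral_add (integrable_const _) h1]; simp
      _ ≤ 3 * η := by linarith
  set I : ℝ := ∫ u in (0 : ℝ)..1, p.eval u with hI
  have hIeq : I = ∫ s, p.eval s ∂lebOmega := by
    rw [hI, intervalIntegral.integral_of_le zero_le_one, integral_Icc_eq_integral_Ioc]
  have hI1 : |I - 1| ≤ 3 * η := by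
    rw [hIeq, ← hφ.integral_deriv, ← integral_sub hpi hfi]
    exact (abs_integral_le_integral_abs).trans hpf
  have hI0 : 0 < I := by linarith [(abs_le.1 hI1).1]
  refine ⟨fun s => (∫ u in (0 : ℝ)..s, p.eval u) / I,
    fun n => isClassicalDiffeo_of_polynomial hppos hI0 n, ?_⟩
  have hint : Integrable (fun s => |p.eval s / I - f s|) lebOmega :=
    ((hpi.div_const I).sub hfi).abs
  have hint' : Integrable (fun s => |p.eval s - f s|) lebOmega := (hpi.sub hfi).abs
  have hd : ∀ s : ℝ, deriv (fun s => (∫ u in (0 : ℝ)..s, p.eval u) / I) s = p.eval s / I :=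
    fun s => ((p.continuous.integral_hasStrictDerivAt 0 s).hasDerivAt.div_const _).deriv
  simp only [derivGap, hd]
  rw [← ofReal_integral_eq_lintegral_ofReal hint
    (Eventually.of_forall fun s => abs_nonneg _)]
  refine ENNReal.ofReal_le_ofReal ?_
  calc ∫ s, |p.eval s / I - f s| ∂lebOmega
      ≤ ∫ s, (|p.eval s - f s| + |1 - I| / I * p.eval s) ∂lebOmega := by
        refine integral_mono_ae hint (hint'.add (hpi.const_mul _)) ?_
        filter_upwards [ae_mem_Icc] with s hs
        have e : p.eval s / I - f s = (p.eval s - f s) + (1 - I) / I * p.eval s := by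
          field_simp; ring
        rw [e]
        refine (abs_add_le _ _).trans (le_of_eq ?_)
        rw [abs_mul, abs_div, abs_of_pos hI0, abs_of_pos (hppos s hs)]
    _ = ∫ s, |p.eval s - f s| ∂lebOmega + |1 - I| := by
        rw [integral_add hint' (hpi.const_mul _), integral_const_mul, ← hIeq,
          div_mul_cancel₀ _ hI0.ne']
    _ ≤ ε := by rw [abs_sub_comm]; linarith

theorem exists_classicalDiffeo_tendsto (hσ : 1 ≤ 2 * σ) (h₀ : a₀ ∈ unitTangents d)
    (h₁ : a₁ ∈ unitTangents d) (hφ : IsDiffeo φ) :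
    ∃ ψ : ℕ → ℝ → ℝ, (∀ k (n : ℕ∞), IsClassicalDiffeo n (ψ k)) ∧
      Tendsto (fun k => rho σ a₀ a₁ (ψ k)) atTop (𝓝 (rho σ a₀ a₁ φ)) := by
  have h : ∀ k : ℕ, ∃ ψ, (∀ n : ℕ∞, IsClassicalDiffeo n ψ) ∧
      derivGap ψ φ ≤ ENNReal.ofReal (1 / ((k : ℝ) + 1)) := fun k =>
    exists_classicalDiffeo_near hφ (by positivity)
  choose ψ hψ hgap using h
  have hlim : Tendsto (fun k => derivGap (ψ k) φ) atTop (𝓝 0) := by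
    have h1 := ENNReal.tendsto_ofReal (tendsto_one_div_add_atTop_nhds_zero_nat (𝕜 := ℝ))
    rw [ENNReal.ofReal_zero] at h1
    exact tendsto_of_tendsto_of_tendsto_of_le_of_le tendsto_const_nhds h1 (fun _ => zero_le) hgap
  exact ⟨ψ, hψ, (Real.continuous_arccos.tendsto _).comp
    (tendsto_corr_of_derivGap hσ h₀ h₁ hφ (fun k => (hψ k 1).isDiffeo) hlim)⟩

theorem elasticDist_eq_iInf_classical (hσ : 1 ≤ 2 * σ) (h₀ : a₀ ∈ unitTangents d)
    (h₁ : a₁ ∈ unitTangents d) {n : ℕ∞} (hn : 1 ≤ n) : elasticDist σ a₀ a₁ =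
      2 * ⨅ φ₁ : {φ : ℝ → ℝ // IsClassicalDiffeo n φ}, rho σ a₀ a₁ φ₁.1 := by
  have : Nonempty {φ : ℝ → ℝ // IsClassicalDiffeo n φ} := ⟨⟨_, isClassicalDiffeo_id n⟩⟩
  have : Nonempty {φ : ℝ → ℝ // IsDiffeo φ} := ⟨⟨_, isDiffeo_id⟩⟩
  unfold elasticDist
  congr 1
  refine le_antisymm (le_ciInf fun φ => ?_) (le_ciInf fun φ => ?_)
  · exact ciInf_le (bddBelow_rho σ a₀ a₁ fun φ : {φ : ℝ → ℝ // IsDiffeo φ} => φ.1)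
      ⟨φ.1, (φ.2.mono hn).isDiffeo⟩
  · obtain ⟨ψ, hψ, hlim⟩ := exists_classicalDiffeo_tendsto hσ h₀ h₁ φ.2
    exact ge_of_tendsto' hlim fun k =>
      ciInf_le (bddBelow_rho σ a₀ a₁ fun φ : {φ : ℝ → ℝ // IsClassicalDiffeo n φ} => φ.1)
        ⟨ψ k, hψ k n⟩

/-- Almost optimal diffeomorphisms can be taken `C¹`, so that inversion, composition and change of
variables are classical. -/
theorem exists_classical_rho_lt (hσ : 1 ≤ 2 * σ) (h₀ : a₀ ∈ unitTangents d)
    (h₁ : a₁ ∈ unitTangents d) {ε : ℝ} (hε : 0 < ε) :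
    ∃ φ, IsClassicalDiffeo 1 φ ∧ 2 * rho σ a₀ a₁ φ < elasticDist σ a₀ a₁ + ε := by
  have : Nonempty {φ : ℝ → ℝ // IsClassicalDiffeo 1 φ} := ⟨⟨_, isClassicalDiffeo_id 1⟩⟩
  obtain ⟨φ, hφ⟩ := exists_lt_of_ciInf_lt (lt_add_of_pos_right
    (⨅ φ : {φ : ℝ → ℝ // IsClassicalDiffeo 1 φ}, rho σ a₀ a₁ φ.1) (half_pos hε))
  refine ⟨φ.1, φ.2, ?_⟩
  rw [elasticDist_eq_iInf_classical hσ h₀ h₁ le_rfl]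
  linarith

end Metamorphosis

/-! ### Definiteness of the distance. -/

namespace Metamorphosis

open Filter Topology

variable {d : ℕ} {σ : ℝ} {a₀ a₁ a₂ : ℝ → E d} {φ ψ : ℝ → ℝ}

/-- With `x = √φ'` and `I = ∫ x`, one has `|x² - 1| ≤ ((x-1)²/δ + δ (x+1)²)/2`. Integrating with `∫
x² = 1` gives `(1 - I)/δ + δ (1 + I)`, at most `δ + 2δ`. -/
theorem derivGap_id_le (h : IsDiffeo φ) {δ : ℝ} (hδ : 0 < δ)
    (hI : 1 - δ ^ 2 ≤ ∫ s, √(deriv φ s) ∂lebOmega) :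
    derivGap φ (fun s => s) ≤ ENNReal.ofReal (3 * δ) := by
  have hsq := integrable_sqrt_deriv h
  have h1i : Integrable (fun s => deriv φ s + 1) lebOmega := h.integrable.add (integrable_const 1)
  have hai : Integrable (fun s => |deriv φ s - 1|) lebOmega :=
    (h.integrable.sub (integrable_const 1)).abs
  have hi : Integrable (fun s => (1 / (2 * δ) + δ / 2) * (deriv φ s + 1) -
      (1 / δ - δ) * √(deriv φ s)) lebOmega :=
    (h1i.const_mul _).sub (hsq.const_mul _)
  have hpt : ∀ᵐ s ∂lebOmega, |deriv φ s - 1| ≤ (1 / (2 * δ) + δ / 2) * (deriv φ s + 1) -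
      (1 / δ - δ) * √(deriv φ s) := by
    filter_upwards [h.deriv_pos] with s hs
    set x := √(deriv φ s) with hx
    have hx2 : deriv φ s = x ^ 2 := (Real.sq_sqrt hs.le).symm
    have hx0 : 0 ≤ x := Real.sqrt_nonneg _
    have e : (1 / (2 * δ) + δ / 2) * (x ^ 2 + 1) - (1 / δ - δ) * x =
        ((x - 1) ^ 2 + (δ * (x + 1)) ^ 2) / (2 * δ) := by
      field_simp
      ring
    rw [hx2, e, le_div_iff₀ (by positivity), show x ^ 2 - 1 = (x - 1) * (x + 1) by ring, abs_mul,
      abs_of_nonneg (by linarith : 0 ≤ x + 1), ← sq_abs (x - 1)]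
    nlinarith [sq_nonneg (|x - 1| - δ * (x + 1))]
  have hle : ∫ s, |deriv φ s - 1| ∂lebOmega ≤ 3 * δ := by
    refine (integral_mono_ae hai hi hpt).trans ?_
    rw [integral_sub (h1i.const_mul _) (hsq.const_mul _),
      integral_const_mul, integral_const_mul, integral_add h.integrable (integrable_const _),
      h.integral_deriv]
    have hI1 := integral_sqrt_deriv_le h
    set I := ∫ s, √(deriv φ s) ∂lebOmega
    have hc : ∫ _, (1 : ℝ) ∂lebOmega = 1 := by simp
    have e : (1 / (2 * δ) + δ / 2) * (1 + 1) - (1 / δ - δ) * I = (1 - I) / δ + δ * (1 + I) := by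
      field_simp
      ring
    rw [hc, e]
    have h1 : (1 - I) / δ ≤ δ := by
      rw [div_le_iff₀ hδ]
      linarith [sq δ]
    nlinarith
  unfold derivGap
  simp only [deriv_id'']
  rw [← ofReal_integral_eq_lintegral_ofReal hai
    (Eventually.of_forall fun s => abs_nonneg _)]
  exact ENNReal.ofReal_le_ofReal hle

theorem corr_id (σ : ℝ) (a₀ a₁ : ℝ → E d) : corr σ a₀ a₁ (fun s => s) =
    ∫ s, Real.cos (omega a₀ a₁ (fun s => s) s / (2 * σ)) ∂lebOmega := by
  simp [corr]

theorem one_sub_sq_le_corr {ε : ℝ} (hε : 0 ≤ ε) (hε1 : ε ≤ 1) (h : rho σ a₀ a₁ φ < ε) :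
    1 - ε ^ 2 ≤ corr σ a₀ a₁ φ := by
  have h1 : Real.cos ε ≤ corr σ a₀ a₁ φ := by
    by_contra! hlt
    have := Real.arccos_le_arccos hlt.le
    rw [Real.arccos_cos hε (by linarith [Real.pi_gt_three])] at this
    exact absurd h (not_lt.2 this)
  nlinarith [Real.one_sub_sq_div_two_le_cos (x := ε), sq_nonneg ε]

/-- If the distance is `0`, some `φ n` have correlation tending to `1`. As `corr ≤ ∫ √(φ n)'`, their
derivatives tend to `1` in `L¹`, so the identity has correlation `1` by continuity. Then `cos (ω/2σ)
= 1` a.e., and `0 ≤ ω/2σ ≤ π` forces `ω = 0`. -/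
theorem elasticDist_eq_zero_iff (hσ : 1 ≤ 2 * σ) (h₀ : a₀ ∈ unitTangents d)
    (h₁ : a₁ ∈ unitTangents d) : elasticDist σ a₀ a₁ = 0 ↔ a₀ =ᵐ[lebOmega] a₁ := by
  constructor
  · intro h
    have hφ : ∀ n : ℕ, ∃ φ, IsDiffeo φ ∧ 1 - (1 / ((n : ℝ) + 1)) ^ 2 ≤ corr σ a₀ a₁ φ := fun n => by
      have hn : (0 : ℝ) < 1 / ((n : ℝ) + 1) := by positivity
      obtain ⟨φ, hφ, hlt⟩ := exists_rho_lt σ a₀ a₁ hn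
      refine ⟨φ, hφ, one_sub_sq_le_corr hn.le ?_ (by linarith [rho_nonneg σ a₀ a₁ φ])⟩
      exact (div_le_one (by positivity)).2 (by linarith [n.cast_nonneg (α := ℝ)])
    choose φ hφ hcorr using hφ
    have hn0 := tendsto_one_div_add_atTop_nhds_zero_nat (𝕜 := ℝ)
    have hgap : Tendsto (fun n => derivGap (φ n) fun s => s) atTop (𝓝 0) := by
      have h3 := ENNReal.tendsto_ofReal (hn0.const_mul 3)
      rw [mul_zero, ENNReal.ofReal_zero] at h3
      exact tendsto_of_tendsto_of_tendsto_of_le_of_le tendsto_const_nhds h3 (fun n => zero_le)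
        fun n => derivGap_id_le (hφ n) (by positivity)
          ((hcorr n).trans (corr_le_integral_sqrt_deriv σ h₀ h₁ (hφ n)))
    have hlim := tendsto_corr_of_derivGap hσ h₀ h₁ isDiffeo_id hφ hgap
    have hge : 1 ≤ corr σ a₀ a₁ fun s => s := by
      refine le_of_tendsto_of_tendsto' ?_ hlim hcorr
      simpa using (hn0.pow 2).const_sub 1
    rw [corr_id] at hge
    have hint : Integrable (fun s => Real.cos (omega a₀ a₁ (fun s => s) s / (2 * σ))) lebOmega := by
      simpa using integrable_corr σ h₀ h₁ isDiffeo_id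
    have hz : ∫ s, (1 - Real.cos (omega a₀ a₁ (fun s => s) s / (2 * σ))) ∂lebOmega = 0 := by
      refine le_antisymm ?_ (integral_nonneg fun s => sub_nonneg.2 (Real.cos_le_one _))
      rw [integral_sub (integrable_const _) hint]
      simpa using hge
    rw [integral_eq_zero_iff_of_nonneg (fun s => sub_nonneg.2 (Real.cos_le_one _))
      ((integrable_const _).sub hint)] at hz
    filter_upwards [hz, ae_mem_Icc] with s hs hI
    have hcos : Real.cos (omega a₀ a₁ (fun s => s) s / (2 * σ)) = 1 := (sub_eq_zero.1 hs).symm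
    have hw0 := omega_nonneg a₀ a₁ (fun s => s) s
    have hw1 := omega_le_pi a₀ a₁ (fun s => s) s
    have hle : omega a₀ a₁ (fun s => s) s / (2 * σ) ≤ Real.pi := (div_le_self hw0 hσ).trans hw1
    replace hz := (Real.cos_eq_one_iff_of_lt_of_lt
      (by linarith [Real.pi_pos, div_nonneg hw0 (by linarith : 0 ≤ 2 * σ)])
      (by linarith [Real.pi_pos])).1 hcos
    replace hz := (div_eq_zero_iff.1 hz).resolve_right (by linarith)
    have hin := real_inner_le_norm (a₀ s) (a₁ s)
    rw [h₀.2 s hI, h₁.2 s hI, mul_one] at hin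
    exact (inner_eq_one_iff_of_norm_eq_one (𝕜 := ℝ) (h₀.2 s hI) (h₁.2 s hI)).1
      (le_antisymm hin (Real.arccos_eq_zero.1 hz))
  · intro h
    refine le_antisymm ((elasticDist_le σ a₀ a₁ isDiffeo_id).trans ?_) (elasticDist_nonneg σ a₀ a₁)
    have : corr σ a₀ a₁ (fun s => s) = 1 := by
      rw [corr_id]
      have : ∫ s, Real.cos (omega a₀ a₁ (fun s => s) s / (2 * σ)) ∂lebOmega =
          ∫ _, (1 : ℝ) ∂lebOmega := by
        refine integral_congr_ae ?_
        filter_upwards [h, ae_mem_Icc] with s hs hI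
        rw [omega, ← hs, real_inner_self_eq_norm_sq, h₀.2 s hI]
        simp
      rw [this]
      simp
    rw [rho_eq_arccos_corr, this, Real.arccos_one, mul_zero]

end Metamorphosis

/-! ### Symmetry and the triangle inequality. -/

namespace Metamorphosis

open Filter Topology

variable {d : ℕ} {σ : ℝ} {a₀ a₁ a₂ : ℝ → E d} {φ ψ : ℝ → ℝ}

namespace IsClassicalDiffeo

theorem mapsTo_Ioo (h : IsClassicalDiffeo 1 φ) : MapsTo φ (Ioo 0 1) (Ioo 0 1) := fun _ hs =>
  ⟨h.zero ▸ h.strictMonoOn (left_mem_Icc.2 zero_le_one) (Ioo_subset_Icc_self hs) hs.1,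
    h.one ▸ h.strictMonoOn (Ioo_subset_Icc_self hs) (right_mem_Icc.2 zero_le_one) hs.2⟩

theorem deriv_pos_of_mem_Ioo (h : IsClassicalDiffeo 1 φ) {s : ℝ} (hs : s ∈ Ioo (0 : ℝ) 1) :
    0 < deriv φ s := by
  rw [(h.hasDerivAt hs).deriv]
  exact h.deriv_pos s (Ioo_subset_Icc_self hs)

theorem comp (hψ : IsClassicalDiffeo 1 ψ) (hφ : IsClassicalDiffeo 1 φ) :
    IsClassicalDiffeo 1 fun s => ψ (φ s) where
  zero := by rw [hφ.zero, hψ.zero]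
  one := by rw [hφ.one, hψ.one]
  contDiffOn := hψ.contDiffOn.comp hφ.contDiffOn hφ.isDiffeo.mapsTo
  deriv_pos s hs := by
    have h := (hψ.hasDerivWithinAt (hφ.isDiffeo.mapsTo hs)).comp s (hφ.hasDerivWithinAt hs)
      hφ.isDiffeo.mapsTo
    have e := h.derivWithin (uniqueDiffOn_Icc zero_lt_one s hs)
    exact e ▸ mul_pos (hψ.deriv_pos _ (hφ.isDiffeo.mapsTo hs)) (hφ.deriv_pos s hs)

theorem deriv_comp (hψ : IsClassicalDiffeo 1 ψ) (hφ : IsClassicalDiffeo 1 φ) {s : ℝ}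
    (hs : s ∈ Ioo (0 : ℝ) 1) : deriv (fun s => ψ (φ s)) s = deriv ψ (φ s) * deriv φ s := by
  rw [(hψ.hasDerivAt (hφ.mapsTo_Ioo hs)).deriv, (hφ.hasDerivAt hs).deriv]
  exact ((hψ.hasDerivAt (hφ.mapsTo_Ioo hs)).comp s (hφ.hasDerivAt hs)).deriv

/-- On the compact interval `φ'` has a positive minimum `m`, so the inverse is `m⁻¹`-Lipschitz and
hence absolutely continuous. -/
theorem exists_inverse (h : IsClassicalDiffeo 1 φ) : ∃ ψ, IsDiffeo ψ ∧
    (∀ s ∈ Icc (0 : ℝ) 1, ψ (φ s) = s) ∧ ∀ s ∈ Ioo (0 : ℝ) 1, deriv ψ (φ s) = (deriv φ s)⁻¹ := by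
  have hinj := h.strictMonoOn.injOn
  set ψ := Function.invFunOn φ (Icc 0 1) with hψ
  have hl : ∀ s ∈ Icc (0 : ℝ) 1, ψ (φ s) = s := fun s hs => hinj.leftInvOn_invFunOn hs
  have hmem : ∀ t ∈ Icc (0 : ℝ) 1, ψ t ∈ Icc (0 : ℝ) 1 := fun t ht =>
    Function.invFunOn_mem (by rwa [← h.image] at ht)
  have hr : ∀ t ∈ Icc (0 : ℝ) 1, φ (ψ t) = t := fun t ht =>
    Function.invFunOn_eq (by rwa [← h.image] at ht)
  obtain ⟨x, hx, hmin⟩ := isCompact_Icc.exists_isMinOn (nonempty_Icc.2 (zero_le_one' ℝ))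
    (h.contDiffOn.continuousOn_derivWithin (uniqueDiffOn_Icc zero_lt_one) le_rfl)
  set m := derivWithin φ (Icc 0 1) x
  have hm : 0 < m := h.deriv_pos x hx
  have hexp : ∀ s ∈ Icc (0 : ℝ) 1, ∀ t ∈ Icc (0 : ℝ) 1, s ≤ t → m * (t - s) ≤ φ t - φ s := by
    refine Convex.mul_sub_le_image_sub_of_le_deriv (convex_Icc 0 1) h.contDiffOn.continuousOn ?_ ?_
    · exact (h.contDiffOn.differentiableOn (by simp)).mono interior_subset
    · intro s hs
      rw [interior_Icc] at hs
      rw [(h.hasDerivAt hs).deriv]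
      exact hmin (Ioo_subset_Icc_self hs)
  have hmono : StrictMonoOn ψ (Icc 0 1) := fun s hs t ht hst => by
    by_contra! hle
    have := h.strictMonoOn.monotoneOn (hmem t ht) (hmem s hs) hle
    rw [hr s hs, hr t ht] at this
    exact absurd hst (not_lt.2 this)
  have hlip : LipschitzOnWith (Real.toNNReal m⁻¹) ψ (uIcc 0 1) := by
    rw [uIcc_of_le zero_le_one]
    refine LipschitzOnWith.of_dist_le' ?_
    have key : ∀ s ∈ Icc (0 : ℝ) 1, ∀ t ∈ Icc (0 : ℝ) 1, s ≤ t → dist (ψ s) (ψ t) ≤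
        m⁻¹ * dist s t := fun s hs t ht hst => by
      have h1 := hmono.monotoneOn hs ht hst
      have h2 := hexp _ (hmem s hs) _ (hmem t ht) h1
      rw [hr s hs, hr t ht] at h2
      rw [dist_comm, dist_comm s, Real.dist_eq, Real.dist_eq, abs_of_nonneg (by linarith),
        abs_of_nonneg (by linarith), inv_mul_eq_div, le_div_iff₀ hm]
      linarith
    intro s hs t ht
    rcases le_total s t with hst | hst
    · exact key s hs t ht hst
    · rw [dist_comm, dist_comm s]
      exact key t ht s hs hst
  have hd : ∀ s ∈ Ioo (0 : ℝ) 1, HasDerivAt ψ (deriv φ s)⁻¹ (φ s) := fun s hs => by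
    have hφs := h.mapsTo_Ioo hs
    have hs' := Ioo_subset_Icc_self hs
    refine HasDerivAt.of_local_left_inverse (f := φ) ?_ ?_ (h.deriv_pos_of_mem_Ioo hs).ne' ?_
    · rw [uIcc_of_le zero_le_one] at hlip
      exact hlip.continuousOn.continuousAt (Icc_mem_nhds hφs.1 hφs.2)
    · rw [hl s hs', (h.hasDerivAt hs).deriv]
      exact h.hasDerivAt hs
    · filter_upwards [Icc_mem_nhds hφs.1 hφs.2] with t ht using hr t ht
  have h0 : ψ 0 = 0 := by
    have := hl 0 (left_mem_Icc.2 zero_le_one)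
    rwa [h.zero] at this
  have h1 : ψ 1 = 1 := by
    have := hl 1 (right_mem_Icc.2 zero_le_one)
    rwa [h.one] at this
  refine ⟨ψ, ⟨h0, h1, hmono, hlip.absolutelyContinuousOnInterval, ?_⟩, hl,
    fun s hs => (hd s hs).deriv⟩
  filter_upwards [ae_mem_Ioo] with t ht
  have ht' := Ioo_subset_Icc_self ht
  have hψt : ψ t ∈ Ioo (0 : ℝ) 1 :=
    ⟨h0 ▸ hmono (left_mem_Icc.2 zero_le_one) ht' ht.1,
      h1 ▸ hmono ht' (right_mem_Icc.2 zero_le_one) ht.2⟩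
  have := (hd _ hψt).deriv
  rw [hr t ht'] at this
  rw [this]
  exact inv_pos.2 (h.deriv_pos_of_mem_Ioo hψt)

/-- Substitute `φ(s)` in the integral for the inverse: `φ' √(1/φ') = √φ'`. -/
theorem exists_rho_swap_eq (σ : ℝ) (a₀ a₁ : ℝ → E d) (h : IsClassicalDiffeo 1 φ) :
    ∃ ψ, IsDiffeo ψ ∧ rho σ a₁ a₀ ψ = rho σ a₀ a₁ φ := by
  obtain ⟨ψ, hψ, hl, hd⟩ := h.exists_inverse
  refine ⟨ψ, hψ, ?_⟩
  rw [rho_eq_arccos_corr, rho_eq_arccos_corr, corr, h.integral_comp]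
  congr 1
  refine integral_congr_ae ?_
  filter_upwards [ae_mem_Ioo] with s hs
  have hp := h.deriv_pos_of_mem_Ioo hs
  rw [hd s hs, omega, omega, hl s (Ioo_subset_Icc_self hs), real_inner_comm, ← mul_assoc]
  congr 1
  rw [Real.sqrt_inv, mul_inv_eq_iff_eq_mul₀ (Real.sqrt_pos.2 hp).ne', Real.mul_self_sqrt hp.le]

end IsClassicalDiffeo

theorem elasticDist_le_swap (hσ : 1 ≤ 2 * σ) (h₀ : a₀ ∈ unitTangents d)
    (h₁ : a₁ ∈ unitTangents d) : elasticDist σ a₁ a₀ ≤ elasticDist σ a₀ a₁ := by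
  refine le_of_forall_pos_le_add fun ε hε => ?_
  obtain ⟨φ, hφ, hlt⟩ := exists_classical_rho_lt hσ h₀ h₁ hε
  obtain ⟨ψ, hψ, he⟩ := hφ.exists_rho_swap_eq σ a₀ a₁
  refine (elasticDist_le σ a₁ a₀ hψ).trans ?_
  rw [he]
  exact hlt.le

theorem elasticDist_comm (hσ : 1 ≤ 2 * σ) (h₀ : a₀ ∈ unitTangents d) (h₁ : a₁ ∈ unitTangents d) :
    elasticDist σ a₀ a₁ = elasticDist σ a₁ a₀ :=
  le_antisymm (elasticDist_le_swap hσ h₁ h₀) (elasticDist_le_swap hσ h₀ h₁)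

open InnerProductGeometry in
-- Monotonicity of the cosine does not suffice, since `p/2σ` may exceed `π`. Besides `q ≤ p`, the
-- triangle inequality through `-y` gives `p + q ≤ 2π`; with `2σ ≥ 1` both sines in the product
-- formula for `cos (q/2σ) - cos (p/2σ)` are then nonnegative.
theorem cos_angle_add_angle_le {V : Type*} [NormedAddCommGroup V] [InnerProductSpace ℝ V]
    (hσ : 1 ≤ 2 * σ) (x y z : V) :
    Real.cos ((angle x y + angle y z) / (2 * σ)) ≤ Real.cos (angle x z / (2 * σ)) := by
  have h1 := angle_le_angle_add_angle x y z
  have h2 := angle_le_angle_add_angle x (-y) z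
  rw [angle_neg_right, angle_neg_left] at h2
  have hxz := angle_nonneg x z
  have hxz' := angle_le_pi x z
  have hσ0 : 0 < 2 * σ := by linarith
  set p := angle x y + angle y z
  set q := angle x z
  rw [← sub_nonneg, Real.cos_sub_cos, neg_mul, neg_mul, ← mul_neg, ← Real.sin_neg]
  refine mul_nonneg (mul_nonneg zero_le_two (Real.sin_nonneg_of_nonneg_of_le_pi ?_ ?_))
    (Real.sin_nonneg_of_nonneg_of_le_pi ?_ ?_)
  · have : 0 ≤ p := by linarith
    positivity
  · rw [← add_div, div_div, div_le_iff₀ (by positivity)]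
    nlinarith [Real.pi_pos]
  · rw [← sub_div, div_div, ← neg_div]
    exact div_nonneg (by linarith) (by positivity)
  · rw [← sub_div, div_div, ← neg_div, div_le_iff₀ (by positivity)]
    nlinarith [Real.pi_pos]

/-- The triangle inequality for angles between three unit vectors of `L²(Ω, ℝ²)`. The outer pair
involves `cos ((ω₀₁ + ω₁₂)/2σ)`, which `cos_angle_add_angle_le` bounds by `cos (ω₀₂/2σ)`. -/
theorem rho_comp_le (hσ : 1 ≤ 2 * σ) (h₀ : a₀ ∈ unitTangents d) (h₁ : a₁ ∈ unitTangents d)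
    (h₂ : a₂ ∈ unitTangents d) (hφ : IsClassicalDiffeo 1 φ) (hψ : IsClassicalDiffeo 1 ψ) :
    rho σ a₀ a₂ (fun s => ψ (φ s)) ≤ rho σ a₀ a₁ φ + rho σ a₁ a₂ ψ := by
  have hφd := hφ.isDiffeo
  have hχ := hψ.comp hφ
  have hχd := hχ.isDiffeo
  have hm1 : AEMeasurable (fun s => -omega a₀ a₁ φ s) lebOmega := (aemeasurable_omega h₀ h₁ hφd).neg
  have hm2 : AEMeasurable (fun s => omega a₁ a₂ ψ (φ s)) lebOmega :=
    Real.continuous_arccos.measurable.comp_aemeasurable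
      ((aemeasurable_comp_diffeo h₁.1 hφd).inner (aemeasurable_comp_diffeo h₂.1 hχd))
  -- Planar angles are measured from the middle point: `-ω₀₁`, `0` and `ω₁₂ ∘ φ`, with densities
  -- `1`, `φ'` and `(ψ ∘ φ)'`. The two angles thus add up between the first and the last.
  have m0 := memLp_sqrtTransform σ (integrable_const (1 : ℝ)) hm1
  have m1 := memLp_sqrtTransform σ hφd.integrable (aemeasurable_const (b := (0 : ℝ)))
  have m2 := memLp_sqrtTransform σ hχd.integrable hm2
  have n0 := norm_toLp_sqrtTransform m0 (Eventually.of_forall fun _ => zero_le_one) (by simp)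
  have n1 := norm_toLp_sqrtTransform m1 (hφd.deriv_pos.mono fun s hs => hs.le) hφd.integral_deriv
  have n2 := norm_toLp_sqrtTransform m2 (hχd.deriv_pos.mono fun s hs => hs.le) hχd.integral_deriv
  have h := InnerProductGeometry.angle_le_angle_add_angle (m0.toLp _) (m1.toLp _) (m2.toLp _)
  simp only [InnerProductGeometry.angle, n0, n1, n2, mul_one, div_one] at h
  have e1 : inner ℝ (m0.toLp _) (m1.toLp _) = corr σ a₀ a₁ φ := by
    rw [inner_toLp_sqrtTransform]
    refine integral_congr_ae (Eventually.of_forall fun s => ?_)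
    simp [neg_div]
  have e2 : inner ℝ (m1.toLp _) (m2.toLp _) = corr σ a₁ a₂ ψ := by
    -- Moving `corr σ a₁ a₂ ψ` to the variable of `φ` matches the weights: `√φ' √((ψ ∘ φ)') = φ'
    -- √(ψ' ∘ φ)`.
    rw [inner_toLp_sqrtTransform, corr,
      hφ.integral_comp fun s => √(deriv ψ s) * Real.cos (omega a₁ a₂ ψ s / (2 * σ))]
    refine integral_congr_ae ?_
    filter_upwards [ae_mem_Ioo] with s hs
    have hp := (hφ.deriv_pos_of_mem_Ioo hs).le
    rw [hψ.deriv_comp hφ hs, zero_div, zero_sub, Real.cos_neg, Real.sqrt_mul'  _ hp,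
      ← mul_assoc (deriv φ s)]
    congr 1
    rw [mul_comm, mul_assoc, Real.mul_self_sqrt hp, mul_comm]
  have e3 : inner ℝ (m0.toLp _) (m2.toLp _) ≤ corr σ a₀ a₂ fun s => ψ (φ s) := by
    rw [inner_toLp_sqrtTransform]
    refine integral_mono_ae ?_ (integrable_corr σ h₀ h₂ hχd) ?_
    · simp only [Real.sqrt_one, one_mul]
      refine (integrable_sqrt_deriv hχd).mul_bdd (c := 1)
        (Real.continuous_cos.measurable.comp_aemeasurable
          ((hm1.div_const _).sub (hm2.div_const _))).aestronglyMeasurable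
        (Eventually.of_forall fun s => Real.abs_cos_le_one _)
    · filter_upwards [ae_mem_Icc] with s hs
      have u1 := h₁.2 _ (hφd.mapsTo hs)
      have u2 := h₂.2 _ (hχd.mapsTo hs)
      rw [Real.sqrt_one, one_mul]
      refine mul_le_mul_of_nonneg_left ?_ (Real.sqrt_nonneg _)
      have w1 : omega a₀ a₁ φ s = _ := omega_eq_angle (h₀.2 s hs) u1
      have w2 : omega a₁ a₂ ψ (φ s) = _ := omega_eq_angle u1 u2
      have w3 : omega a₀ a₂ (fun s => ψ (φ s)) s = _ := omega_eq_angle (h₀.2 s hs) u2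
      rw [w1, w2, w3, ← sub_div, ← neg_add', neg_div, Real.cos_neg]
      exact cos_angle_add_angle_le hσ _ _ _
  rw [e1, e2] at h
  exact (Real.arccos_le_arccos e3).trans h

theorem elasticDist_triangle (hσ : 1 ≤ 2 * σ) (h₀ : a₀ ∈ unitTangents d)
    (h₁ : a₁ ∈ unitTangents d) (h₂ : a₂ ∈ unitTangents d) :
    elasticDist σ a₀ a₂ ≤ elasticDist σ a₀ a₁ + elasticDist σ a₁ a₂ := by
  refine le_of_forall_pos_le_add fun ε hε => ?_
  obtain ⟨φ, hφ, hlt⟩ := exists_classical_rho_lt hσ h₀ h₁ (half_pos hε)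
  obtain ⟨ψ, hψ, hlt'⟩ := exists_classical_rho_lt hσ h₁ h₂ (half_pos hε)
  have h1 := elasticDist_le σ a₀ a₂ (hψ.comp hφ).isDiffeo
  have h2 := rho_comp_le hσ h₀ h₁ h₂ hφ hψ
  linarith

end Metamorphosis

theorem mainTheorem1 (d : ℕ) (hd : 2 ≤ d) (σ : ℝ) (hσ : 1 ≤ 2 * σ) :
    -- optimal energy for a given final diffeomorphism
    (∀ a₀ ∈ Metamorphosis.unitTangents d, ∀ a₁ ∈ Metamorphosis.unitTangents d,
      ∀ φ₁ : ℝ → ℝ, Metamorphosis.IsDiffeo φ₁ →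
        (⨅ T ∈ {T : Metamorphosis.Trajectory d | Metamorphosis.JoinsWith a₀ a₁ φ₁ T},
            Metamorphosis.energy σ T) =
          ENNReal.ofReal (4 * (Metamorphosis.rho σ a₀ a₁ φ₁) ^ 2) ∧
        (1 < 2 * σ → ∃ T : Metamorphosis.Trajectory d,
          Metamorphosis.JoinsWith a₀ a₁ φ₁ T ∧
          Metamorphosis.energy σ T =
            ENNReal.ofReal (4 * (Metamorphosis.rho σ a₀ a₁ φ₁) ^ 2) ∧
          Metamorphosis.IsGreatCircleLift σ a₀ a₁ φ₁ T)) ∧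
    -- minimizing over the final diffeomorphism gives `d_σ`
    (∀ a₀ ∈ Metamorphosis.unitTangents d, ∀ a₁ ∈ Metamorphosis.unitTangents d,
      (⨅ T ∈ {T : Metamorphosis.Trajectory d | Metamorphosis.Joins a₀ a₁ T},
          Metamorphosis.energy σ T) =
        ENNReal.ofReal ((Metamorphosis.elasticDist σ a₀ a₁) ^ 2) ∧
      ∀ n : ℕ∞, 1 ≤ n →
        Metamorphosis.elasticDist σ a₀ a₁ =
          2 * ⨅ φ₁ : {φ : ℝ → ℝ // Metamorphosis.IsClassicalDiffeo n φ},
            Metamorphosis.rho σ a₀ a₁ φ₁.1) ∧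
    -- `d_σ` is a distance on `M`
    (∀ a₀ ∈ Metamorphosis.unitTangents d, ∀ a₁ ∈ Metamorphosis.unitTangents d,
      0 ≤ Metamorphosis.elasticDist σ a₀ a₁ ∧
      (Metamorphosis.elasticDist σ a₀ a₁ = 0 ↔ a₀ =ᵐ[Metamorphosis.lebOmega] a₁) ∧
      Metamorphosis.elasticDist σ a₀ a₁ = Metamorphosis.elasticDist σ a₁ a₀ ∧
      ∀ a₂ ∈ Metamorphosis.unitTangents d,
        Metamorphosis.elasticDist σ a₀ a₂ ≤
          Metamorphosis.elasticDist σ a₀ a₁ + Metamorphosis.elasticDist σ a₁ a₂) := by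
  refine ⟨fun a₀ h₀ a₁ h₁ φ₁ h => ⟨Metamorphosis.iInf_energy_joinsWith hd hσ h₀ h₁ h, fun hσ1 =>
    Metamorphosis.exists_greatCircle_trajectory hd hσ1 h₀ h₁ h⟩, fun a₀ h₀ a₁ h₁ =>
    ⟨Metamorphosis.iInf_energy_joins hd hσ h₀ h₁, fun n hn =>
      Metamorphosis.elasticDist_eq_iInf_classical hσ h₀ h₁ hn⟩, fun a₀ h₀ a₁ h₁ =>
    ⟨Metamorphosis.elasticDist_nonneg σ a₀ a₁, Metamorphosis.elasticDist_eq_zero_iff hσ h₀ h₁,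
      Metamorphosis.elasticDist_comm hσ h₀ h₁, fun a₂ h₂ =>
      Metamorphosis.elasticDist_triangle hσ h₀ h₁ h₂⟩⟩
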